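/- Let $\mathbb D$ be the open unit disc and $\mathbb T=\partial\mathbb D$ the unit circle. An \emph{inner function} is a bounded analytic function $I$ on $\mathbb D$ that has radial limits of modulus $1$ at almost every point of $\mathbb T$; a \emph{singular inner function} is an inner function without zeros in $\mathbb D$. The \emph{singular set} of an inner function is the set of points of $\mathbb T$ at which it cannot be extended analytically. Let $\rho(z,w)=\left|\frac{z-w}{1-\overline{w}z}\right|$ be the pseudohyperbolic distance on $\mathbb D$, let $Z(I)$ be the zero set of $I$ in $\mathbb D$, and put $\rho(z,Z(I))=\inf_{w\in Z(I)}\rho(z,w)$ (with $\inf\varnothing=+\infty$). An inner function $I$ satisfies the \emph{Weak Embedding Property (WEP)} if for every $\varepsilon>0$ $$\eta_I(\varepsilon)=\inf\{|I(z)| : z\in\mathbb D,\ \rho(z,Z(I))>\varepsilon\}>0 ,$$ and $I$ is called \emph{wepable} if there is an inner function $J$ such that $IJ$ satisfies the WEP. For $A\subset\mathbb T$ let $|A|$ denote its normalised length, $|\mathbb T|=1$. **Theorem.** Let $E$ be a closed subset of the unit circle $\mathbb T$. The following conditions are equivalent: (a) Every singular inner function whose singular set is contained in $E$ is wepable; (b)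 $E$ has zero length and finite entropy (that is, $E$ is a Beurling–Carleson set): $|E|=0$ and $$\sum_k |J_k|\log |J_k|^{-1}<\infty ,$$ where $(J_k)_k$ are the connected components of $\mathbb T\setminus E$. -/

import Mathlib

open Set Filter Topology MeasureTheory
open scoped ENNReal ComplexConjugate

noncomputable section

namespace Wepable

/-- The open unit disc. Functions on the disc are represented by functions `ℂ → ℂ`,
of which only the values on `disc` are used. -/
def disc : Set ℂ := Metric.ball 0 1

/-- `I` is an inner function: a bounded analytic function on the unit disc that has radial limits
of modulus `1` at almost every point of the unit circle. -/
structure IsInner (I : ℂ → ℂ) : Prop where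
  analytic : DifferentiableOn ℂ I disc
  bounded : ∃ C : ℝ, ∀ z ∈ disc, ‖I z‖ ≤ C
  radial_limit : ∀ᵐ θ : ℝ, ∃ w : ℂ, ‖w‖ = 1 ∧
    Tendsto (fun r : ℝ => I (r * (Circle.exp θ : ℂ))) (𝓝[<] 1) (𝓝 w)

/-- `S` is a singular inner function: an inner function without zeros in the unit disc. -/
structure IsSingularInner (S : ℂ → ℂ) : Prop extends IsInner S where
  ne_zero : ∀ z ∈ disc, S z ≠ 0

/-- The singular set `sing(I)`: the points of the unit circle at which `I` has no analytic
extension, i.e. near which it does not agree, inside the disc, with a function analytic there. -/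
def singularSet (I : ℂ → ℂ) : Set Circle :=
  {ζ | ¬ ∃ g : ℂ → ℂ, AnalyticAt ℂ g (ζ : ℂ) ∧ ∀ᶠ z in 𝓝[disc] (ζ : ℂ), I z = g z}

/-- The zero set `Z(I)` of `I` in the unit disc. -/
def zeroSet (I : ℂ → ℂ) : Set ℂ := {z ∈ disc | I z = 0}

/-- The pseudohyperbolic distance between two points of the unit disc. -/
def pseudoDist (z w : ℂ) : ℝ := ‖(z - w) / (1 - conj w * z)‖

/-- The pseudohyperbolic distance from `z` to the set `A`; it is `∞` if `A` is empty. -/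
def pseudoInfDist (z : ℂ) (A : Set ℂ) : ℝ≥0∞ := ⨅ w ∈ A, ENNReal.ofReal (pseudoDist z w)

/-- `η_I(ε) = inf {|I(z)| : z ∈ 𝔻, ρ(z, Z(I)) > ε}`, which is `∞` if there is no such `z`. -/
def eta (I : ℂ → ℂ) (ε : ℝ) : ℝ≥0∞ :=
  ⨅ z ∈ {z ∈ disc | ENNReal.ofReal ε < pseudoInfDist z (zeroSet I)}, ‖I z‖ₑ

/-- The Weak Embedding Property. -/
def WEP (I : ℂ → ℂ) : Prop := ∀ ε : ℝ, 0 < ε → 0 < eta I ε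

/-- `I` is wepable: it is a factor of an inner function with the Weak Embedding Property. -/
def IsWepable (I : ℂ → ℂ) : Prop := ∃ J : ℂ → ℂ, IsInner J ∧ WEP (fun z => I z * J z)

/-- The normalised length of a subset of the unit circle (the whole circle has length `1`). -/
def arcLength (A : Set Circle) : ℝ≥0∞ :=
  volume {t : ℝ | t ∈ Ico 0 1 ∧ Circle.exp (2 * Real.pi * t) ∈ A}

/-- The set of connected components of the complement of `E` in the unit circle. -/
def complementaryArcs (E : Set Circle) : Set (Set Circle) :=
  {J | ∃ ζ ∈ Eᶜ, J = connectedComponentIn Eᶜ ζ}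

/-- The entropy `∑ |J| log |J|⁻¹` over the connected components `J` of the complement of `E`;
all the terms are nonnegative, since `|J| ≤ 1`. -/
def entropy (E : Set Circle) : ℝ≥0∞ :=
  ∑' J : complementaryArcs E,
    ENNReal.ofReal ((arcLength J.1).toReal * Real.log ((arcLength J.1).toReal)⁻¹)

end Wepable

end

noncomputable section

namespace Wepable

/-! Necessity rests on `metSum`, the total length of all dyadic intervals that meet the lift of `E`.
If it is finite, then `E` is null, and the entropy is at most this sum: a dyadic interval containing
a point of a complementary arc and longer than that arc must meet `E` (`entropy_le_metSum`). If it
is infinite, it stays infinite along a nested sequence of dyadic intervals. Point masses on `E`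
inside these intervals, with growing weights, form a finite measure carried by a countable closed
set. For every `k` this measure gives mass at least `k` times the length to finitely many dyadic
intervals of total length at least `k` (`exists_heavy_measure`). Its singular inner function is at
most `exp (-k / 32)` at the point of the disc above each of them. If the product with an inner `J`
had the WEP, then for large `k` the function `J` would have zeros close to all these points. The
zeros would be distinct and the sum of `1 - ‖w‖` over them at least `k / 4`, against the Blaschke
condition (`not_isWepable_of_heavy`).

Sufficiency uses one Blaschke product that depends on `E` only. Let `d` be the distance to `E`. By
the Poisson formula `-log ‖S z‖` is at most a constant times `(1 - ‖z‖) / d ^ 2`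
(`IsSingularInner.neg_log_norm_le`), so `S` can be small only in parabolic regions `A * d ^ 2 ≤ 1 -
‖z‖`. For each `q`, the part near the circle of such a region, of aperture `A = gridAperture q`, is
filled with a grid of zeros of pseudohyperbolic mesh about `1 / q`. At height `4 ^ (-n)` the region
lies over a neighbourhood of `E` of size about `2 ^ (-n)`. The lengths of these neighbourhoods are
summable exactly because `E` is a Beurling–Carleson set (`tsum_volume_layer_lt_top`), so starting
each grid at a late enough level gives the Blaschke condition.

A point at pseudohyperbolic distance more than `ε` from all zeros is, when `10 / q < ε`, either at a
fixed distance from the circle or outside the region of aperture `16 * gridAperture q`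
(`exists_gridSel_near`). In both cases `S` is bounded below, and so is the Blaschke product, because
the sum of `1 - ρ ^ 2` over its zeros is bounded (`tsum_one_sub_pseudoDist_sq_le`). The factor `q ^
2` in the aperture pays for the density of the grid and the factor `2 ^ q` makes the grids summable.
-/

/-! ### Pseudohyperbolic geometry and the Blaschke condition -/

theorem mem_disc {z : ℂ} : z ∈ disc ↔ ‖z‖ < 1 := by simp [disc]

theorem isOpen_disc : IsOpen disc := Metric.isOpen_ball

theorem one_sub_norm_le_norm_one_sub_conj_mul {z w : ℂ} (hw : ‖w‖ ≤ 1) :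
    1 - ‖z‖ ≤ ‖1 - conj w * z‖ := by
  have h := norm_sub_norm_le (1 : ℂ) (conj w * z)
  rw [norm_one, norm_mul, RCLike.norm_conj] at h
  nlinarith [norm_nonneg z, mul_le_mul_of_nonneg_right hw (norm_nonneg z)]

theorem one_sub_conj_mul_ne_zero {z w : ℂ} (hz : ‖z‖ < 1) (hw : ‖w‖ ≤ 1) :
    1 - conj w * z ≠ 0 := by
  have h := one_sub_norm_le_norm_one_sub_conj_mul (z := z) hw
  exact norm_pos_iff.1 (by linarith)

theorem norm_one_sub_conj_mul_sq_sub (z w : ℂ) :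
    ‖1 - conj w * z‖ ^ 2 - ‖z - w‖ ^ 2 = (1 - ‖z‖ ^ 2) * (1 - ‖w‖ ^ 2) := by
  simp only [← Complex.normSq_eq_norm_sq, Complex.normSq_apply, Complex.sub_re, Complex.sub_im,
    Complex.mul_re, Complex.mul_im, Complex.one_re, Complex.one_im, Complex.conj_re,
    Complex.conj_im]
  ring

theorem norm_sub_le_norm_one_sub_conj_mul {z w : ℂ} (hz : ‖z‖ ≤ 1) (hw : ‖w‖ ≤ 1) :
    ‖z - w‖ ≤ ‖1 - conj w * z‖ := by
  have h := norm_one_sub_conj_mul_sq_sub z w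
  have h1 : 0 ≤ (1 - ‖z‖ ^ 2) * (1 - ‖w‖ ^ 2) :=
    mul_nonneg (by nlinarith [norm_nonneg z]) (by nlinarith [norm_nonneg w])
  exact (pow_le_pow_iff_left₀ (norm_nonneg _) (norm_nonneg _) two_ne_zero).1 (by linarith)

theorem pseudoDist_nonneg (z w : ℂ) : 0 ≤ pseudoDist z w := norm_nonneg _

theorem pseudoDist_le_one {z w : ℂ} (hz : ‖z‖ ≤ 1) (hw : ‖w‖ ≤ 1) : pseudoDist z w ≤ 1 := by
  rw [pseudoDist, norm_div]
  exact div_le_one_of_le₀ (norm_sub_le_norm_one_sub_conj_mul hz hw) (norm_nonneg _)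

theorem one_sub_pseudoDist_sq {z w : ℂ} (hz : ‖z‖ < 1) (hw : ‖w‖ < 1) :
    1 - pseudoDist z w ^ 2 = (1 - ‖z‖ ^ 2) * (1 - ‖w‖ ^ 2) / ‖1 - conj w * z‖ ^ 2 := by
  have h := norm_one_sub_conj_mul_sq_sub z w
  have h0 := norm_pos_iff.2 (one_sub_conj_mul_ne_zero hz hw.le)
  rw [pseudoDist, norm_div, ← h, div_pow, sub_div, div_self (pow_ne_zero 2 h0.ne')]

/-- A bounded analytic function with a zero at `w` is dominated by the Blaschke factor of `w`. -/
theorem norm_le_pseudoDist_of_eq_zero {f : ℂ → ℂ} (hf : DifferentiableOn ℂ f disc)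
    (hb : ∀ z ∈ disc, ‖f z‖ ≤ 1) {w : ℂ} (hw : w ∈ disc) (h0 : f w = 0) {z : ℂ} (hz : z ∈ disc) :
    ‖f z‖ ≤ pseudoDist z w := by
  have hw' := mem_disc.1 hw
  have hz' := mem_disc.1 hz
  set φ : ℂ → ℂ := fun u => (u + w) / (1 + conj w * u) with hφ
  have hden : ∀ u ∈ disc, 1 + conj w * u ≠ 0 := fun u hu => by
    have := one_sub_conj_mul_ne_zero (z := -u) (w := w) (by simpa using mem_disc.1 hu) hw'.le
    simpa using this
  have hmaps : MapsTo φ disc disc := fun u hu => by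
    have hu' := mem_disc.1 hu
    rw [mem_disc, hφ]
    simp only [norm_div]
    have h1 := norm_one_sub_conj_mul_sq_sub (-u) w
    rw [show -u - w = -(u + w) by ring, norm_neg, norm_neg, show 1 - conj w * -u = 1 + conj w * u by
      ring] at h1
    rw [div_lt_one (norm_pos_iff.2 (hden u hu))]
    have h2 : 0 < (1 - ‖u‖ ^ 2) * (1 - ‖w‖ ^ 2) :=
      mul_pos (by nlinarith [norm_nonneg u]) (by nlinarith [norm_nonneg w])
    exact lt_of_pow_lt_pow_left₀ 2 (norm_nonneg _) (by linarith)
  have hd : DifferentiableOn ℂ (f ∘ φ) (Metric.ball 0 1) := by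
    refine hf.comp ?_ hmaps
    exact DifferentiableOn.div (by fun_prop) (by fun_prop) hden
  have hm : MapsTo (f ∘ φ) (Metric.ball 0 1) (Metric.closedBall 0 1) := fun u hu => by
    simpa using hb _ (hmaps hu)
  have hu : ‖(z - w) / (1 - conj w * z)‖ < 1 := by
    have h1 := norm_one_sub_conj_mul_sq_sub z w
    rw [norm_div, div_lt_one (norm_pos_iff.2 (one_sub_conj_mul_ne_zero hz' hw'.le))]
    have h2 : 0 < (1 - ‖z‖ ^ 2) * (1 - ‖w‖ ^ 2) :=
      mul_pos (by nlinarith [norm_nonneg z]) (by nlinarith [norm_nonneg w])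
    exact lt_of_pow_lt_pow_left₀ 2 (norm_nonneg _) (by linarith)
  -- The Schwarz lemma for `f ∘ φ`, where the disc automorphism `φ` sends `0` to `w`.
  have key := Complex.norm_le_norm_of_mapsTo_ball hd hm (by simp [φ, h0]) hu
  have h1 := one_sub_conj_mul_ne_zero hz' hw'.le
  have hinv : φ ((z - w) / (1 - conj w * z)) = z := by
    have h2 := hden _ (mem_disc.2 hu)
    rw [hφ]
    simp only
    rw [div_eq_iff h2]
    have h3 : (z - w) / (1 - conj w * z) * (1 - conj w * z) = z - w := div_mul_cancel₀ _ h1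
    linear_combination h3
  rw [Function.comp_apply, hinv] at key
  exact key

theorem differentiableOn_dslope_disc {f : ℂ → ℂ} (hf : DifferentiableOn ℂ f disc) {w : ℂ}
    (hw : w ∈ disc) : DifferentiableOn ℂ (dslope f w) disc :=
  (Complex.differentiableOn_dslope (isOpen_disc.mem_nhds hw)).2 hf

/-- A zero of a bounded analytic function can be divided out by a Blaschke factor. -/
theorem exists_eq_blaschke_mul {f : ℂ → ℂ} (hf : DifferentiableOn ℂ f disc)
    (hb : ∀ z ∈ disc, ‖f z‖ ≤ 1) {w : ℂ} (hw : w ∈ disc) (h0 : f w = 0) :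
    ∃ g : ℂ → ℂ, DifferentiableOn ℂ g disc ∧ (∀ z ∈ disc, ‖g z‖ ≤ 1) ∧
      ∀ z ∈ disc, f z = (z - w) / (1 - conj w * z) * g z := by
  have hw' := mem_disc.1 hw
  have hg : DifferentiableOn ℂ (fun z => dslope f w z * (1 - conj w * z)) disc :=
    (differentiableOn_dslope_disc hf hw).mul (by fun_prop)
  have heq : ∀ z ∈ disc, f z =
      (z - w) / (1 - conj w * z) * (dslope f w z * (1 - conj w * z)) := fun z hz => by
    have h1 := one_sub_conj_mul_ne_zero (mem_disc.1 hz) hw'.le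
    have h2 := sub_smul_dslope f w z
    rw [h0, sub_zero, smul_eq_mul] at h2
    rw [← h2, mul_comm (dslope f w z), ← mul_assoc, div_mul_cancel₀ _ h1]
  refine ⟨_, hg, ?_, heq⟩
  have hne : ∀ z ∈ disc, z ≠ w → ‖dslope f w z * (1 - conj w * z)‖ ≤ 1 := fun z hz hzw => by
    have h1 := norm_le_pseudoDist_of_eq_zero hf hb hw h0 hz
    rw [heq z hz, norm_mul] at h1
    have h2 : 0 < ‖(z - w) / (1 - conj w * z)‖ :=
      norm_pos_iff.2 (div_ne_zero (sub_ne_zero.2 hzw)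
        (one_sub_conj_mul_ne_zero (mem_disc.1 hz) hw'.le))
    exact le_of_mul_le_mul_left (by simpa [pseudoDist] using h1) h2
  intro z hz
  by_cases hzw : z = w
  · subst hzw
    -- At the zero itself the domination by the Blaschke factor says nothing; the bound there comes
    -- by continuity.
    have hc : Tendsto (fun u => ‖dslope f z u * (1 - conj z * u)‖) (𝓝[≠] z)
        (𝓝 ‖dslope f z z * (1 - conj z * z)‖) :=
      ((hg.differentiableAt (isOpen_disc.mem_nhds hz)).continuousAt.norm).tendsto.mono_left
        nhdsWithin_le_nhds
    refine le_of_tendsto hc ?_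
    filter_upwards [self_mem_nhdsWithin, mem_nhdsWithin_of_mem_nhds (isOpen_disc.mem_nhds hz)]
      with u hu hud using hne u hud hu
  · exact hne z hz hzw

/-- Divide out one zero at a time: the points of `F` are distinct, so the remaining ones are still
zeros of the quotient, which is again bounded by `1`. -/
theorem norm_le_prod_pseudoDist {f : ℂ → ℂ} (hf : DifferentiableOn ℂ f disc)
    (hb : ∀ z ∈ disc, ‖f z‖ ≤ 1) (F : Finset ℂ) (hF : ∀ w ∈ F, w ∈ disc ∧ f w = 0) {p : ℂ}
    (hp : p ∈ disc) : ‖f p‖ ≤ ∏ w ∈ F, pseudoDist p w := by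
  classical
  induction F using Finset.induction_on generalizing f with
  | empty => simpa using hb p hp
  | insert w F hwF ih =>
    obtain ⟨hw, h0⟩ := hF w (Finset.mem_insert_self _ _)
    obtain ⟨g, hg, hgb, hfg⟩ := exists_eq_blaschke_mul hf hb hw h0
    rw [Finset.prod_insert hwF, hfg p hp, norm_mul]
    refine mul_le_mul_of_nonneg_left (ih hg hgb fun v hv => ?_) (norm_nonneg _)
    obtain ⟨hv1, hv2⟩ := hF v (Finset.mem_insert_of_mem hv)
    refine ⟨hv1, ?_⟩
    rw [hfg v hv1] at hv2
    refine (mul_eq_zero.1 hv2).resolve_left (div_ne_zero (sub_ne_zero.2 ?_)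
      (one_sub_conj_mul_ne_zero (mem_disc.1 hv1) (mem_disc.1 hw).le))
    rintro rfl
    exact hwF hv

/-- The **Blaschke condition**: the zeros of a bounded analytic function `f ≢ 0` are summable. -/
theorem exists_sum_one_sub_norm_le {f : ℂ → ℂ} (hf : DifferentiableOn ℂ f disc)
    (hb : ∀ z ∈ disc, ‖f z‖ ≤ 1) {p : ℂ} (hp : p ∈ disc) (hfp : f p ≠ 0) :
    ∃ C : ℝ, ∀ F : Finset ℂ, (∀ w ∈ F, w ∈ disc ∧ f w = 0) → ∑ w ∈ F, (1 - ‖w‖) ≤ C := by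
  have hp' := mem_disc.1 hp
  have hp2 : 0 < 1 - ‖p‖ ^ 2 := by nlinarith [norm_nonneg p]
  refine ⟨4 * (-Real.log (‖f p‖ ^ 2)) / (1 - ‖p‖ ^ 2), fun F hF => ?_⟩
  have h1 := norm_le_prod_pseudoDist hf hb F hF hp
  have h2 : ‖f p‖ ^ 2 ≤ Real.exp (-∑ w ∈ F, (1 - pseudoDist p w ^ 2)) := by
    calc ‖f p‖ ^ 2 ≤ (∏ w ∈ F, pseudoDist p w) ^ 2 := by gcongr
      _ = ∏ w ∈ F, pseudoDist p w ^ 2 := (Finset.prod_pow _ _ _).symm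
      _ ≤ ∏ w ∈ F, Real.exp (-(1 - pseudoDist p w ^ 2)) := by
          refine Finset.prod_le_prod (fun _ _ => sq_nonneg _) fun w _ => ?_
          have := Real.add_one_le_exp (-(1 - pseudoDist p w ^ 2))
          linarith
      _ = _ := by rw [← Real.exp_sum, Finset.sum_neg_distrib]
  have h3 := Real.log_le_log (by positivity) h2
  rw [Real.log_exp] at h3
  rw [le_div_iff₀ hp2, Finset.sum_mul]
  have h4 : ∑ w ∈ F, (1 - ‖w‖) * (1 - ‖p‖ ^ 2) ≤ ∑ w ∈ F, 4 * (1 - pseudoDist p w ^ 2) := by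
    refine Finset.sum_le_sum fun w hw => ?_
    have hw' := mem_disc.1 (hF w hw).1
    rw [one_sub_pseudoDist_sq hp' hw']
    have h5 := norm_pos_iff.2 (one_sub_conj_mul_ne_zero hp' hw'.le)
    have h6 : ‖1 - conj w * p‖ ≤ 2 := by
      calc ‖1 - conj w * p‖ ≤ ‖(1 : ℂ)‖ + ‖conj w * p‖ := norm_sub_le _ _
        _ ≤ 1 + 1 * 1 := by
          rw [norm_one, norm_mul, RCLike.norm_conj]
          gcongr
        _ = 2 := by norm_num
    rw [mul_div_assoc', le_div_iff₀ (by positivity)]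
    have h7 : ‖1 - conj w * p‖ ^ 2 ≤ 4 := by nlinarith
    have h8 : 0 ≤ (1 - ‖w‖) * (1 - ‖p‖ ^ 2) := mul_nonneg (by linarith) hp2.le
    have h9 : (1 - ‖w‖) * (1 - ‖p‖ ^ 2) ≤ (1 - ‖p‖ ^ 2) * (1 - ‖w‖ ^ 2) := by
      nlinarith [norm_nonneg w, mul_nonneg (norm_nonneg w) (sub_nonneg.2 hw'.le)]
    nlinarith
  rw [← Finset.mul_sum] at h4
  linarith

/-! ### Poisson kernel and the maximum principle for inner functions -/

theorem poissonKernel_nonneg {w ζ : ℂ} {r : ℝ} (hw : ‖w‖ ≤ r) (hζ : ‖ζ‖ = r) :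
    0 ≤ poissonKernel 0 w ζ := by
  rw [poissonKernel_def, sub_zero, sub_zero, hζ]
  have := norm_nonneg w
  exact div_nonneg (by nlinarith) (sq_nonneg _)

theorem continuousOn_poissonKernel {w : ℂ} {r : ℝ} (hw : ‖w‖ < r) :
    ContinuousOn (poissonKernel 0 w) (Metric.sphere 0 r) := by
  have : poissonKernel 0 w = fun z => (‖z - 0‖ ^ 2 - ‖w - 0‖ ^ 2) / ‖(z - 0) - (w - 0)‖ ^ 2 := by
    ext z; rw [poissonKernel_def]
  rw [this]
  refine ContinuousOn.div (by fun_prop) (by fun_prop) fun z hz => ?_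
  have hz' : ‖z‖ = r := by simpa using hz
  have : z - w ≠ 0 := by
    rw [sub_ne_zero]
    rintro rfl
    linarith
  simpa using this

theorem circleAverage_poissonKernel {w : ℂ} {r : ℝ} (hw : ‖w‖ < r) :
    Real.circleAverage (poissonKernel 0 w) 0 r = 1 := by
  have h := InnerProductSpace.HarmonicOnNhd.circleAverage_poissonKernel_smul
    (f := fun _ : ℂ => (1 : ℝ)) (c := 0) (w := w) (R := r)
    (fun z _ => (InnerProductSpace.harmonicAt_const 1)) (by simpa using hw)
  rw [← h]
  congr 1
  ext z
  simp

theorem circle_exp_eq_circleMap (θ : ℝ) : (Circle.exp θ : ℂ) = circleMap 0 1 θ := by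
  simp [circleMap, Circle.coe_exp]

/-- The bound `C` in the definition is arbitrary. The Poisson formula for the dilates of `I`, with
dominated convergence as `r → 1`, replaces it by the boundary modulus. -/
theorem IsInner.norm_le_one {I : ℂ → ℂ} (hI : IsInner I) {z : ℂ} (hz : z ∈ disc) : ‖I z‖ ≤ 1 := by
  have hz' := mem_disc.1 hz
  obtain ⟨C, hC⟩ := hI.bounded
  have hP : Continuous fun θ : ℝ => poissonKernel 0 z (circleMap 0 1 θ) :=
    (continuousOn_poissonKernel hz').comp_continuous (continuous_circleMap 0 1)
      fun θ => circleMap_mem_sphere 0 zero_le_one θ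
  have hP0 : ∀ θ : ℝ, 0 ≤ poissonKernel 0 z (circleMap 0 1 θ) := fun θ =>
    poissonKernel_nonneg hz'.le (by simp)
  have hmem : ∀ r ∈ Ioo (0 : ℝ) 1, ∀ ζ : ℂ, ‖ζ‖ ≤ 1 → (r : ℂ) * ζ ∈ disc := fun r hr ζ hζ => by
    rw [mem_disc, norm_mul, Complex.norm_real, Real.norm_of_nonneg hr.1.le]
    nlinarith [hr.1, hr.2, norm_nonneg ζ]
  have hle : ∀ r ∈ Ioo (0 : ℝ) 1, ‖I (r * z)‖ ≤ (2 * Real.pi)⁻¹ *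
      ∫ θ in (0 : ℝ)..2 * Real.pi, poissonKernel 0 z (circleMap 0 1 θ) *
        ‖I (r * circleMap 0 1 θ)‖ := fun r hr => by
    have hd : DifferentiableOn ℂ (fun ζ => I (r * ζ)) (Metric.closedBall 0 1) :=
      hI.analytic.comp (by fun_prop) fun ζ hζ => hmem r hr ζ (by simpa using hζ)
    have h1 := DiffContOnCl.circleAverage_poissonKernel_smul (c := 0) (R := 1) (w := z)
      (f := fun ζ => I (r * ζ)) ?_ (by simpa using hz')
    · rw [← h1, Real.circleAverage_def, norm_smul, Real.norm_of_nonneg (by positivity)]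
      refine mul_le_mul_of_nonneg_left ?_ (by positivity)
      refine (intervalIntegral.norm_integral_le_integral_norm (by positivity)).trans_eq ?_
      refine intervalIntegral.integral_congr fun θ _ => ?_
      simp only [Pi.smul_apply', norm_smul, Real.norm_of_nonneg (hP0 θ)]
    · refine DifferentiableOn.diffContOnCl ?_
      rwa [closure_ball _ one_ne_zero]
  have hIoo : Ioo (0 : ℝ) 1 ∈ 𝓝[<] (1 : ℝ) := Ioo_mem_nhdsLT one_pos
  have hL : Tendsto (fun r : ℝ => ‖I (r * z)‖) (𝓝[<] 1) (𝓝 ‖I z‖) := by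
    have h1 : ContinuousAt I z := (hI.analytic.differentiableAt (isOpen_disc.mem_nhds hz)).continuousAt
    have h2 : Tendsto (fun r : ℝ => (r : ℂ) * z) (𝓝[<] 1) (𝓝 z) := by
      have : Continuous fun r : ℝ => (r : ℂ) * z := by fun_prop
      simpa using (this.tendsto 1).mono_left nhdsWithin_le_nhds
    exact (h1.norm.tendsto.comp h2)
  have hR : Tendsto (fun r : ℝ => (2 * Real.pi)⁻¹ * ∫ θ in (0 : ℝ)..2 * Real.pi,
      poissonKernel 0 z (circleMap 0 1 θ) * ‖I (r * circleMap 0 1 θ)‖) (𝓝[<] 1)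
      (𝓝 ((2 * Real.pi)⁻¹ * ∫ θ in (0 : ℝ)..2 * Real.pi,
        poissonKernel 0 z (circleMap 0 1 θ) * 1)) := by
    refine Tendsto.const_mul _ ?_
    refine intervalIntegral.tendsto_integral_filter_of_dominated_convergence
      (fun θ => poissonKernel 0 z (circleMap 0 1 θ) * C) ?_ ?_ ?_ ?_
    · filter_upwards [hIoo] with r hr
      refine (hP.mul (Continuous.norm ?_)).aestronglyMeasurable
      exact hI.analytic.continuousOn.comp_continuous (by fun_prop)
        fun θ => hmem r hr _ (by simp)
    · filter_upwards [hIoo] with r hr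
      refine Eventually.of_forall fun θ _ => ?_
      rw [Real.norm_of_nonneg (mul_nonneg (hP0 θ) (norm_nonneg _))]
      exact mul_le_mul_of_nonneg_left (hC _ (hmem r hr _ (by simp))) (hP0 θ)
    · exact (hP.mul continuous_const).intervalIntegrable _ _
    · filter_upwards [hI.radial_limit] with θ hθ _
      obtain ⟨w, hw, hlim⟩ := hθ
      refine Tendsto.const_mul _ ?_
      have h2 := hlim.norm
      rw [hw] at h2
      simpa only [circle_exp_eq_circleMap] using h2
  have hone : (2 * Real.pi)⁻¹ * ∫ θ in (0 : ℝ)..2 * Real.pi,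
      poissonKernel 0 z (circleMap 0 1 θ) * 1 = 1 := by
    simp only [mul_one]
    exact circleAverage_poissonKernel hz'
  rw [hone] at hR
  refine le_of_tendsto_of_tendsto hL hR ?_
  filter_upwards [hIoo] with r hr using hle r hr

theorem IsInner.exists_ne_zero {I : ℂ → ℂ} (hI : IsInner I) : ∃ p ∈ disc, I p ≠ 0 := by
  by_contra! h
  obtain ⟨θ, w, hw, hlim⟩ := hI.radial_limit.exists
  have h0 : Tendsto (fun r : ℝ => I (r * (Circle.exp θ : ℂ))) (𝓝[<] 1) (𝓝 0) := by
    refine tendsto_const_nhds.congr' ?_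
    filter_upwards [Ioo_mem_nhdsLT (one_pos : (0 : ℝ) < 1)] with r hr
    refine (h _ ?_).symm
    rw [mem_disc, norm_mul, Complex.norm_real, Real.norm_of_nonneg hr.1.le]
    simpa using hr.2
  have := tendsto_nhds_unique hlim h0
  simp [this] at hw

/-! ### Dyadic sums and the construction of a heavy measure -/

/-- The dyadic interval of generation `n` and index `i`. -/
def dyadic (n i : ℕ) : Set ℝ := Ico ((i : ℝ) / 2 ^ n) ((i + 1 : ℝ) / 2 ^ n)

theorem mem_dyadic {n i : ℕ} {x : ℝ} :
    x ∈ dyadic n i ↔ (i : ℝ) ≤ x * 2 ^ n ∧ x * 2 ^ n < i + 1 := by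
  rw [dyadic, mem_Ico, div_le_iff₀ (by positivity), lt_div_iff₀ (by positivity)]

theorem measurableSet_dyadic (n i : ℕ) : MeasurableSet (dyadic n i) := measurableSet_Ico

theorem volume_dyadic (n i : ℕ) : volume (dyadic n i) = (2 : ℝ≥0∞)⁻¹ ^ n := by
  rw [dyadic, Real.volume_Ico, ← sub_div, add_sub_cancel_left, one_div, ← inv_pow,
    ENNReal.ofReal_pow (by positivity), ENNReal.ofReal_inv_of_pos two_pos, ENNReal.ofReal_ofNat]

theorem dyadic_subset {n m i j : ℕ} (h1 : j * 2 ^ m ≤ i) (h2 : i < (j + 1) * 2 ^ m) :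
    dyadic (n + m) i ⊆ dyadic n j := by
  intro x hx
  rw [mem_dyadic] at hx ⊢
  have h1' : (j : ℝ) * 2 ^ m ≤ i := by exact_mod_cast h1
  have h2' : (i : ℝ) + 1 ≤ (j + 1) * 2 ^ m := by exact_mod_cast h2
  rw [pow_add, ← mul_assoc] at hx
  have hm : (0 : ℝ) < 2 ^ m := by positivity
  constructor
  · exact le_of_mul_le_mul_right (h1'.trans hx.1) hm
  · exact lt_of_mul_lt_mul_right (hx.2.trans_le h2') hm.le

theorem disjoint_dyadic {n i j : ℕ} (h : i ≠ j) : Disjoint (dyadic n i) (dyadic n j) := by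
  rw [Set.disjoint_left]
  intro x hi hj
  rw [mem_dyadic] at hi hj
  have h1 : (i : ℝ) < j + 1 := hi.1.trans_lt hj.2
  have h2 : (j : ℝ) < i + 1 := hj.1.trans_lt hi.2
  norm_cast at h1 h2
  omega

theorem mem_dyadic_floor {n : ℕ} {x : ℝ} (hx : 0 ≤ x) : x ∈ dyadic n ⌊x * 2 ^ n⌋₊ :=
  mem_dyadic.2 ⟨Nat.floor_le (by positivity), Nat.lt_floor_add_one _⟩

theorem floor_lt_two_pow {n : ℕ} {x : ℝ} (hx : 0 ≤ x) (hx1 : x < 1) : ⌊x * 2 ^ n⌋₊ < 2 ^ n := by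
  rw [Nat.floor_lt (by positivity)]
  push_cast
  nlinarith [pow_pos (two_pos : (0 : ℝ) < 2) n]

theorem dyadic_eq_union (n j : ℕ) :
    dyadic n j = dyadic (n + 1) (2 * j) ∪ dyadic (n + 1) (2 * j + 1) := by
  ext x
  rw [mem_union, mem_dyadic, mem_dyadic, mem_dyadic, pow_succ, ← mul_assoc]
  push_cast
  constructor
  · rintro ⟨h1, h2⟩
    rcases lt_or_ge (x * 2 ^ n * 2) (2 * j + 1) with h | h
    · exact Or.inl ⟨by linarith, by linarith⟩
    · exact Or.inr ⟨by linarith, by linarith⟩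
  · rintro (⟨h1, h2⟩ | ⟨h1, h2⟩) <;> constructor <;> linarith

open Classical in
/-- The indices of the dyadic subintervals of `dyadic n j`, of generation `n + m`, that meet `X`. -/
def met (X : Set ℝ) (n m j : ℕ) : Finset ℕ :=
  (Finset.Ico (j * 2 ^ m) ((j + 1) * 2 ^ m)).filter fun i => (X ∩ dyadic (n + m) i).Nonempty

theorem mem_met {X : Set ℝ} {n m j i : ℕ} :
    i ∈ met X n m j ↔ (j * 2 ^ m ≤ i ∧ i < (j + 1) * 2 ^ m) ∧
      (X ∩ dyadic (n + m) i).Nonempty := by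
  simp [met]

theorem met_succ (X : Set ℝ) (n m j : ℕ) :
    met X n (m + 1) j = met X (n + 1) m (2 * j) ∪ met X (n + 1) m (2 * j + 1) := by
  ext i
  rw [Finset.mem_union, mem_met, mem_met, mem_met, show n + (m + 1) = n + 1 + m by ring, ← or_and_right]
  refine and_congr_left fun _ => ?_
  have e1 : j * 2 ^ (m + 1) = 2 * j * 2 ^ m := by ring
  have e2 : (j + 1) * 2 ^ (m + 1) = (2 * j + 1 + 1) * 2 ^ m := by ring
  have e3 : 2 * j * 2 ^ m ≤ (2 * j + 1) * 2 ^ m := by gcongr; omega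
  have e4 : (2 * j + 1) * 2 ^ m ≤ (2 * j + 1 + 1) * 2 ^ m := by gcongr; omega
  rw [e1, e2]
  omega

theorem disjoint_met (X : Set ℝ) (n m j : ℕ) :
    Disjoint (met X (n + 1) m (2 * j)) (met X (n + 1) m (2 * j + 1)) := by
  rw [Finset.disjoint_left]
  intro i h1 h2
  rw [mem_met] at h1 h2
  omega

theorem met_eq_empty {X : Set ℝ} {n j : ℕ} (h : ¬ (X ∩ dyadic n j).Nonempty) (m : ℕ) :
    met X n m j = ∅ := by
  rw [Finset.eq_empty_iff_forall_notMem]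
  intro i hi
  obtain ⟨⟨h1, h2⟩, x, hx⟩ := mem_met.1 hi
  exact h ⟨x, hx.1, dyadic_subset h1 h2 hx.2⟩

theorem met_zero_subset (X : Set ℝ) (n j : ℕ) : met X n 0 j ⊆ {j} := by
  intro i hi
  rw [mem_met] at hi
  rw [Finset.mem_singleton]
  simp only [pow_zero, mul_one] at hi
  omega

/-- Finitely many point masses on `X`, of total mass equal to the length of a dyadic interval
meeting `X`, that charge every dyadic subinterval meeting `X` down to a given generation at least
by its length. -/
theorem exists_measure_le_dyadic (X : Set ℝ) (M : ℕ) : ∀ n j : ℕ, (X ∩ dyadic n j).Nonempty →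
    ∃ p : Measure ℝ, p univ = (2 : ℝ≥0∞)⁻¹ ^ n ∧
      (∃ F : Set ℝ, F.Finite ∧ F ⊆ X ∩ dyadic n j ∧ p Fᶜ = 0) ∧
      ∀ m ≤ M, ∀ i ∈ met X n m j, (2 : ℝ≥0∞)⁻¹ ^ (n + m) ≤ p (dyadic (n + m) i) := by
  have hzero : ∀ (p : Measure ℝ) (n j : ℕ), p univ = (2 : ℝ≥0∞)⁻¹ ^ n →
      (∃ F : Set ℝ, F.Finite ∧ F ⊆ X ∩ dyadic n j ∧ p Fᶜ = 0) →
      ∀ i ∈ met X n 0 j, (2 : ℝ≥0∞)⁻¹ ^ (n + 0) ≤ p (dyadic (n + 0) i) := by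
    rintro p n j hp ⟨F, -, hF, hpF⟩ i hi
    have := Finset.mem_singleton.1 (met_zero_subset X n j hi)
    subst this
    rw [add_zero, ← hp]
    have h1 : p (dyadic n i)ᶜ = 0 := measure_mono_null
      (compl_subset_compl.2 (hF.trans inter_subset_right)) hpF
    rw [← measure_add_measure_compl (measurableSet_dyadic n i), h1, add_zero]
  induction M with
  | zero =>
    rintro n j ⟨x, hx⟩
    have h1 : ((2 : ℝ≥0∞)⁻¹ ^ n • Measure.dirac x) univ = (2 : ℝ≥0∞)⁻¹ ^ n := by simp
    have h2 : ∃ F : Set ℝ, F.Finite ∧ F ⊆ X ∩ dyadic n j ∧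
        ((2 : ℝ≥0∞)⁻¹ ^ n • Measure.dirac x) Fᶜ = 0 :=
      ⟨{x}, finite_singleton x, by simpa using hx, by simp⟩
    refine ⟨_, h1, h2, fun m hm i hi => ?_⟩
    obtain rfl : m = 0 := by omega
    exact hzero _ n j h1 h2 i hi
  | succ M ih =>
    intro n j hX
    have hhalf : (2 : ℝ≥0∞) * (2 : ℝ≥0∞)⁻¹ ^ (n + 1) = (2 : ℝ≥0∞)⁻¹ ^ n := by
      rw [pow_succ', ← mul_assoc, ENNReal.mul_inv_cancel two_ne_zero ENNReal.ofNat_ne_top, one_mul]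
    have hsub1 : dyadic (n + 1) (2 * j) ⊆ dyadic n j := by
      rw [dyadic_eq_union n j]; exact subset_union_left
    have hsub2 : dyadic (n + 1) (2 * j + 1) ⊆ dyadic n j := by
      rw [dyadic_eq_union n j]; exact subset_union_right
    have hfin : ∀ p : Measure ℝ, p univ = (2 : ℝ≥0∞)⁻¹ ^ n →
        (∃ F : Set ℝ, F.Finite ∧ F ⊆ X ∩ dyadic n j ∧ p Fᶜ = 0) →
        (∀ m ≤ M, ∀ i ∈ met X (n + 1) m (2 * j),
          (2 : ℝ≥0∞)⁻¹ ^ (n + 1 + m) ≤ p (dyadic (n + 1 + m) i)) →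
        (∀ m ≤ M, ∀ i ∈ met X (n + 1) m (2 * j + 1),
          (2 : ℝ≥0∞)⁻¹ ^ (n + 1 + m) ≤ p (dyadic (n + 1 + m) i)) →
        ∃ p : Measure ℝ, p univ = (2 : ℝ≥0∞)⁻¹ ^ n ∧
          (∃ F : Set ℝ, F.Finite ∧ F ⊆ X ∩ dyadic n j ∧ p Fᶜ = 0) ∧
          ∀ m ≤ M + 1, ∀ i ∈ met X n m j, (2 : ℝ≥0∞)⁻¹ ^ (n + m) ≤ p (dyadic (n + m) i) := by
      refine fun p h1 h2 h3 h4 => ⟨p, h1, h2, fun m hm i hi => ?_⟩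
      cases m with
      | zero => exact hzero p n j h1 h2 i hi
      | succ m =>
        rw [met_succ, Finset.mem_union] at hi
        rw [show n + (m + 1) = n + 1 + m by ring]
        rcases hi with hi | hi
        · exact h3 m (by omega) i hi
        · exact h4 m (by omega) i hi
    -- The mass is divided equally between the two halves if both meet `X`; otherwise the half that
    -- meets `X` takes all of it, which is why its measure is doubled.
    by_cases hl : (X ∩ dyadic (n + 1) (2 * j)).Nonempty <;>
      by_cases hr : (X ∩ dyadic (n + 1) (2 * j + 1)).Nonempty
    · obtain ⟨p, hp1, ⟨F, hF1, hF2, hF3⟩, hp3⟩ := ih _ _ hl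
      obtain ⟨q, hq1, ⟨G, hG1, hG2, hG3⟩, hq3⟩ := ih _ _ hr
      refine hfin (p + q) ?_ ⟨F ∪ G, hF1.union hG1, ?_, ?_⟩ ?_ ?_
      · rw [Measure.add_apply, hp1, hq1, ← two_mul, hhalf]
      · exact union_subset (hF2.trans (inter_subset_inter_right _ hsub1))
          (hG2.trans (inter_subset_inter_right _ hsub2))
      · rw [Measure.add_apply,
          measure_mono_null (compl_subset_compl.2 subset_union_left) hF3,
          measure_mono_null (compl_subset_compl.2 subset_union_right) hG3, add_zero]
      · exact fun m hm i hi => (hp3 m hm i hi).trans (by rw [Measure.add_apply]; exact le_self_add)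
      · exact fun m hm i hi => (hq3 m hm i hi).trans (by rw [Measure.add_apply]; exact le_add_self)
    · obtain ⟨p, hp1, ⟨F, hF1, hF2, hF3⟩, hp3⟩ := ih _ _ hl
      refine hfin ((2 : ℝ≥0∞) • p) ?_ ⟨F, hF1, ?_, ?_⟩ ?_ ?_
      · rw [Measure.smul_apply, smul_eq_mul, hp1, hhalf]
      · exact hF2.trans (inter_subset_inter_right _ hsub1)
      · rw [Measure.smul_apply, hF3, smul_zero]
      · refine fun m hm i hi => (hp3 m hm i hi).trans ?_
        rw [Measure.smul_apply, smul_eq_mul, two_mul]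
        exact le_self_add
      · intro m hm i hi
        rw [met_eq_empty hr] at hi
        simp at hi
    · obtain ⟨p, hp1, ⟨F, hF1, hF2, hF3⟩, hp3⟩ := ih _ _ hr
      refine hfin ((2 : ℝ≥0∞) • p) ?_ ⟨F, hF1, ?_, ?_⟩ ?_ ?_
      · rw [Measure.smul_apply, smul_eq_mul, hp1, hhalf]
      · exact hF2.trans (inter_subset_inter_right _ hsub2)
      · rw [Measure.smul_apply, hF3, smul_zero]
      · intro m hm i hi
        rw [met_eq_empty hl] at hi
        simp at hi
      · refine fun m hm i hi => (hp3 m hm i hi).trans ?_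
        rw [Measure.smul_apply, smul_eq_mul, two_mul]
        exact le_self_add
    · obtain ⟨x, hx1, hx2⟩ := hX
      rw [dyadic_eq_union] at hx2
      exact (hx2.elim (fun h => hl ⟨x, hx1, h⟩) fun h => hr ⟨x, hx1, h⟩).elim

/-- The total length of the dyadic subintervals of `dyadic n j` that meet `X`. -/
def metSum (X : Set ℝ) (n j : ℕ) : ℝ≥0∞ :=
  ∑' m : ℕ, ((met X n m j).card : ℝ≥0∞) * (2 : ℝ≥0∞)⁻¹ ^ (n + m)

theorem metSum_eq (X : Set ℝ) (n j : ℕ) : metSum X n j =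
    ((met X n 0 j).card : ℝ≥0∞) * (2 : ℝ≥0∞)⁻¹ ^ (n + 0) +
      (metSum X (n + 1) (2 * j) + metSum X (n + 1) (2 * j + 1)) := by
  rw [metSum, tsum_eq_zero_add' ENNReal.summable, metSum, metSum, ← ENNReal.tsum_add]
  congr 1
  refine tsum_congr fun m => ?_
  rw [met_succ, Finset.card_union_of_disjoint (disjoint_met X n m j),
    show n + (m + 1) = n + 1 + m by ring]
  push_cast
  ring

theorem metSum_child_eq_top {X : Set ℝ} {n j : ℕ} (h : metSum X n j = ⊤) :
    metSum X (n + 1) (2 * j) = ⊤ ∨ metSum X (n + 1) (2 * j + 1) = ⊤ := by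
  rw [metSum_eq, ENNReal.add_eq_top, ENNReal.add_eq_top] at h
  refine h.resolve_left (ENNReal.mul_ne_top (by simp) ?_)
  exact ENNReal.pow_ne_top (by simp)

theorem nonempty_of_metSum_eq_top {X : Set ℝ} {n j : ℕ} (h : metSum X n j = ⊤) :
    (X ∩ dyadic n j).Nonempty := by
  by_contra hX
  rw [metSum] at h
  simp [met_eq_empty hX] at h

/-- The sum over an interval is one finite term plus the sums over its two halves, so an infinite
sum passes to one of the halves. -/
theorem exists_nested_metSum_eq_top {X : Set ℝ} (h : metSum X 0 0 = ⊤) :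
    ∃ J : ℕ → ℕ, J 0 = 0 ∧ (∀ n, metSum X n (J n) = ⊤) ∧
      ∀ n, J (n + 1) = 2 * J n ∨ J (n + 1) = 2 * J n + 1 := by
  classical
  let J : ℕ → ℕ := fun n => Nat.rec 0
    (fun n j => if metSum X (n + 1) (2 * j) = ⊤ then 2 * j else 2 * j + 1) n
  have hJ : ∀ n, J (n + 1) = if metSum X (n + 1) (2 * J n) = ⊤ then 2 * J n else 2 * J n + 1 :=
    fun n => rfl
  refine ⟨J, rfl, fun n => ?_, fun n => ?_⟩
  · induction n with
    | zero => exact h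
    | succ n ih =>
      rw [hJ]
      split_ifs with h1
      · exact h1
      · exact (metSum_child_eq_top ih).resolve_left h1
  · rw [hJ]
    split_ifs <;> simp

/-- The measure is `∑ k • p k`, where `p k` consists of point masses in the nested interval of
generation `2 * k` and charges the dyadic intervals meeting `X` by at least their length, down to
generation `2 * k + M k`. Here `M k` is taken so large that these intervals have total length at
least `k`. -/
theorem exists_heavy_measure {X : Set ℝ} (h : metSum X 0 0 = ⊤) :
    ∃ (μ : Measure ℝ) (C : Set ℝ), IsFiniteMeasure μ ∧ C.Countable ∧ IsClosed C ∧
      C ⊆ closure X ∧ C ⊆ Icc 0 1 ∧ μ Cᶜ = 0 ∧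
      ∀ k : ℕ, ∃ G : Finset (ℕ × ℕ),
        (∀ p ∈ G, p.2 < 2 ^ p.1 ∧ (k : ℝ≥0∞) * 2⁻¹ ^ p.1 ≤ μ (dyadic p.1 p.2)) ∧
        (k : ℝ≥0∞) ≤ ∑ p ∈ G, (2 : ℝ≥0∞)⁻¹ ^ p.1 := by
  obtain ⟨J, hJ0, hJtop, hJs⟩ := exists_nested_metSum_eq_top h
  have hJlt : ∀ n, J n < 2 ^ n := fun n => by
    induction n with
    | zero => simp [hJ0]
    | succ n ih => rw [pow_succ]; rcases hJs n with h | h <;> omega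
  have hnest1 : ∀ n, dyadic (n + 1) (J (n + 1)) ⊆ dyadic n (J n) := fun n => by
    rw [dyadic_eq_union n]
    rcases hJs n with h | h <;> rw [h]
    exacts [subset_union_left, subset_union_right]
  have hnest : Antitone fun n => dyadic n (J n) := antitone_nat_of_succ_le hnest1
  have hpart : ∀ k : ℕ, ∃ M : ℕ, (k : ℝ≥0∞) ≤
      ∑ m ∈ Finset.range M, ((met X (2 * k) m (J (2 * k))).card : ℝ≥0∞) *
        (2 : ℝ≥0∞)⁻¹ ^ (2 * k + m) := fun k => by
    have h1 := hJtop (2 * k)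
    rw [metSum, ENNReal.tsum_eq_iSup_nat, iSup_eq_top] at h1
    obtain ⟨M, hM⟩ := h1 k (by simp)
    exact ⟨M, hM.le⟩
  choose M hM using hpart
  -- Generation `2 * k` makes the total mass of `k • p k` equal to `k * 4 ^ (-k)`, at most `2 ^
  -- (-k)`.
  choose p hp1 hF hp2 using fun k : ℕ => exists_measure_le_dyadic X (M k) (2 * k) (J (2 * k))
    (nonempty_of_metSum_eq_top (hJtop _))
  choose F hF1 hF2 hF3 using hF
  set μ : Measure ℝ := Measure.sum fun k : ℕ => (k : ℝ≥0∞) • p k with hμ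
  have hμle : ∀ (k : ℕ) (A : Set ℝ), MeasurableSet A → (k : ℝ≥0∞) * p k A ≤ μ A := fun k A hA => by
    rw [hμ, Measure.sum_apply _ hA]
    exact ENNReal.le_tsum (f := fun k : ℕ => ((k : ℝ≥0∞) • p k) A) k
  have hFsub : ∀ k n, n ≤ 2 * k → F k ⊆ dyadic n (J n) := fun k n hn =>
    (hF2 k).trans (inter_subset_right.trans (hnest hn))
  -- All but finitely many `F k` lie in any given nested interval, so the closure adds at most one
  -- point to the countable union.
  have hclsub : ∀ K, closure (⋃ k, F k) ⊆
      (⋃ k ∈ Finset.range K, F k) ∪ closure (dyadic K (J K)) := fun K => by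
    refine closure_minimal (iUnion_subset fun k => ?_) ?_
    · rcases lt_or_ge k K with hk | hk
      · refine subset_union_of_subset_left ?_ _
        exact subset_biUnion_of_mem (u := fun k => F k) (by simpa using hk)
      · exact subset_union_of_subset_right ((hFsub k K (by omega)).trans subset_closure) _
    · refine IsClosed.union ?_ isClosed_closure
      exact (Finset.finite_toSet _).isClosed_biUnion fun k _ => (hF1 k).isClosed
  have hdiam : ∀ K, ∀ x ∈ closure (dyadic K (J K)), ∀ y ∈ closure (dyadic K (J K)),
      |x - y| ≤ (1 / 2 : ℝ) ^ K := fun K x hx y hy => by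
    have hsub : closure (dyadic K (J K)) ⊆ Icc ((J K : ℝ) / 2 ^ K) ((J K + 1 : ℝ) / 2 ^ K) :=
      closure_minimal Ico_subset_Icc_self isClosed_Icc
    have h1 := hsub hx
    have h2 := hsub hy
    have h3 : (J K + 1 : ℝ) / 2 ^ K - (J K : ℝ) / 2 ^ K = (1 / 2 : ℝ) ^ K := by
      rw [← sub_div, add_sub_cancel_left, one_div_pow]
    rw [abs_le]
    constructor <;> linarith [h1.1, h1.2, h2.1, h2.2]
  refine ⟨μ, closure (⋃ k, F k), ⟨?_⟩, ?_, isClosed_closure, ?_, ?_, ?_, fun k => ?_⟩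
  · rw [hμ, Measure.sum_apply _ MeasurableSet.univ]
    have hle : ∀ k : ℕ, ((k : ℝ≥0∞) • p k) univ ≤ 2⁻¹ ^ k := fun k => by
      rw [Measure.smul_apply, hp1, smul_eq_mul, two_mul, pow_add, ← mul_assoc]
      have h1 : (k : ℝ≥0∞) ≤ 2 ^ k := by exact_mod_cast (Nat.lt_two_pow_self (n := k)).le
      have h2 : (k : ℝ≥0∞) * 2⁻¹ ^ k ≤ 1 := by
        calc (k : ℝ≥0∞) * 2⁻¹ ^ k ≤ 2 ^ k * 2⁻¹ ^ k := by gcongr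
          _ = 1 := by
            rw [← mul_pow, ENNReal.mul_inv_cancel two_ne_zero ENNReal.ofNat_ne_top, one_pow]
      exact mul_le_of_le_one_left' h2
    refine (ENNReal.tsum_le_tsum hle).trans_lt ?_
    rw [ENNReal.tsum_geometric, ENNReal.one_sub_inv_two, inv_inv]
    exact ENNReal.ofNat_lt_top
  · have hsub : (closure (⋃ k, F k) \ ⋃ k, F k).Subsingleton := by
      intro x hx y hy
      have hxy : ∀ K, |x - y| ≤ (1 / 2 : ℝ) ^ K := fun K => by
        have hmem : ∀ z ∈ closure (⋃ k, F k) \ ⋃ k, F k, z ∈ closure (dyadic K (J K)) :=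
          fun z hz => (hclsub K hz.1).resolve_left fun hz' => hz.2 <| by
            obtain ⟨k, -, hk⟩ := mem_iUnion₂.1 hz'
            exact mem_iUnion.2 ⟨k, hk⟩
        exact hdiam K x (hmem x hx) y (hmem y hy)
      have h0 : |x - y| ≤ 0 := ge_of_tendsto'
        (tendsto_pow_atTop_nhds_zero_of_lt_one (by norm_num) (by norm_num)) hxy
      exact sub_eq_zero.1 (abs_nonpos_iff.1 h0)
    refine ((countable_iUnion fun k => (hF1 k).countable).union hsub.countable).mono ?_
    intro x hx
    by_cases hx' : x ∈ ⋃ k, F k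
    · exact Or.inl hx'
    · exact Or.inr ⟨hx, hx'⟩
  · exact closure_mono (iUnion_subset fun k => (hF2 k).trans inter_subset_left)
  · refine closure_minimal (iUnion_subset fun k => (hFsub k 0 (by omega)).trans ?_) isClosed_Icc
    rw [hJ0, dyadic]
    simpa using Ico_subset_Icc_self
  · rw [hμ, Measure.sum_apply _ isClosed_closure.measurableSet.compl, ENNReal.tsum_eq_zero]
    intro k
    rw [Measure.smul_apply, measure_mono_null (compl_subset_compl.2
      ((subset_iUnion F k).trans subset_closure)) (hF3 k), smul_zero]
  · refine ⟨((Finset.range (M k)).sigma fun m => met X (2 * k) m (J (2 * k))).image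
      fun x => (2 * k + x.1, x.2), ?_, ?_⟩
    · intro q hq
      obtain ⟨⟨m, i⟩, hmi, rfl⟩ := Finset.mem_image.1 hq
      rw [Finset.mem_sigma] at hmi
      obtain ⟨hm, hi⟩ := hmi
      have hi' := (mem_met.1 hi).1.2
      refine ⟨?_, ?_⟩
      · refine hi'.trans_le ?_
        rw [pow_add]
        exact Nat.mul_le_mul_right _ (hJlt _)
      · refine le_trans ?_ (hμle k _ (measurableSet_dyadic _ _))
        gcongr
        exact hp2 k m (by simpa using (Finset.mem_range.1 hm).le) i hi
    · rw [Finset.sum_image, Finset.sum_sigma]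
      · refine (hM k).trans_eq (Finset.sum_congr rfl fun m _ => ?_)
        simp
      · rintro ⟨a, b⟩ - ⟨c, d⟩ - hac
        simp only [Prod.mk.injEq] at hac
        obtain ⟨h1, h2⟩ := hac
        obtain rfl : a = c := by omega
        subst h2
        rfl

/-! ### The circle as a period and the complementary arcs -/

/-- The parametrisation `t ↦ exp (2πit)` of the circle, of period `1`. -/
def turn (t : ℝ) : Circle := Circle.exp (2 * Real.pi * t)

/-- The preimage of a subset of the circle under `turn`. -/
def lift (A : Set Circle) : Set ℝ := turn ⁻¹' A

theorem mem_lift {A : Set Circle} {t : ℝ} : t ∈ lift A ↔ turn t ∈ A := Iff.rfl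

theorem arcLength_eq (A : Set Circle) : arcLength A = volume (Ico 0 1 ∩ lift A) := rfl

theorem continuous_turn : Continuous turn := by unfold turn; fun_prop

theorem turn_eq_turn {s t : ℝ} : turn s = turn t ↔ ∃ m : ℤ, s = t + m := by
  rw [turn, turn, Circle.exp_eq_exp]
  refine exists_congr fun m => ?_
  have := Real.pi_pos
  constructor
  · intro h
    have h2 : 2 * Real.pi * s = 2 * Real.pi * (t + m) := by linarith
    exact mul_left_cancel₀ (by positivity) h2
  · rintro rfl
    ring

theorem turn_add_intCast (t : ℝ) (m : ℤ) : turn (t + m) = turn t := turn_eq_turn.2 ⟨m, rfl⟩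

theorem turn_add_one (t : ℝ) : turn (t + 1) = turn t := by simpa using turn_add_intCast t 1

theorem turn_sub_one (t : ℝ) : turn (t - 1) = turn t := by
  rw [← turn_add_one (t - 1), sub_add_cancel]

theorem exists_turn_eq_Ico (a : ℝ) (ζ : Circle) : ∃ t ∈ Ico a (a + 1), turn t = ζ := by
  obtain ⟨θ, rfl⟩ := Circle.exp_surjective ζ
  refine ⟨toIcoMod one_pos a (θ / (2 * Real.pi)), toIcoMod_mem_Ico _ _ _, ?_⟩
  have h1 : turn (θ / (2 * Real.pi)) = Circle.exp θ := by
    rw [turn, mul_div_cancel₀ _ (by positivity)]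
  rw [← h1, turn_eq_turn]
  refine ⟨-toIcoDiv one_pos a (θ / (2 * Real.pi)), ?_⟩
  rw [toIcoMod, zsmul_eq_mul]
  push_cast
  ring

theorem turn_surjective : Function.Surjective turn := fun ζ =>
  let ⟨t, _, ht⟩ := exists_turn_eq_Ico 0 ζ
  ⟨t, ht⟩

theorem injOn_turn_Ico (a : ℝ) : InjOn turn (Ico a (a + 1)) := by
  intro s hs t ht hst
  obtain ⟨m, rfl⟩ := turn_eq_turn.1 hst
  have h1 : (m : ℝ) < 1 := by linarith [hs.2, ht.1]
  have h2 : (-1 : ℝ) < m := by linarith [hs.1, ht.2]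
  have h3 : m < 1 := by exact_mod_cast h1
  have h4 : -1 < m := by exact_mod_cast h2
  obtain rfl : m = 0 := by omega
  simp

theorem isOpenMap_turn : IsOpenMap turn := by
  have h : IsOpenMap fun t : ℝ => 2 * Real.pi * t :=
    (Homeomorph.mulLeft₀ (2 * Real.pi) (by positivity)).isOpenMap
  exact isLocalHomeomorph_circleExp.isOpenMap.comp h

theorem isClosed_lift {A : Set Circle} (hA : IsClosed A) : IsClosed (lift A) :=
  hA.preimage continuous_turn

theorem isOpen_lift {A : Set Circle} (hA : IsOpen A) : IsOpen (lift A) :=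
  hA.preimage continuous_turn

theorem subset_of_mem_complementaryArcs {E J : Set Circle} (hJ : J ∈ complementaryArcs E) :
    J ⊆ Eᶜ := by
  obtain ⟨ζ, -, rfl⟩ := hJ
  exact connectedComponentIn_subset _ _

/-- Components absorb connected sets that meet them and avoid `E`; this gives the openness of the
arcs and the inclusion of dyadic intervals in them. -/
theorem image_turn_subset_of_mem {E J : Set Circle} (hJ : J ∈ complementaryArcs E) {A : Set ℝ}
    (hA : IsPreconnected A) (hAE : turn '' A ⊆ Eᶜ) {t : ℝ} (ht : t ∈ A) (htJ : turn t ∈ J) :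
    turn '' A ⊆ J := by
  obtain ⟨ζ, -, rfl⟩ := hJ
  rw [connectedComponentIn_eq htJ]
  exact (hA.image _ continuous_turn.continuousOn).subset_connectedComponentIn
    (mem_image_of_mem _ ht) hAE

theorem isOpen_lift_of_mem_complementaryArcs {E J : Set Circle} (hE : IsClosed E)
    (hJ : J ∈ complementaryArcs E) : IsOpen (lift J) := by
  rw [Metric.isOpen_iff]
  intro t ht
  have hU : IsOpen (lift Eᶜ) := isOpen_lift hE.isOpen_compl
  obtain ⟨r, hr, hsub⟩ := Metric.isOpen_iff.1 hU t (subset_of_mem_complementaryArcs hJ ht)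
  refine ⟨r, hr, fun s hs => ?_⟩
  exact image_turn_subset_of_mem hJ (convex_ball t r).isPreconnected (image_subset_iff.2 hsub)
    (Metric.mem_ball_self hr) ht (mem_image_of_mem _ hs)

theorem isOpen_of_mem_complementaryArcs {E J : Set Circle} (hE : IsClosed E)
    (hJ : J ∈ complementaryArcs E) : IsOpen J := by
  rw [← image_preimage_eq J turn_surjective]
  exact isOpenMap_turn _ (isOpen_lift_of_mem_complementaryArcs hE hJ)

theorem nonempty_of_mem_complementaryArcs {E J : Set Circle} (hJ : J ∈ complementaryArcs E) :
    J.Nonempty := by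
  obtain ⟨ζ, hζ, rfl⟩ := hJ
  exact ⟨ζ, mem_connectedComponentIn hζ⟩

theorem pairwiseDisjoint_complementaryArcs (E : Set Circle) :
    (complementaryArcs E).PairwiseDisjoint id := by
  rintro _ ⟨ζ, -, rfl⟩ _ ⟨ξ, -, rfl⟩ hne
  rw [Function.onFun, id, id, Set.disjoint_left]
  intro x hx hx'
  exact hne ((connectedComponentIn_eq hx).trans (connectedComponentIn_eq hx').symm)

theorem countable_complementaryArcs {E : Set Circle} (hE : IsClosed E) :
    (complementaryArcs E).Countable :=
  (pairwiseDisjoint_complementaryArcs E).countable_of_isOpen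
    (fun _ hJ => isOpen_of_mem_complementaryArcs hE hJ)
    fun _ hJ => nonempty_of_mem_complementaryArcs hJ

theorem iUnion_complementaryArcs (E : Set Circle) : ⋃ J : complementaryArcs E, J.1 = Eᶜ := by
  refine Subset.antisymm (iUnion_subset fun J => subset_of_mem_complementaryArcs J.2) ?_
  intro ζ hζ
  exact mem_iUnion.2 ⟨⟨_, ζ, hζ, rfl⟩, mem_connectedComponentIn hζ⟩

theorem arcLength_le_one (A : Set Circle) : arcLength A ≤ 1 := by
  rw [arcLength_eq]
  refine (measure_mono inter_subset_left).trans ?_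
  simp

theorem arcLength_ne_top (A : Set Circle) : arcLength A ≠ ⊤ :=
  ne_top_of_le_ne_top ENNReal.one_ne_top (arcLength_le_one A)

/-! ### Entropy against the dyadic sum -/

/-- The union of the dyadic intervals of generation `m` in `[0, 1)` that meet `X`. -/
def metUnion (X : Set ℝ) (m : ℕ) : Set ℝ := ⋃ i ∈ met X 0 m 0, dyadic (0 + m) i

theorem measurableSet_metUnion (X : Set ℝ) (m : ℕ) : MeasurableSet (metUnion X m) :=
  Finset.measurableSet_biUnion _ fun _ _ => measurableSet_dyadic _ _

theorem volume_metUnion (X : Set ℝ) (m : ℕ) :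
    volume (metUnion X m) = ((met X 0 m 0).card : ℝ≥0∞) * (2 : ℝ≥0∞)⁻¹ ^ (0 + m) := by
  rw [metUnion, measure_biUnion_finset (fun i _ j _ h => disjoint_dyadic h)
    fun _ _ => measurableSet_dyadic _ _]
  simp [volume_dyadic]

theorem mem_metUnion {X : Set ℝ} {m : ℕ} {x : ℝ} (hx : x ∈ Ico (0 : ℝ) 1)
    (h : (X ∩ dyadic m ⌊x * 2 ^ m⌋₊).Nonempty) : x ∈ metUnion X m := by
  refine mem_iUnion₂.2 ⟨⌊x * 2 ^ m⌋₊, mem_met.2 ⟨⟨by simp, ?_⟩, by rwa [zero_add]⟩, ?_⟩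
  · simpa using floor_lt_two_pow hx.1 hx.2
  · rw [zero_add]
    exact mem_dyadic_floor hx.1

/-- By Tonelli: the integrand counts the generations at which the dyadic interval of `x` meets `X`.
-/
theorem metSum_eq_lintegral (X : Set ℝ) :
    metSum X 0 0 = ∫⁻ x, ∑' m, (metUnion X m).indicator 1 x := by
  rw [lintegral_tsum fun m => (measurable_one.indicator (measurableSet_metUnion X m)).aemeasurable,
    metSum]
  refine tsum_congr fun m => ?_
  rw [lintegral_indicator_one (measurableSet_metUnion X m), volume_metUnion]

/-- The terms of the convergent series tend to `0`, and each of them bounds the length of `E` from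
above. -/
theorem arcLength_eq_zero_of_metSum_ne_top {E : Set Circle}
    (h : metSum (Ico 0 1 ∩ lift E) 0 0 ≠ ⊤) : arcLength E = 0 := by
  set X := Ico (0 : ℝ) 1 ∩ lift E with hX
  have h1 : Tendsto (fun m => volume (metUnion X m)) atTop (𝓝 0) := by
    simp only [volume_metUnion]
    exact ENNReal.tendsto_atTop_zero_of_tsum_ne_top h
  rw [arcLength_eq]
  refine le_antisymm (ge_of_tendsto' h1 fun m => measure_mono fun x hx => ?_) zero_le
  exact mem_metUnion hx.1 ⟨x, hx, mem_dyadic_floor hx.1.1⟩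

theorem dyadic_subset_lift {E J : Set Circle} (hJ : J ∈ complementaryArcs E) {m : ℕ} {x : ℝ}
    (hx : x ∈ Ico 0 1 ∩ lift J) (h : x ∉ metUnion (Ico 0 1 ∩ lift E) m) :
    dyadic m ⌊x * 2 ^ m⌋₊ ⊆ Ico 0 1 ∩ lift J := by
  have hsub : dyadic m ⌊x * 2 ^ m⌋₊ ⊆ Ico 0 1 := by
    have h1 := floor_lt_two_pow (n := m) hx.1.1 hx.1.2
    have h2 := dyadic_subset (n := 0) (m := m) (i := ⌊x * 2 ^ m⌋₊) (j := 0) (by simp) (by simpa using h1)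
    rw [zero_add] at h2
    refine h2.trans ?_
    simp [dyadic]
  refine subset_inter hsub (image_subset_iff.1 ?_)
  refine image_turn_subset_of_mem hJ (convex_Ico _ _).isPreconnected ?_ (mem_dyadic_floor hx.1.1) hx.2
  rintro _ ⟨s, hs, rfl⟩ hsE
  exact h (mem_metUnion hx.1 ⟨s, ⟨hsub hs, hsE⟩, hs⟩)

/-- On an arc of length `ℓ` the counting function of `metSum_eq_lintegral` is at least `log (1 / ℓ)
/ log 2`. Integrate this over the disjoint arcs. -/
theorem entropy_le_metSum {E : Set Circle} (hE : IsClosed E) :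
    entropy E ≤ metSum (Ico 0 1 ∩ lift E) 0 0 := by
  set X := Ico (0 : ℝ) 1 ∩ lift E with hX
  set f : ℝ → ℝ≥0∞ := fun x => ∑' m, (metUnion X m).indicator 1 x with hf
  rw [metSum_eq_lintegral, entropy, ENNReal.tsum_eq_iSup_sum]
  have hmeas : ∀ J : complementaryArcs E, MeasurableSet (Ico 0 1 ∩ lift J.1) := fun J =>
    measurableSet_Ico.inter (isOpen_lift_of_mem_complementaryArcs hE J.2).measurableSet
  have key : ∀ J : complementaryArcs E,
      ENNReal.ofReal ((arcLength J.1).toReal * Real.log ((arcLength J.1).toReal)⁻¹) ≤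
        ∫⁻ x in Ico 0 1 ∩ lift J.1, f x := by
    intro J
    set ℓ := (arcLength J.1).toReal with hℓ
    have hℓ0 : 0 ≤ ℓ := ENNReal.toReal_nonneg
    rcases hℓ0.eq_or_lt with h0 | h0
    · rw [← h0]; simp
    have hvol : volume (Ico 0 1 ∩ lift J.1) = ENNReal.ofReal ℓ := by
      rw [hℓ, ENNReal.ofReal_toReal (arcLength_ne_top _), arcLength_eq]
    have hl2 : 0 < Real.log 2 := Real.log_pos one_lt_two
    set N := ⌈Real.log ℓ⁻¹ / Real.log 2⌉₊ with hN
    have hge : ∀ x ∈ Ico 0 1 ∩ lift J.1, (N : ℝ≥0∞) ≤ f x := fun x hx => by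
      have h1 : ∀ m ∈ Finset.range N, (metUnion X m).indicator (1 : ℝ → ℝ≥0∞) x = 1 :=
        fun m hm => by
          refine indicator_of_mem ?_ _
          -- If the dyadic interval of `x` missed `E` it would lie in the arc, although `m < N`
          -- makes it longer than `ℓ`.
          by_contra hxm
          have h2 := measure_mono (μ := volume) (dyadic_subset_lift J.2 hx hxm)
          rw [volume_dyadic, hvol] at h2
          have h3 : (1 / 2 : ℝ) ^ m ≤ ℓ := by
            rw [← ENNReal.ofReal_le_ofReal_iff hℓ0, ENNReal.ofReal_pow (by norm_num), one_div,
              ENNReal.ofReal_inv_of_pos two_pos, ENNReal.ofReal_ofNat]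
            exact h2
          have h4 : (m : ℝ) < Real.log ℓ⁻¹ / Real.log 2 := Nat.lt_ceil.1 (Finset.mem_range.1 hm)
          rw [lt_div_iff₀ hl2, Real.log_inv] at h4
          have h5 := Real.log_le_log (by positivity) h3
          rw [Real.log_pow, one_div, Real.log_inv] at h5
          linarith
      calc (N : ℝ≥0∞) = ∑ m ∈ Finset.range N, (metUnion X m).indicator (1 : ℝ → ℝ≥0∞) x := by
            rw [Finset.sum_congr rfl h1]; simp
        _ ≤ f x := ENNReal.sum_le_tsum _
    calc ENNReal.ofReal (ℓ * Real.log ℓ⁻¹) ≤ ENNReal.ofReal (N * ℓ) := by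
          refine ENNReal.ofReal_le_ofReal ?_
          have h1 : Real.log ℓ⁻¹ / Real.log 2 ≤ N := Nat.le_ceil _
          rw [div_le_iff₀ hl2] at h1
          have h2 : Real.log 2 ≤ 1 := by linarith [Real.log_two_lt_d9]
          have h3 : (0 : ℝ) ≤ N := Nat.cast_nonneg _
          nlinarith [mul_le_mul_of_nonneg_left h2 h3]
      _ = N * volume (Ico 0 1 ∩ lift J.1) := by
          rw [hvol, ENNReal.ofReal_mul (Nat.cast_nonneg _), ENNReal.ofReal_natCast]
      _ = ∫⁻ _ in Ico 0 1 ∩ lift J.1, (N : ℝ≥0∞) := by rw [setLIntegral_const]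
      _ ≤ ∫⁻ x in Ico 0 1 ∩ lift J.1, f x := setLIntegral_mono' (hmeas J) hge
  refine iSup_le fun s => (Finset.sum_le_sum fun J _ => key J).trans ?_
  rw [← lintegral_biUnion_finset (t := fun J : complementaryArcs E => Ico 0 1 ∩ lift J.1)
    (fun J _ K _ hJK => ?_) (fun J _ => hmeas J)]
  · exact setLIntegral_le_lintegral _ _
  · have h1 := pairwiseDisjoint_complementaryArcs E J.2 K.2 fun h => hJK (Subtype.ext h)
    exact (h1.preimage turn).mono inter_subset_right inter_subset_right

/-! ### Singular inner functions from measures on a compact set -/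

/-- The exponential of minus the Herglotz integral of a measure on `ℝ`, transported to the circle
by `turn`. -/
def herglotz (μ : Measure ℝ) (z : ℂ) : ℂ := ∫ t, ((turn t : ℂ) + z) / ((turn t : ℂ) - z) ∂μ

theorem continuous_coe_turn : Continuous fun t => (turn t : ℂ) :=
  continuous_subtype_val.comp continuous_turn

theorem norm_turn (t : ℝ) : ‖(turn t : ℂ)‖ = 1 := Circle.norm_coe _

theorem re_add_div_sub (a b : ℂ) : ((a + b) / (a - b)).re = (‖a‖ ^ 2 - ‖b‖ ^ 2) / ‖a - b‖ ^ 2 := by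
  have h := congrFun (poissonKernel_eq_re_herglotzRieszKernel (c := 0) (w := b)) a
  rw [Function.comp_apply, herglotzRieszKernel_def, poissonKernel_def] at h
  simpa using h.symm

theorem norm_exp_neg_herglotz (μ : Measure ℝ) (z : ℂ) :
    ‖Complex.exp (-herglotz μ z)‖ = Real.exp (-(herglotz μ z).re) := by
  rw [Complex.norm_exp, Complex.neg_re]

section

variable {μ : Measure ℝ} [IsFiniteMeasure μ] {C : Set ℝ}

theorem exists_ball_le_norm_turn_sub (hC : IsCompact C) {z : ℂ}
    (hz : z ∉ (fun t => (turn t : ℂ)) '' C) :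
    ∃ δ > 0, ∀ y ∈ Metric.ball z δ, ∀ t ∈ C, δ ≤ ‖(turn t : ℂ) - y‖ := by
  have hcl : IsClosed ((fun t => (turn t : ℂ)) '' C) := (hC.image continuous_coe_turn).isClosed
  obtain ⟨δ, hδ, hsub⟩ := Metric.isOpen_iff.1 hcl.isOpen_compl z hz
  refine ⟨δ / 2, by positivity, fun y hy t ht => ?_⟩
  by_contra! h
  refine hsub ?_ (mem_image_of_mem _ ht)
  rw [Metric.mem_ball, dist_eq_norm] at hy ⊢
  calc ‖(turn t : ℂ) - z‖ = ‖((turn t : ℂ) - y) + (y - z)‖ := by ring_nf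
    _ ≤ _ := norm_add_le _ _
    _ < δ := by linarith

theorem measurable_herglotz_integrand (z : ℂ) :
    Measurable fun t => ((turn t : ℂ) + z) / ((turn t : ℂ) - z) :=
  (continuous_coe_turn.measurable.add_const z).div (continuous_coe_turn.measurable.sub_const z)

theorem integrable_herglotz (hC : IsCompact C) (hμ : μ Cᶜ = 0) {z : ℂ}
    (hz : z ∉ (fun t => (turn t : ℂ)) '' C) :
    Integrable (fun t => ((turn t : ℂ) + z) / ((turn t : ℂ) - z)) μ := by
  obtain ⟨δ, hδ, h⟩ := exists_ball_le_norm_turn_sub hC hz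
  refine Integrable.of_bound (measurable_herglotz_integrand z).aestronglyMeasurable
    ((1 + ‖z‖) / δ) ?_
  filter_upwards [(mem_ae_iff.2 hμ : C ∈ ae μ)] with t ht
  rw [norm_div]
  have h1 := h z (Metric.mem_ball_self hδ) t ht
  have h2 : ‖(turn t : ℂ) + z‖ ≤ 1 + ‖z‖ := (norm_add_le _ _).trans_eq (by rw [norm_turn])
  gcongr

/-- Differentiability holds at every point off the support, also on the circle; this yields both the
radial limits and the inclusion of the singular set in the support. -/
theorem differentiableAt_herglotz (hC : IsCompact C) (hμ : μ Cᶜ = 0) {z : ℂ}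
    (hz : z ∉ (fun t => (turn t : ℂ)) '' C) : DifferentiableAt ℂ (herglotz μ) z := by
  obtain ⟨δ, hδ, h⟩ := exists_ball_le_norm_turn_sub hC hz
  have hae : ∀ᵐ t ∂μ, t ∈ C := mem_ae_iff.2 hμ
  refine (hasDerivAt_integral_of_dominated_loc_of_deriv_le (μ := μ)
    (F := fun z t => ((turn t : ℂ) + z) / ((turn t : ℂ) - z))
    (F' := fun z t => 2 * (turn t : ℂ) / ((turn t : ℂ) - z) ^ 2)
    (bound := fun _ => 2 / δ ^ 2) (Metric.ball_mem_nhds z hδ)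
    (Eventually.of_forall fun y => (measurable_herglotz_integrand y).aestronglyMeasurable)
    (integrable_herglotz hC hμ hz) ?_ ?_ (integrable_const _) ?_).2.differentiableAt
  · exact ((continuous_coe_turn.measurable.const_mul 2).div
      ((continuous_coe_turn.measurable.sub_const z).pow_const 2)).aestronglyMeasurable
  · filter_upwards [hae] with t ht y hy
    have h1 := h y hy t ht
    rw [norm_div, norm_mul, norm_pow, norm_turn, mul_one, Complex.norm_ofNat]
    gcongr
  · filter_upwards [hae] with t ht y hy
    have h1 : (turn t : ℂ) - y ≠ 0 := norm_pos_iff.1 (hδ.trans_le (h y hy t ht))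
    have h2 : HasDerivAt (fun y : ℂ => (turn t : ℂ) + y) 1 y := (hasDerivAt_id y).const_add _
    have h3 : HasDerivAt (fun y : ℂ => (turn t : ℂ) - y) (-1) y := (hasDerivAt_id y).const_sub _
    refine (h2.div h3 h1).congr_deriv ?_
    ring

theorem re_herglotz (hC : IsCompact C) (hμ : μ Cᶜ = 0) {z : ℂ}
    (hz : z ∉ (fun t => (turn t : ℂ)) '' C) :
    (herglotz μ z).re = ∫ t, (1 - ‖z‖ ^ 2) / ‖(turn t : ℂ) - z‖ ^ 2 ∂μ := by
  have h := Complex.reCLM.integral_comp_comm (integrable_herglotz hC hμ hz)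
  rw [herglotz]
  refine h.symm.trans (integral_congr_ae (Eventually.of_forall fun t => ?_))
  simp only [Complex.reCLM_apply, re_add_div_sub, norm_turn, one_pow]

theorem notMem_image_turn {z : ℂ} (hz : ‖z‖ < 1) (C : Set ℝ) :
    z ∉ (fun t => (turn t : ℂ)) '' C := by
  rintro ⟨t, -, rfl⟩
  simp [norm_turn] at hz

/-- The Poisson kernel is nonnegative, so discarding everything outside `A` only lowers the
integral. -/
theorem mul_le_re_herglotz (hC : IsCompact C) (hμ : μ Cᶜ = 0) {z : ℂ} (hz : ‖z‖ < 1) {A : Set ℝ}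
    (hA : MeasurableSet A) {c : ℝ}
    (hc : ∀ t ∈ A, c ≤ (1 - ‖z‖ ^ 2) / ‖(turn t : ℂ) - z‖ ^ 2) :
    c * (μ A).toReal ≤ (herglotz μ z).re := by
  have h0 : 0 ≤ 1 - ‖z‖ ^ 2 := by nlinarith [norm_nonneg z]
  have hint : Integrable (fun t => (1 - ‖z‖ ^ 2) / ‖(turn t : ℂ) - z‖ ^ 2) μ := by
    refine (integrable_herglotz hC hμ (notMem_image_turn hz C)).re.congr
      (Eventually.of_forall fun t => ?_)
    simp only [RCLike.re_to_complex, re_add_div_sub, norm_turn, one_pow]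
  rw [re_herglotz hC hμ (notMem_image_turn hz C)]
  calc c * (μ A).toReal = ∫ _ in A, c ∂μ := by
        rw [setIntegral_const, smul_eq_mul, mul_comm, measureReal_def]
    _ ≤ ∫ t in A, (1 - ‖z‖ ^ 2) / ‖(turn t : ℂ) - z‖ ^ 2 ∂μ :=
        setIntegral_mono_on (integrable_const _) hint.integrableOn hA hc
    _ ≤ _ := setIntegral_le_integral hint (Eventually.of_forall fun t => by positivity)

theorem ae_exp_notMem {A : Set Circle} (hA : arcLength A = 0) :
    ∀ᵐ θ : ℝ, Circle.exp θ ∉ A := by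
  have h1 : volume (lift A) = 0 := by
    have hsub : lift A ⊆ ⋃ m : ℤ, (fun t => t + (m : ℝ)) ⁻¹' (Ico 0 1 ∩ lift A) := by
      intro t ht
      refine mem_iUnion.2 ⟨-⌊t⌋, ⟨⟨?_, ?_⟩, ?_⟩⟩
      · push_cast; linarith [Int.floor_le t]
      · push_cast; linarith [Int.lt_floor_add_one t]
      · rw [mem_lift, turn_add_intCast]; exact ht
    refine measure_mono_null hsub (measure_iUnion_null fun m => ?_)
    rw [measure_preimage_add_right]
    exact hA
  rw [ae_iff]
  simp only [not_not]
  have h2 : {θ : ℝ | Circle.exp θ ∈ A} = (fun θ => (2 * Real.pi)⁻¹ * θ) ⁻¹' lift A := by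
    ext θ
    rw [mem_ofPred_eq, mem_preimage, mem_lift, turn, ← mul_assoc, mul_inv_cancel₀ (by positivity),
      one_mul]
  rw [h2, Real.volume_preimage_mul_left (by positivity), h1, mul_zero]

theorem arcLength_eq_zero_of_countable {A : Set Circle} (hA : A.Countable) : arcLength A = 0 := by
  rw [arcLength_eq]
  refine Set.Countable.measure_zero ?_ _
  have h1 : MapsTo turn (Ico 0 1 ∩ lift A) A := fun t ht => ht.2
  refine h1.countable_of_injOn ?_ hA
  have := injOn_turn_Ico 0
  rw [zero_add] at this
  exact this.mono inter_subset_left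

theorem tendsto_radial (ζ : ℂ) : Tendsto (fun r : ℝ => (r : ℂ) * ζ) (𝓝[<] 1) (𝓝 ζ) := by
  have : Continuous fun r : ℝ => (r : ℂ) * ζ := by fun_prop
  simpa using (this.tendsto 1).mono_left nhdsWithin_le_nhds

/-- Countability of `C` serves only to make its image null; at the other boundary points the real
part of the Herglotz integral vanishes, so the modulus is `1`. -/
theorem isSingularInner_exp_neg_herglotz (hC : IsCompact C) (hμ : μ Cᶜ = 0) (hCc : C.Countable) :
    IsSingularInner fun z => Complex.exp (-herglotz μ z) where
  analytic z hz := (differentiableAt_herglotz hC hμ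
    (notMem_image_turn (mem_disc.1 hz) C)).neg.cexp.differentiableWithinAt
  bounded := by
    refine ⟨1, fun z hz => ?_⟩
    have hz' := mem_disc.1 hz
    rw [norm_exp_neg_herglotz, Real.exp_le_one_iff, Left.neg_nonpos_iff]
    rw [re_herglotz hC hμ (notMem_image_turn hz' C)]
    have h0 : 0 ≤ 1 - ‖z‖ ^ 2 := by nlinarith [norm_nonneg z]
    exact integral_nonneg fun t => by positivity
  radial_limit := by
    have hcount : (turn '' C).Countable := hCc.image _
    filter_upwards [ae_exp_notMem (arcLength_eq_zero_of_countable hcount)] with θ hθ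
    have hζ : (Circle.exp θ : ℂ) ∉ (fun t => (turn t : ℂ)) '' C := by
      rintro ⟨t, ht, h⟩
      exact hθ ⟨t, ht, Subtype.ext h⟩
    refine ⟨Complex.exp (-herglotz μ (Circle.exp θ)), ?_, ?_⟩
    · rw [norm_exp_neg_herglotz, re_herglotz hC hμ hζ]
      simp
    · have h1 := (differentiableAt_herglotz hC hμ hζ).neg.cexp.continuousAt
      exact h1.tendsto.comp (tendsto_radial _)
  ne_zero z _ := Complex.exp_ne_zero _

theorem singularSet_exp_neg_herglotz_subset (hC : IsCompact C) (hμ : μ Cᶜ = 0) :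
    singularSet (fun z => Complex.exp (-herglotz μ z)) ⊆ turn '' C := by
  intro ζ hζ
  by_contra hζC
  have hcl : IsClosed ((fun t => (turn t : ℂ)) '' C) := (hC.image continuous_coe_turn).isClosed
  refine hζ ⟨_, ?_, Eventually.of_forall fun z => rfl⟩
  have hd : DifferentiableOn ℂ (fun z => Complex.exp (-herglotz μ z))
      ((fun t => (turn t : ℂ)) '' C)ᶜ := fun z hz =>
    (differentiableAt_herglotz hC hμ hz).neg.cexp.differentiableWithinAt
  refine hd.analyticAt (hcl.isOpen_compl.mem_nhds ?_)
  rintro ⟨t, ht, h⟩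
  exact hζC ⟨t, ht, Subtype.ext h⟩

end

/-! ### Points of the disc above dyadic arcs -/

theorem dist_turn_le (s t : ℝ) : ‖(turn s : ℂ) - turn t‖ ≤ 2 * Real.pi * |s - t| := by
  have h1 : (turn s : ℂ) - turn t =
      turn t * (Complex.exp (Complex.I * (2 * Real.pi * (s - t) : ℝ)) - 1) := by
    rw [mul_sub, mul_one, turn, turn, Circle.coe_exp, Circle.coe_exp, ← Complex.exp_add]
    congr 2
    push_cast
    ring
  rw [h1, norm_mul, norm_turn, one_mul]
  refine (Real.norm_exp_I_mul_ofReal_sub_one_le).trans_eq ?_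
  rw [Real.norm_eq_abs, abs_mul, abs_of_pos (by positivity)]

theorem le_dist_turn {s t : ℝ} (h : |s - t| ≤ 1 / 2) :
    4 * |s - t| ≤ ‖(turn s : ℂ) - turn t‖ := by
  have h1 : (turn s : ℂ) - turn t =
      turn t * (Complex.exp (Complex.I * (2 * Real.pi * (s - t) : ℝ)) - 1) := by
    rw [mul_sub, mul_one, turn, turn, Circle.coe_exp, Circle.coe_exp, ← Complex.exp_add]
    congr 2
    push_cast
    ring
  rw [h1, norm_mul, norm_turn, one_mul, Complex.norm_exp_I_mul_ofReal_sub_one, Real.norm_eq_abs,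
    abs_mul, abs_of_pos (two_pos : (0 : ℝ) < 2), show 2 * Real.pi * (s - t) / 2 =
    Real.pi * (s - t) by ring]
  have h2 := Real.mul_abs_le_abs_sin (x := Real.pi * (s - t)) (by
    rw [abs_mul, abs_of_pos Real.pi_pos]
    nlinarith [Real.pi_pos])
  rw [abs_mul, abs_of_pos Real.pi_pos, ← mul_assoc, div_mul_cancel₀ _ Real.pi_ne_zero] at h2
  linarith

/-- The point of the disc above the centre of the dyadic arc `turn '' dyadic n i`. -/
def boxPoint (n i : ℕ) : ℂ := ((1 - (1 / 2 : ℝ) ^ (n + 1) : ℝ) : ℂ) * turn ((i + 1 / 2 : ℝ) / 2 ^ n)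

theorem half_pow_succ_le (n : ℕ) : (1 / 2 : ℝ) ^ (n + 1) ≤ 1 / 2 := by
  rw [pow_succ]
  have : (1 / 2 : ℝ) ^ n ≤ 1 := pow_le_one₀ (by norm_num) (by norm_num)
  linarith

theorem norm_boxPoint (n i : ℕ) : ‖boxPoint n i‖ = 1 - (1 / 2 : ℝ) ^ (n + 1) := by
  rw [boxPoint, norm_mul, norm_turn, mul_one, Complex.norm_real, Real.norm_of_nonneg]
  linarith [half_pow_succ_le n]

theorem boxPoint_mem_disc (n i : ℕ) : boxPoint n i ∈ disc := by
  rw [mem_disc, norm_boxPoint]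
  linarith [pow_pos (by norm_num : (0 : ℝ) < 1 / 2) (n + 1)]

/-- With `h` the height of the point, the kernel over its arc is at least `h / (8 * h) ^ 2`, and `2
^ n * h = 1 / 2`. -/
theorem le_poisson_boxPoint {n i : ℕ} {t : ℝ} (ht : t ∈ dyadic n i) :
    (2 : ℝ) ^ n / 32 ≤ (1 - ‖boxPoint n i‖ ^ 2) / ‖(turn t : ℂ) - boxPoint n i‖ ^ 2 := by
  set h := (1 / 2 : ℝ) ^ (n + 1) with hh
  have hpos : 0 < h := by positivity
  have h2n : (2 : ℝ) ^ n * h = 1 / 2 := by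
    rw [hh, pow_succ, ← mul_assoc, ← mul_pow]; norm_num
  have hle := half_pow_succ_le n
  have hz := norm_boxPoint n i
  have hz1 := boxPoint_mem_disc n i
  have hne : 0 < ‖(turn t : ℂ) - boxPoint n i‖ := by
    rw [norm_pos_iff, sub_ne_zero]
    intro h0
    have := norm_turn t
    rw [h0] at this
    linarith [mem_disc.1 hz1]
  have htc : |t - (i + 1 / 2 : ℝ) / 2 ^ n| ≤ h := by
    rw [mem_dyadic] at ht
    have h2 : (0 : ℝ) < 2 ^ n := by positivity
    have h3 : h = 1 / 2 / 2 ^ n := by rw [eq_div_iff h2.ne']; linarith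
    have h4 : t - (i + 1 / 2 : ℝ) / 2 ^ n = (t * 2 ^ n - (i + 1 / 2)) / 2 ^ n := by
      rw [sub_div, mul_div_cancel_right₀ _ h2.ne']
    rw [h3, h4, abs_div, abs_of_pos h2]
    gcongr
    rw [abs_le]
    constructor <;> linarith [ht.1, ht.2]
  have hdist : ‖(turn t : ℂ) - boxPoint n i‖ ≤ 8 * h := by
    have h1 : (turn t : ℂ) - boxPoint n i = ((turn t : ℂ) - turn ((i + 1 / 2 : ℝ) / 2 ^ n)) +
        (h : ℂ) * turn ((i + 1 / 2 : ℝ) / 2 ^ n) := by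
      rw [boxPoint, ← hh, Complex.ofReal_sub, Complex.ofReal_one]; ring
    rw [h1]
    refine (norm_add_le _ _).trans ?_
    rw [norm_mul, norm_turn, mul_one, Complex.norm_real, Real.norm_of_nonneg hpos.le]
    have h2 := dist_turn_le t ((i + 1 / 2 : ℝ) / 2 ^ n)
    nlinarith [Real.pi_lt_d2, Real.pi_pos, abs_nonneg (t - (i + 1 / 2 : ℝ) / 2 ^ n)]
  rw [hz, le_div_iff₀ (by positivity)]
  have h5 : ‖(turn t : ℂ) - boxPoint n i‖ ^ 2 ≤ (8 * h) ^ 2 := by gcongr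
  have h6 : (2 : ℝ) ^ n / 32 * ‖(turn t : ℂ) - boxPoint n i‖ ^ 2 ≤ (2 : ℝ) ^ n / 32 * (8 * h) ^ 2 := by
    gcongr
  nlinarith

theorem norm_sub_le_of_pseudoDist_lt {z w : ℂ} (hz : ‖z‖ < 1) (hw : ‖w‖ < 1)
    (h : pseudoDist z w < 1 / 100) : ‖z - w‖ ≤ (1 - ‖z‖) / 40 := by
  have h0 := norm_pos_iff.2 (one_sub_conj_mul_ne_zero hz hw.le)
  rw [pseudoDist, norm_div, div_lt_iff₀ h0] at h
  have h1 : ‖1 - conj w * z‖ ≤ (1 - ‖z‖ ^ 2) + ‖z - w‖ * ‖z‖ := by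
    have h2 : 1 - conj w * z = ((1 - ‖z‖ ^ 2 : ℝ) : ℂ) + conj (z - w) * z := by
      have h3 : conj z * z = ((‖z‖ ^ 2 : ℝ) : ℂ) := by
        rw [mul_comm, Complex.mul_conj, Complex.normSq_eq_norm_sq]
      rw [map_sub, sub_mul, h3]
      push_cast
      ring
    rw [h2]
    refine (norm_add_le _ _).trans_eq ?_
    rw [norm_mul, RCLike.norm_conj, Complex.norm_real, Real.norm_of_nonneg]
    nlinarith [norm_nonneg z]
  nlinarith [norm_nonneg z, norm_nonneg (z - w)]

theorem two_mul_le_norm_turn_sub {n i j : ℕ} (hi : i < 2 ^ n) (hj : j < 2 ^ n) (hij : i ≠ j) :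
    8 * (1 / 2 : ℝ) ^ (n + 1) ≤
      ‖(turn ((i + 1 / 2 : ℝ) / 2 ^ n) : ℂ) - turn ((j + 1 / 2 : ℝ) / 2 ^ n)‖ := by
  wlog hlt : j < i generalizing i j
  · rw [norm_sub_rev]
    exact this hj hi hij.symm (by omega)
  set h := (1 / 2 : ℝ) ^ (n + 1) with hh
  have h2 : (0 : ℝ) < 2 ^ n := by positivity
  have h3 : h = 1 / 2 / 2 ^ n := by rw [hh, pow_succ, one_div_pow]; ring
  set c := (i + 1 / 2 : ℝ) / 2 ^ n with hc
  set d := (j + 1 / 2 : ℝ) / 2 ^ n with hd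
  have hcd : c - d = (i - j : ℝ) / 2 ^ n := by rw [hc, hd]; ring
  have e1 : (j : ℝ) + 1 ≤ i := by exact_mod_cast hlt
  have e2 : (i : ℝ) + 1 ≤ 2 ^ n := by exact_mod_cast hi
  have e3 : (0 : ℝ) ≤ j := Nat.cast_nonneg j
  have l1 : 2 * h ≤ c - d := by
    rw [hcd, h3, le_div_iff₀ h2]
    field_simp
    linarith
  have l2 : c - d ≤ 1 - 2 * h := by
    rw [hcd, h3, div_le_iff₀ h2, sub_mul]
    field_simp
    linarith
  have hpos : 0 < h := by positivity
  -- The chord bound needs a difference of at most half a turn; otherwise go round the other way,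
  -- where the gap is still at least `2 * h`.
  rcases le_or_gt (c - d) (1 / 2) with hle | hgt
  · have := le_dist_turn (s := c) (t := d) (by rw [abs_of_nonneg (by linarith)]; exact hle)
    rw [abs_of_nonneg (by linarith)] at this
    linarith
  · have := le_dist_turn (s := c - 1) (t := d) (by rw [abs_of_nonpos (by linarith)]; linarith)
    rw [abs_of_nonpos (by linarith), turn_sub_one] at this
    linarith

/-- The discs of pseudohyperbolic radius `1 / 100` about the box points are disjoint: different
generations are separated by the modulus, equal generations by the argument. Hence zeros found near
different box points are different. -/
theorem eq_of_pseudoDist_boxPoint_lt {n m i j : ℕ} (hi : i < 2 ^ n) (hj : j < 2 ^ m) {w : ℂ}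
    (hw : ‖w‖ < 1) (h1 : pseudoDist (boxPoint n i) w < 1 / 100)
    (h2 : pseudoDist (boxPoint m j) w < 1 / 100) : n = m ∧ i = j := by
  have d1 := norm_sub_le_of_pseudoDist_lt (mem_disc.1 (boxPoint_mem_disc n i)) hw h1
  have d2 := norm_sub_le_of_pseudoDist_lt (mem_disc.1 (boxPoint_mem_disc m j)) hw h2
  rw [norm_boxPoint] at d1 d2
  have d3 : ‖boxPoint n i - boxPoint m j‖ ≤ ((1 / 2 : ℝ) ^ (n + 1) + (1 / 2 : ℝ) ^ (m + 1)) / 40 := by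
    have : boxPoint n i - boxPoint m j = (boxPoint n i - w) - (boxPoint m j - w) := by ring
    rw [this]
    refine (norm_sub_le _ _).trans ?_
    linarith
  have hn : (0 : ℝ) < (1 / 2 : ℝ) ^ (n + 1) := by positivity
  have hm : (0 : ℝ) < (1 / 2 : ℝ) ^ (m + 1) := by positivity
  have hlevel : ∀ a b : ℕ, a < b → (1 / 2 : ℝ) ^ (b + 1) ≤ (1 / 2 : ℝ) ^ (a + 1) / 2 := fun a b hab => by
    calc (1 / 2 : ℝ) ^ (b + 1) ≤ (1 / 2 : ℝ) ^ (a + 1 + 1) :=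
          pow_le_pow_of_le_one (by norm_num) (by norm_num) (by omega)
      _ = _ := by rw [pow_succ _ (a + 1)]; ring
  have hnorm := abs_le.1 ((abs_norm_sub_norm_le (boxPoint n i) (boxPoint m j)).trans d3)
  rw [norm_boxPoint, norm_boxPoint] at hnorm
  have hnm : n = m := by
    rcases lt_trichotomy n m with h | h | h
    · have := hlevel n m h; linarith [hnorm.1, hnorm.2]
    · exact h
    · have := hlevel m n h; linarith [hnorm.1, hnorm.2]
  subst hnm
  refine ⟨rfl, ?_⟩
  by_contra hij
  have h4 := two_mul_le_norm_turn_sub hi hj hij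
  have h5 : ‖boxPoint n i - boxPoint n j‖ = (1 - (1 / 2 : ℝ) ^ (n + 1)) *
      ‖(turn ((i + 1 / 2 : ℝ) / 2 ^ n) : ℂ) - turn ((j + 1 / 2 : ℝ) / 2 ^ n)‖ := by
    rw [boxPoint, boxPoint, ← mul_sub, norm_mul, Complex.norm_real, Real.norm_of_nonneg]
    linarith [half_pow_succ_le n]
  have h6 := half_pow_succ_le n
  nlinarith

/-! ### Necessity of the Beurling–Carleson condition -/

theorem exists_zero_of_WEP {I : ℂ → ℂ} (hI : WEP I) {ε : ℝ} (hε : 0 < ε) :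
    ∃ c : ℝ, 0 < c ∧ ∀ z ∈ disc, ‖I z‖ < c → ∃ w ∈ zeroSet I, pseudoDist z w < ε := by
  -- The infimum in `eta` runs over points at distance strictly larger than its parameter; halving
  -- leaves room when all distances are only known to be `≥ ε`.
  have h1 := hI (ε / 2) (by positivity)
  obtain ⟨c, hc0, hc⟩ := exists_between h1
  have hctop : c ≠ ⊤ := ne_top_of_lt hc
  refine ⟨c.toReal, ENNReal.toReal_pos hc0.ne' hctop, fun z hz hlt => ?_⟩
  by_contra! hno
  have h2 : ENNReal.ofReal (ε / 2) < pseudoInfDist z (zeroSet I) := by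
    refine lt_of_lt_of_le ((ENNReal.ofReal_lt_ofReal_iff hε).2 (half_lt_self hε)) ?_
    exact le_iInf₂ fun w hw => ENNReal.ofReal_le_ofReal (hno w hw)
  have h3 : eta I (ε / 2) ≤ ‖I z‖ₑ := iInf₂_le z ⟨hz, h2⟩
  have h4 : ‖I z‖ₑ < c := by
    rw [← ofReal_norm, ENNReal.ofReal_lt_iff_lt_toReal (norm_nonneg _) hctop]
    exact hlt
  exact absurd (hc.trans_le h3) (not_lt.2 h4.le)

theorem not_isWepable_of_heavy {μ : Measure ℝ} [IsFiniteMeasure μ] {C : Set ℝ} (hC : IsCompact C)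
    (hμ : μ Cᶜ = 0)
    (hG : ∀ k : ℕ, ∃ G : Finset (ℕ × ℕ),
      (∀ p ∈ G, p.2 < 2 ^ p.1 ∧ (k : ℝ≥0∞) * 2⁻¹ ^ p.1 ≤ μ (dyadic p.1 p.2)) ∧
      (k : ℝ≥0∞) ≤ ∑ p ∈ G, (2 : ℝ≥0∞)⁻¹ ^ p.1) :
    ¬ IsWepable fun z => Complex.exp (-herglotz μ z) := by
  rintro ⟨J, hJ, hW⟩
  obtain ⟨c, hc, hzero⟩ := exists_zero_of_WEP hW (by norm_num : (0 : ℝ) < 1 / 100)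
  obtain ⟨p, hp, hJp⟩ := hJ.exists_ne_zero
  obtain ⟨B, hB⟩ := exists_sum_one_sub_norm_le hJ.analytic (fun z hz => hJ.norm_le_one hz) hp hJp
  -- `32 * (-log c)` makes `exp (-k / 32) < c` at the box points; `4 * B` makes their zeros violate
  -- the Blaschke bound.
  obtain ⟨k, hk⟩ := exists_nat_gt (max (4 * B) (32 * (-Real.log c)))
  have hk1 := (le_max_left _ _).trans_lt hk
  have hk2 := (le_max_right _ _).trans_lt hk
  obtain ⟨G, hG1, hG2⟩ := hG k
  have htoReal : ∀ n : ℕ, ((2 : ℝ≥0∞)⁻¹ ^ n).toReal = (1 / 2 : ℝ) ^ n := fun n => by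
    rw [ENNReal.toReal_pow, ENNReal.toReal_inv, ENNReal.toReal_ofNat, one_div]
  have hex : ∀ q ∈ G, ∃ w ∈ zeroSet J, pseudoDist (boxPoint q.1 q.2) w < 1 / 100 := fun q hq => by
    obtain ⟨hq1, hq2⟩ := hG1 q hq
    have hz := boxPoint_mem_disc q.1 q.2
    have h1 : (k : ℝ) * (1 / 2) ^ q.1 ≤ (μ (dyadic q.1 q.2)).toReal := by
      have := ENNReal.toReal_mono (measure_ne_top μ _) hq2
      rwa [ENNReal.toReal_mul, ENNReal.toReal_natCast, htoReal] at this
    have h2 := mul_le_re_herglotz hC hμ (mem_disc.1 hz) (measurableSet_dyadic q.1 q.2)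
      fun t ht => le_poisson_boxPoint ht
    have h3 : (k : ℝ) / 32 ≤ (herglotz μ (boxPoint q.1 q.2)).re := by
      refine le_trans ?_ h2
      calc (k : ℝ) / 32 = 2 ^ q.1 / 32 * (k * (1 / 2) ^ q.1) := by
            rw [one_div_pow]; field_simp
        _ ≤ _ := by gcongr
    obtain ⟨w, ⟨hw1, hw2⟩, hw3⟩ := hzero _ hz (by
      rw [norm_mul, norm_exp_neg_herglotz]
      calc _ ≤ Real.exp (-(herglotz μ (boxPoint q.1 q.2)).re) * 1 := by
            gcongr; exact hJ.norm_le_one hz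
        _ ≤ Real.exp (-(k / 32)) := by rw [mul_one]; gcongr
        _ < Real.exp (Real.log c) := by gcongr; linarith
        _ = c := Real.exp_log hc)
    exact ⟨w, ⟨hw1, (mul_eq_zero.1 hw2).resolve_left (Complex.exp_ne_zero _)⟩, hw3⟩
  choose! w hw1 hw2 using hex
  have hinj : Set.InjOn w G := fun q hq q' hq' h => by
    have h1 := hw2 q hq
    have h2 := hw2 q' hq'
    rw [← h] at h2
    obtain ⟨e1, e2⟩ := eq_of_pseudoDist_boxPoint_lt (hG1 q hq).1 (hG1 q' hq').1
      (mem_disc.1 (hw1 q hq).1) h1 h2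
    exact Prod.ext e1 e2
  have h1 := hB (G.image w) fun v hv => by
    obtain ⟨q, hq, rfl⟩ := Finset.mem_image.1 hv
    exact hw1 q hq
  rw [Finset.sum_image hinj] at h1
  -- A box point has height `2 ^ (-n) / 2`, and a zero that close has at least half of this height.
  have h2 : ∑ q ∈ G, (1 / 2 : ℝ) ^ q.1 / 4 ≤ ∑ q ∈ G, (1 - ‖w q‖) := by
    refine Finset.sum_le_sum fun q hq => ?_
    have h3 := norm_sub_le_of_pseudoDist_lt (mem_disc.1 (boxPoint_mem_disc q.1 q.2))
      (mem_disc.1 (hw1 q hq).1) (hw2 q hq)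
    have h4 := abs_le.1 (abs_norm_sub_norm_le (boxPoint q.1 q.2) (w q))
    rw [norm_boxPoint, pow_succ] at h3 h4
    have h5 : (0 : ℝ) < (1 / 2) ^ q.1 := by positivity
    linarith [h4.1, h4.2]
  have h3 : (k : ℝ) ≤ ∑ q ∈ G, (1 / 2 : ℝ) ^ q.1 := by
    have := ENNReal.toReal_mono (by
      refine (ENNReal.sum_lt_top.2 fun q _ => ?_).ne
      exact ENNReal.pow_lt_top (by simp)) hG2
    rw [ENNReal.toReal_natCast, ENNReal.toReal_sum fun q _ => ENNReal.pow_ne_top (by simp)] at this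
    simpa only [htoReal] using this
  rw [← Finset.sum_div] at h2
  linarith

/-- If every singular inner function with singular set in `E` is wepable, then `E` is a
Beurling–Carleson set. -/
theorem arcLength_eq_zero_and_entropy_lt_top {E : Set Circle} (hE : IsClosed E)
    (h : ∀ S : ℂ → ℂ, IsSingularInner S → singularSet S ⊆ E → IsWepable S) :
    arcLength E = 0 ∧ entropy E < ⊤ := by
  by_cases htop : metSum (Ico 0 1 ∩ lift E) 0 0 = ⊤
  · obtain ⟨μ, C, hfin, hCc, hCcl, hCX, hCI, hμ, hG⟩ := exists_heavy_measure htop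
    have hC : IsCompact C := isCompact_Icc.of_isClosed_subset hCcl hCI
    refine (not_isWepable_of_heavy hC hμ hG (h _ (isSingularInner_exp_neg_herglotz hC hμ hCc) ?_)).elim
    refine (singularSet_exp_neg_herglotz_subset hC hμ).trans (image_subset_iff.2 ?_)
    exact hCX.trans (closure_minimal inter_subset_right (isClosed_lift hE))
  · exact ⟨arcLength_eq_zero_of_metSum_ne_top htop,
      (entropy_le_metSum hE).trans_lt (lt_top_iff_ne_top.2 htop)⟩

/-! ### Neighbourhoods of a Beurling–Carleson set -/

/-- The distance in the plane from a point to a subset of the circle. -/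
def circDist (E : Set Circle) (z : ℂ) : ℝ := Metric.infDist z ((fun ζ : Circle => (ζ : ℂ)) '' E)

theorem circDist_nonneg (E : Set Circle) (z : ℂ) : 0 ≤ circDist E z := Metric.infDist_nonneg

theorem circDist_le_add (E : Set Circle) (z w : ℂ) : circDist E z ≤ circDist E w + ‖z - w‖ := by
  rw [← dist_eq_norm]
  exact Metric.infDist_le_infDist_add_dist

theorem circDist_le_norm_sub {E : Set Circle} {ζ : Circle} (hζ : ζ ∈ E) (z : ℂ) :
    circDist E z ≤ ‖z - ζ‖ := by
  rw [← dist_eq_norm]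
  exact Metric.infDist_le_dist_of_mem (mem_image_of_mem _ hζ)

theorem exists_circDist_eq {E : Set Circle} (hE : IsClosed E) (hne : E.Nonempty) (z : ℂ) :
    ∃ ζ ∈ E, circDist E z = ‖z - ζ‖ := by
  have hc : IsCompact ((fun ζ : Circle => (ζ : ℂ)) '' E) :=
    hE.isCompact.image continuous_subtype_val
  obtain ⟨_, ⟨ζ, hζ, rfl⟩, h⟩ := hc.exists_infDist_eq_dist (hne.image _) z
  exact ⟨ζ, hζ, by rw [circDist, h, dist_eq_norm]⟩

theorem volume_Ico_inter_lift_le {t₀ : ℝ} (ht₀ : t₀ ∈ Ico (0 : ℝ) 1) (Q : Set Circle) :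
    volume (Ico 0 1 ∩ lift Q) ≤ volume (Ico t₀ (t₀ + 1) ∩ lift Q) := by
  have h1 : Ico 0 1 ∩ lift Q ⊆ (fun t => t + (1 : ℝ)) ⁻¹' ((Ico t₀ (t₀ + 1) ∩ lift Q) \ Iio 1) ∪
      ((Ico t₀ (t₀ + 1) ∩ lift Q) ∩ Iio 1) := by
    rintro t ⟨ht, htQ⟩
    rcases lt_or_ge t t₀ with h | h
    · refine Or.inl ⟨⟨⟨by linarith [ht.1, ht₀.2], by linarith⟩, ?_⟩, ?_⟩
      · rw [mem_lift, turn_add_one]; exact htQ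
      · rw [mem_Iio]; linarith [ht.1]
    · exact Or.inr ⟨⟨⟨h, by linarith [ht.2, ht₀.1]⟩, htQ⟩, ht.2⟩
  refine (measure_mono h1).trans ((measure_union_le _ _).trans_eq ?_)
  rw [measure_preimage_add_right, add_comm, measure_inter_add_sdiff _ measurableSet_Iio]

/-- Seen in a period that starts at a point of `E`, an arc is an interval: a missing point `s` would
split the connected set `J` into two nonempty relatively open pieces. -/
theorem mem_lift_of_between {E J : Set Circle} (hJ : J ∈ complementaryArcs E) {t₀ : ℝ}
    (ht₀ : turn t₀ ∈ E) {t₁ s t₂ : ℝ} (h₁ : t₁ ∈ Ico t₀ (t₀ + 1) ∩ lift J)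
    (h₂ : t₂ ∈ Ico t₀ (t₀ + 1) ∩ lift J) (hs₁ : t₁ < s) (hs₂ : s < t₂) : s ∈ lift J := by
  by_contra hs
  have hsub := subset_of_mem_complementaryArcs hJ
  have hconn : IsPreconnected J := by
    obtain ⟨ζ, -, rfl⟩ := hJ
    exact isPreconnected_connectedComponentIn
  have h₁0 : t₀ < t₁ := lt_of_le_of_ne h₁.1.1 fun h => hsub h₁.2 (h ▸ ht₀)
  have hU := isOpenMap_turn _ (isOpen_Ioo (a := t₀) (b := s))
  have hV := isOpenMap_turn _ (isOpen_Ioo (a := s) (b := t₀ + 1))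
  have hcov : J ⊆ turn '' Ioo t₀ s ∪ turn '' Ioo s (t₀ + 1) := fun ζ hζ => by
    obtain ⟨u, hu, rfl⟩ := exists_turn_eq_Ico t₀ ζ
    have hu0 : t₀ < u := lt_of_le_of_ne hu.1 fun h => hsub hζ (h ▸ ht₀)
    rcases lt_trichotomy u s with h | h | h
    · exact Or.inl ⟨u, ⟨hu0, h⟩, rfl⟩
    · exact (hs (h ▸ hζ)).elim
    · exact Or.inr ⟨u, ⟨h, hu.2⟩, rfl⟩
  obtain ⟨ζ, -, ⟨u, hu, hu'⟩, ⟨v, hv, hv'⟩⟩ := hconn _ _ hU hV hcov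
    ⟨turn t₁, h₁.2, mem_image_of_mem _ ⟨h₁0, hs₁⟩⟩
    ⟨turn t₂, h₂.2, mem_image_of_mem _ ⟨hs₂, h₂.1.2⟩⟩
  have := injOn_turn_Ico t₀ ⟨hu.1.le, by linarith [hu.2, h₂.1.2]⟩
    ⟨by linarith [hv.1, h₁0], hv.2⟩ (hu'.trans hv'.symm)
  linarith [hu.2, hv.1]

/-- In one arc the points within `r` of `E` lie near its two ends. Since chords are at least `4 * |s
- t|`, each end contributes at most `r / 4`. -/
theorem volume_layer_le {E J : Set Circle} (hE : IsClosed E) (hne : E.Nonempty)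
    (hJ : J ∈ complementaryArcs E) {r : ℝ} (hr : 0 ≤ r) :
    volume (Ico 0 1 ∩ lift (J ∩ {ζ | circDist E ζ ≤ r})) ≤ ENNReal.ofReal r := by
  obtain ⟨ζ₀, hζ₀⟩ := hne
  obtain ⟨t₀, ht₀, rfl⟩ := exists_turn_eq_Ico 0 ζ₀
  rw [zero_add] at ht₀
  refine (volume_Ico_inter_lift_le ht₀ _).trans ?_
  set B := Ico t₀ (t₀ + 1) ∩ lift J with hB
  have hsub : Ico t₀ (t₀ + 1) ∩ lift (J ∩ {ζ | circDist E ζ ≤ r}) ⊆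
      Icc (sInf B) (sInf B + r / 4) ∪ Icc (sSup B - r / 4) (sSup B) := by
    rintro t ⟨ht, htJ, htr⟩
    have htB : t ∈ B := ⟨ht, htJ⟩
    have hbb : BddBelow B := ⟨t₀, fun x hx => hx.1.1⟩
    have hba : BddAbove B := ⟨t₀ + 1, fun x hx => hx.1.2.le⟩
    obtain ⟨ξ, hξ, hdist⟩ := exists_circDist_eq hE ⟨_, hζ₀⟩ (turn t : ℂ)
    -- The parameter of the nearest point of `E` is taken within half a turn of `t`, as the chord
    -- estimate requires. It is not in the arc, so it lies beyond one of the ends of `B`.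
    obtain ⟨s, hs, rfl⟩ := exists_turn_eq_Ico (t - 1 / 2) ξ
    have hst : |t - s| ≤ 1 / 2 := by rw [abs_le]; constructor <;> linarith [hs.1, hs.2]
    have h4 := le_dist_turn hst
    have htr' : circDist E (turn t) ≤ r := htr
    rw [← hdist] at h4
    have hsJ : s ∉ lift J := fun h => subset_of_mem_complementaryArcs hJ h hξ
    have hneq : s ≠ t := fun h => hsJ (h ▸ htJ)
    have habs := abs_le.1 (show |t - s| ≤ r / 4 by linarith)
    rcases lt_or_gt_of_ne hneq with hlt | hgt
    · left
      refine ⟨csInf_le hbb htB, ?_⟩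
      have : s ≤ sInf B := by
        by_contra! h
        obtain ⟨t₁, ht₁, h1⟩ := exists_lt_of_csInf_lt ⟨t, htB⟩ h
        exact hsJ (mem_lift_of_between hJ hζ₀ ht₁ htB h1 hlt)
      linarith [habs.2]
    · right
      refine ⟨?_, le_csSup hba htB⟩
      have : sSup B ≤ s := by
        by_contra! h
        obtain ⟨t₁, ht₁, h1⟩ := exists_lt_of_lt_csSup ⟨t, htB⟩ h
        exact hsJ (mem_lift_of_between hJ hζ₀ htB ht₁ hgt h1)
      linarith [habs.1]
  refine (measure_mono hsub).trans ((measure_union_le _ _).trans ?_)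
  rw [Real.volume_Icc, Real.volume_Icc, ← ENNReal.ofReal_add (by linarith) (by linarith)]
  exact ENNReal.ofReal_le_ofReal (by linarith)

/-- Cut at `N`, about `log₂ (1 / ℓ)`: the first `N` terms are bounded by `ℓ` each and give the
entropy term, the geometric tail is at most `2 * c * ℓ`. -/
theorem tsum_min_geometric_le {ℓ c : ℝ} (hℓ0 : 0 ≤ ℓ) (hℓ1 : ℓ ≤ 1) (hc : 0 ≤ c) :
    ∑' n : ℕ, min (ENNReal.ofReal ℓ) (ENNReal.ofReal (c * (1 / 2) ^ n)) ≤
      2 * ENNReal.ofReal (ℓ * Real.log ℓ⁻¹) + ENNReal.ofReal (1 + 2 * c) * ENNReal.ofReal ℓ := by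
  rcases hℓ0.eq_or_lt with h0 | h0
  · simp [← h0]
  set N := ⌈Real.log ℓ⁻¹ / Real.log 2⌉₊ with hN
  have hl2 : 0 < Real.log 2 := Real.log_pos one_lt_two
  have hlog : 0 ≤ Real.log ℓ⁻¹ := Real.log_nonneg ((one_le_inv₀ h0).2 hℓ1)
  have hNle : (N : ℝ) ≤ 2 * Real.log ℓ⁻¹ + 1 := by
    have h1 := (Nat.ceil_lt_add_one (div_nonneg hlog hl2.le)).le
    have h2 : Real.log ℓ⁻¹ / Real.log 2 ≤ 2 * Real.log ℓ⁻¹ := by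
      rw [div_le_iff₀ hl2]
      nlinarith [Real.log_two_gt_d9]
    linarith
  have hpow : (1 / 2 : ℝ) ^ N ≤ ℓ := by
    have h1 : Real.log ℓ⁻¹ / Real.log 2 ≤ N := Nat.le_ceil _
    rw [div_le_iff₀ hl2] at h1
    rw [← Real.log_le_log_iff (by positivity) h0, Real.log_pow, one_div, Real.log_inv]
    rw [Real.log_inv] at h1
    linarith
  have hsummable : Summable fun n : ℕ => c * (1 / 2 : ℝ) ^ n :=
    (summable_geometric_of_lt_one (by norm_num) (by norm_num)).mul_left c
  have hshift : ∀ n : ℕ, c * (1 / 2 : ℝ) ^ (n + N) = (1 / 2) ^ N * (c * (1 / 2) ^ n) := fun n => by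
    rw [pow_add]; ring
  rw [← ENNReal.summable.sum_add_tsum_nat_add' (k := N)]
  calc _ ≤ ∑ _n ∈ Finset.range N, ENNReal.ofReal ℓ +
        ∑' n : ℕ, ENNReal.ofReal (c * (1 / 2) ^ (n + N)) := by
        gcongr
        · exact min_le_left _ _
        · exact min_le_right _ _
    _ = ENNReal.ofReal (N * ℓ) + ENNReal.ofReal ((1 / 2) ^ N * (c * 2)) := by
        congr 1
        · rw [Finset.sum_const, Finset.card_range, nsmul_eq_mul,
            ENNReal.ofReal_mul (Nat.cast_nonneg _), ENNReal.ofReal_natCast]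
        · simp_rw [hshift]
          rw [← ENNReal.ofReal_tsum_of_nonneg (fun n => by positivity) (hsummable.mul_left _),
            tsum_mul_left, tsum_mul_left, tsum_geometric_two]
    _ = ENNReal.ofReal (N * ℓ + (1 / 2) ^ N * (c * 2)) :=
        (ENNReal.ofReal_add (by positivity) (by positivity)).symm
    _ ≤ ENNReal.ofReal (2 * (ℓ * Real.log ℓ⁻¹) + (1 + 2 * c) * ℓ) := by
        refine ENNReal.ofReal_le_ofReal ?_
        nlinarith [mul_le_mul_of_nonneg_right hNle hℓ0, mul_le_mul_of_nonneg_right hpow hc]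
    _ = _ := by
        rw [ENNReal.ofReal_add (by positivity) (by positivity), ENNReal.ofReal_mul two_pos.le,
          ENNReal.ofReal_mul (p := 1 + 2 * c) (by positivity), ENNReal.ofReal_ofNat]

theorem tsum_arcLength_complementaryArcs_le {E : Set Circle} (hE : IsClosed E) :
    ∑' J : complementaryArcs E, arcLength J.1 ≤ 1 := by
  have := (countable_complementaryArcs hE).to_subtype
  simp only [arcLength_eq]
  rw [← measure_iUnion (fun J K hJK => ?_) fun J =>
    measurableSet_Ico.inter (isOpen_lift_of_mem_complementaryArcs hE J.2).measurableSet]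
  · refine (measure_mono (iUnion_subset fun J => inter_subset_left)).trans ?_
    simp
  · have h1 := pairwiseDisjoint_complementaryArcs E J.2 K.2 fun h => hJK (Subtype.ext h)
    exact (h1.preimage turn).mono inter_subset_right inter_subset_right

/-- The neighbourhoods of a Beurling–Carleson set of geometrically decreasing size have summable
lengths. -/
theorem tsum_volume_layer_lt_top {E : Set Circle} (hE : IsClosed E) (hne : E.Nonempty)
    (h0 : arcLength E = 0) (hent : entropy E < ⊤) {c : ℝ} (hc : 0 ≤ c) :
    ∑' n : ℕ, volume (Ico 0 1 ∩ {t | circDist E (turn t) ≤ c * (1 / 2) ^ n}) < ⊤ := by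
  have := (countable_complementaryArcs hE).to_subtype
  have hle : ∀ n : ℕ, volume (Ico 0 1 ∩ {t | circDist E (turn t) ≤ c * (1 / 2) ^ n}) ≤
      ∑' J : complementaryArcs E,
        min (arcLength J.1) (ENNReal.ofReal (c * (1 / 2) ^ n)) := fun n => by
    set r := c * (1 / 2 : ℝ) ^ n
    have hsub : Ico 0 1 ∩ {t | circDist E (turn t) ≤ r} ⊆ (Ico 0 1 ∩ lift E) ∪
        ⋃ J : complementaryArcs E, Ico 0 1 ∩ lift (J.1 ∩ {ζ | circDist E ζ ≤ r}) := by
      rintro t ⟨ht, htr⟩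
      by_cases htE : turn t ∈ E
      · exact Or.inl ⟨ht, htE⟩
      · have h1 : turn t ∈ ⋃ J : complementaryArcs E, J.1 := by
          rw [iUnion_complementaryArcs]; exact htE
        obtain ⟨J, hJ⟩ := mem_iUnion.1 h1
        exact Or.inr (mem_iUnion.2 ⟨J, ht, hJ, htr⟩)
    refine (measure_mono hsub).trans ((measure_union_le _ _).trans ?_)
    rw [← arcLength_eq, h0, zero_add]
    refine (measure_iUnion_le _).trans (ENNReal.tsum_le_tsum fun J => le_min ?_ ?_)
    · rw [arcLength_eq]
      exact measure_mono (inter_subset_inter_right _ fun t ht => ht.1)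
    · exact volume_layer_le hE hne J.2 (by positivity)
  refine (ENNReal.tsum_le_tsum hle).trans_lt ?_
  rw [ENNReal.tsum_comm]
  have hJ : ∀ J : complementaryArcs E,
      ∑' n : ℕ, min (arcLength J.1) (ENNReal.ofReal (c * (1 / 2) ^ n)) ≤
        2 * ENNReal.ofReal ((arcLength J.1).toReal * Real.log ((arcLength J.1).toReal)⁻¹) +
          ENNReal.ofReal (1 + 2 * c) * arcLength J.1 := fun J => by
    have h1 := tsum_min_geometric_le (ℓ := (arcLength J.1).toReal) ENNReal.toReal_nonneg
      (ENNReal.toReal_le_of_le_ofReal zero_le_one (by simpa using arcLength_le_one J.1)) hc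
    rwa [ENNReal.ofReal_toReal (arcLength_ne_top _)] at h1
  refine (ENNReal.tsum_le_tsum hJ).trans_lt ?_
  rw [ENNReal.tsum_add, ENNReal.tsum_mul_left, ENNReal.tsum_mul_left]
  refine ENNReal.add_lt_top.2 ⟨ENNReal.mul_lt_top ENNReal.ofNat_lt_top hent,
    ENNReal.mul_lt_top ENNReal.ofReal_lt_top
      ((tsum_arcLength_complementaryArcs_le hE).trans_lt ENNReal.one_lt_top)⟩

/-! ### Boundary decay of singular inner functions -/

/-- An inner function has boundary values of modulus one off its singular set. -/
theorem IsInner.tendsto_norm {I : ℂ → ℂ} (hI : IsInner I) {ζ : Circle} (hζ : ζ ∉ singularSet I) :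
    Tendsto (fun z => ‖I z‖) (𝓝[disc] (ζ : ℂ)) (𝓝 1) := by
  rw [singularSet, mem_ofPred_eq, not_not] at hζ
  obtain ⟨g, hg, hIg⟩ := hζ
  suffices h : ‖g ζ‖ = 1 by
    have h1 : Tendsto (fun z => ‖g z‖) (𝓝[disc] (ζ : ℂ)) (𝓝 ‖g ζ‖) :=
      hg.continuousAt.norm.tendsto.mono_left nhdsWithin_le_nhds
    rw [h] at h1
    refine h1.congr' ?_
    filter_upwards [hIg] with z hz
    rw [hz]
  by_contra hne
  have hev : ∀ᶠ y in 𝓝 (ζ : ℂ), AnalyticAt ℂ g y ∧ ‖g y‖ ≠ 1 ∧ (y ∈ disc → I y = g y) :=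
    hg.eventually_analyticAt.and ((hg.continuousAt.norm.eventually_ne hne).and
      (eventually_nhdsWithin_iff.1 hIg))
  obtain ⟨U, hU, hUo, hζU⟩ := eventually_nhds_iff.1 hev
  obtain ⟨θ₀, rfl⟩ := Circle.exp_surjective ζ
  have hc : Continuous fun θ => (Circle.exp θ : ℂ) :=
    continuous_subtype_val.comp (Circle.exp.continuous)
  -- Radial limits of modulus one exist almost everywhere, hence densely, so one occurs in the
  -- neighbourhood where `‖g‖ ≠ 1`.
  obtain ⟨θ, hθU, w, hw, hlim⟩ := (Measure.dense_of_ae hI.radial_limit).inter_open_nonempty _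
    (hUo.preimage hc) ⟨θ₀, hζU⟩
  obtain ⟨hga, hg1, -⟩ := hU _ hθU
  have h1 := tendsto_radial (Circle.exp θ : ℂ)
  have h2 : Tendsto (fun r : ℝ => g (r * (Circle.exp θ : ℂ))) (𝓝[<] 1) (𝓝 (g (Circle.exp θ))) :=
    hga.continuousAt.tendsto.comp h1
  have h3 : w = g (Circle.exp θ) := by
    refine tendsto_nhds_unique hlim (h2.congr' ?_)
    filter_upwards [h1 (hUo.mem_nhds hθU), Ioo_mem_nhdsLT (one_pos : (0 : ℝ) < 1)] with r hrU hr
    refine ((hU _ hrU).2.2 ?_).symm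
    rw [mem_disc, norm_mul, Complex.norm_real, Real.norm_of_nonneg hr.1.le, Circle.norm_coe,
      mul_one]
    exact hr.2
  exact hg1 (h3 ▸ hw)

theorem IsSingularInner.neg_log_norm_nonneg {S : ℂ → ℂ} (hS : IsSingularInner S) {z : ℂ}
    (hz : z ∈ disc) : 0 ≤ -Real.log ‖S z‖ := by
  have := Real.log_nonpos (norm_nonneg _) (hS.toIsInner.norm_le_one hz)
  linarith

/-- On compact sets off the singular set the convergence of the modulus to `1` is uniform in the
boundary point. -/
theorem IsSingularInner.eventually_neg_log_norm_le {S : ℂ → ℂ} (hS : IsSingularInner S)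
    {E : Set Circle} (hSE : singularSet S ⊆ E) {K : Set Circle} (hK : IsCompact K)
    (hKE : Disjoint K E) {ε : ℝ} (hε : 0 < ε) :
    ∀ᶠ r : ℝ in 𝓝[<] 1, ∀ ζ ∈ K, -Real.log ‖S (r * (ζ : ℂ))‖ ≤ ε := by
  have h1 : ∀ᶠ r : ℝ in 𝓝 1, ∀ ζ ∈ K, r ∈ Ioo (0 : ℝ) 1 → -Real.log ‖S (r * (ζ : ℂ))‖ ≤ ε := by
    refine hK.eventually_forall_of_forall_eventually
      (P := fun (r : ℝ) (ζ : Circle) => r ∈ Ioo (0 : ℝ) 1 → -Real.log ‖S (r * (ζ : ℂ))‖ ≤ ε)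
      fun ζ hζ => ?_
    have h2 := hS.toIsInner.tendsto_norm fun h => hKE.le_bot ⟨hζ, hSE h⟩
    have h3 := eventually_nhdsWithin_iff.1
      (h2.eventually_const_le (show Real.exp (-ε) < 1 by simpa using hε))
    have h4 : ContinuousAt (fun p : ℝ × Circle => (p.1 : ℂ) * (p.2 : ℂ)) (1, ζ) := by fun_prop
    have h5 := h4.tendsto.eventually (by simpa using h3)
    filter_upwards [h5] with p hp hr
    have hd : (p.1 : ℂ) * (p.2 : ℂ) ∈ disc := by
      rw [mem_disc, norm_mul, Complex.norm_real, Real.norm_of_nonneg hr.1.le, Circle.norm_coe,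
        mul_one]
      exact hr.2
    have h6 := Real.log_le_log (Real.exp_pos _) (hp hd)
    rw [Real.log_exp] at h6
    linarith
  filter_upwards [mem_nhdsWithin_of_mem_nhds h1, Ioo_mem_nhdsLT (one_pos : (0 : ℝ) < 1)]
    with r hr hr' ζ hζ using hr ζ hζ hr'

/-- A singular inner function decays towards the circle at most quadratically in the distance to its
singular set. -/
theorem IsSingularInner.neg_log_norm_le {S : ℂ → ℂ} (hS : IsSingularInner S) {E : Set Circle}
    (hSE : singularSet S ⊆ E) {z : ℂ} (hz : z ∈ disc) {d : ℝ} (hd : 0 < d)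
    (hdE : ∀ ζ ∈ E, d ≤ ‖z - ζ‖) :
    -Real.log ‖S z‖ ≤ 18 * (1 - ‖z‖) / d ^ 2 * -Real.log ‖S 0‖ := by
  have hz' := mem_disc.1 hz
  refine le_of_forall_pos_le_add fun ε hε => ?_
  set u : ℂ → ℝ := fun ζ => -Real.log ‖S ζ‖ with hu
  set M := 18 * (1 - ‖z‖) / d ^ 2 with hM
  have hM0 : 0 ≤ M := div_nonneg (by nlinarith) (sq_nonneg _)
  set K : Set Circle := {ζ | ‖(ζ : ℂ) - z‖ ≤ d / 2} with hK
  have hKc : IsCompact K := (isClosed_le (by fun_prop) continuous_const).isCompact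
  have hKE : Disjoint K E := Set.disjoint_left.2 fun ζ hζ hζE => by
    have h1 := hdE ζ hζE
    rw [norm_sub_rev] at h1
    have h2 : ‖(ζ : ℂ) - z‖ ≤ d / 2 := hζ
    linarith
  -- With `1 - r < d / 6`, directions outside `K` give `‖ζ - z‖ ≥ d / 3`. There the kernel is at
  -- most `2 * (1 - ‖z‖) / (d / 3) ^ 2`, whence the `18`.
  obtain ⟨r, hrK, hr⟩ := ((hS.eventually_neg_log_norm_le hSE hKc hKE hε).and
    (Ioo_mem_nhdsLT (show max ‖z‖ (1 - d / 6) < 1 from max_lt hz' (by linarith)))).exists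
  have hr1 := (le_max_left _ _).trans_lt hr.1
  have hr2 := (le_max_right _ _).trans_lt hr.1
  have hr0 : 0 < r := (norm_nonneg z).trans_lt hr1
  have hsub : Metric.closedBall (0 : ℂ) r ⊆ disc := Metric.closedBall_subset_ball hr.2
  have hharm : InnerProductSpace.HarmonicOnNhd u (Metric.closedBall 0 r) := fun ζ hζ => by
    have h1 : AnalyticAt ℂ S ζ := hS.analytic.analyticAt (isOpen_disc.mem_nhds (hsub hζ))
    exact (h1.harmonicAt_log_norm (hS.ne_zero ζ (hsub hζ))).neg
  have hucont : ContinuousOn u (Metric.sphere 0 r) := by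
    refine ContinuousOn.neg (ContinuousOn.log ?_ fun ζ hζ => ?_)
    · exact (hS.analytic.continuousOn.mono
        (Metric.sphere_subset_closedBall.trans hsub)).norm
    · exact norm_ne_zero_iff.2 (hS.ne_zero ζ (hsub (Metric.sphere_subset_closedBall hζ)))
  have hPcont := continuousOn_poissonKernel (w := z) hr1
  have hpt : ∀ ζ ∈ Metric.sphere (0 : ℂ) |r|,
      (poissonKernel 0 z • u) ζ ≤ (M • u + ε • poissonKernel 0 z) ζ := by
    intro ζ hζ
    rw [abs_of_pos hr0] at hζ
    have hζr : ‖ζ‖ = r := by simpa using hζ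
    have hu0 : 0 ≤ u ζ := hS.neg_log_norm_nonneg (hsub (Metric.sphere_subset_closedBall hζ))
    have hP0 : 0 ≤ poissonKernel 0 z ζ := poissonKernel_nonneg hr1.le hζr
    simp only [Pi.smul_apply', Pi.add_apply, Pi.smul_apply, smul_eq_mul]
    obtain ⟨ξ, hξζ⟩ : ∃ ξ : Circle, ζ = r * (ξ : ℂ) :=
      ⟨Circle.exp ζ.arg, by rw [Circle.coe_exp, ← hζr, Complex.norm_mul_exp_arg_mul_I]⟩
    by_cases hξK : ξ ∈ K
    · have h1 : u ζ ≤ ε := by rw [hξζ]; exact hrK ξ hξK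
      nlinarith [mul_nonneg hM0 hu0, mul_le_mul_of_nonneg_left h1 hP0]
    · have h1 : d / 2 < ‖(ξ : ℂ) - z‖ := not_le.1 hξK
      have h2 : ‖(ξ : ℂ) - z‖ ≤ (1 - r) + ‖ζ - z‖ := by
        have h3 : (ξ : ℂ) - z = ((1 - r : ℝ) : ℂ) * ξ + (ζ - z) := by
          rw [hξζ]; push_cast; ring
        rw [h3]
        refine (norm_add_le _ _).trans_eq ?_
        rw [norm_mul, Circle.norm_coe, mul_one, Complex.norm_real, Real.norm_of_nonneg]
        linarith [hr.2]
      have h4 : d / 3 ≤ ‖ζ - z‖ := by linarith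
      have hpos : 0 < ‖ζ - z‖ := by linarith
      have h5 : poissonKernel 0 z ζ ≤ M := by
        rw [poissonKernel_def, sub_zero, sub_zero, hζr, hM, div_le_div_iff₀ (by positivity)
          (by positivity)]
        have h6 : (d / 3) ^ 2 ≤ ‖ζ - z‖ ^ 2 := by gcongr
        have h7 : r ^ 2 - ‖z‖ ^ 2 ≤ 2 * (1 - ‖z‖) := by
          nlinarith [norm_nonneg z, hr.2]
        have h8 : (r ^ 2 - ‖z‖ ^ 2) * d ^ 2 ≤ 2 * (1 - ‖z‖) * d ^ 2 := by gcongr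
        nlinarith
      nlinarith [mul_nonneg hε.le hP0, mul_le_mul_of_nonneg_right h5 hu0]
  have hint1 : CircleIntegrable (M • u) 0 r := (hucont.const_smul M).circleIntegrable hr0.le
  have hint2 : CircleIntegrable (ε • poissonKernel 0 z) 0 r :=
    (hPcont.const_smul ε).circleIntegrable hr0.le
  have hint3 : CircleIntegrable (poissonKernel 0 z • u) 0 r :=
    (hPcont.smul hucont).circleIntegrable hr0.le
  -- Averaging `P * u ≤ M * u + ε * P` over the circle of radius `r` gives `u z ≤ M * u 0 + ε`.
  have key := Real.circleAverage_mono hint3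
    (((hucont.const_smul M).add (hPcont.const_smul ε)).circleIntegrable hr0.le) hpt
  rw [Real.circleAverage_add hint1 hint2, Real.circleAverage_smul, Real.circleAverage_smul,
    circleAverage_poissonKernel hr1,
    InnerProductSpace.HarmonicOnNhd.circleAverage_poissonKernel_smul hharm (by simpa using hr1),
    InnerProductSpace.HarmonicOnNhd.circleAverage_eq (by rwa [abs_of_pos hr0])] at key
  simp only [smul_eq_mul, mul_one] at key
  exact key

/-! ### Blaschke products -/

/-- The normalised Blaschke factor of `w ≠ 0`, minus `1`. -/
def blaschkeTerm (w z : ℂ) : ℂ := (‖w‖ : ℂ) / w * ((w - z) / (1 - conj w * z)) - 1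

/-- The Blaschke product with zeros `a i`. -/
def blaschke {ι : Type*} (a : ι → ℂ) (z : ℂ) : ℂ := ∏' i, (1 + blaschkeTerm (a i) z)

theorem norm_blaschkeTerm_le {w z : ℂ} (hw : w ≠ 0) (hw1 : ‖w‖ ≤ 1) (h : 1 - conj w * z ≠ 0) :
    ‖blaschkeTerm w z‖ ≤ (1 - ‖w‖) * (1 + ‖z‖) / ‖1 - conj w * z‖ := by
  have h1 : (‖w‖ : ℂ) * ‖w‖ = w * conj w := by
    rw [Complex.mul_conj, Complex.normSq_eq_norm_sq]; push_cast; ring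
  have h2 : blaschkeTerm w z =
      -(((1 - ‖w‖ : ℝ) : ℂ) * (1 + ‖w‖ / w * z) / (1 - conj w * z)) := by
    rw [blaschkeTerm, eq_neg_iff_add_eq_zero, mul_div_assoc', sub_add_eq_add_sub, ← add_div,
      sub_eq_zero, div_eq_one_iff_eq h]
    push_cast
    field_simp
    linear_combination -z * h1
  have h3 : ‖1 + (‖w‖ : ℂ) / w * z‖ ≤ 1 + ‖z‖ := by
    refine (norm_add_le _ _).trans_eq ?_
    rw [norm_one, norm_mul, norm_div, Complex.norm_real, norm_norm,
      div_self (norm_ne_zero_iff.2 hw), one_mul]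
  rw [h2, norm_neg, norm_div, norm_mul, Complex.norm_real, Real.norm_of_nonneg (by linarith)]
  gcongr

theorem norm_one_add_blaschkeTerm {w : ℂ} (hw : w ≠ 0) (z : ℂ) :
    ‖1 + blaschkeTerm w z‖ = pseudoDist z w := by
  rw [blaschkeTerm, add_sub_cancel, norm_mul, norm_div, Complex.norm_real, norm_norm,
    div_self (norm_ne_zero_iff.2 hw), one_mul, pseudoDist, norm_div, norm_div, norm_sub_rev]

theorem one_add_blaschkeTerm_self (w : ℂ) : 1 + blaschkeTerm w w = 0 := by
  simp [blaschkeTerm]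

theorem norm_blaschkeTerm_le_of_le {w z : ℂ} (hw : w ≠ 0) (hw1 : ‖w‖ ≤ 1) (hz : ‖z‖ ≤ 1) {c : ℝ}
    (hc : 0 < c) (h : c ≤ ‖1 - conj w * z‖) :
    ‖blaschkeTerm w z‖ ≤ 2 / c * (1 - ‖w‖) := by
  refine (norm_blaschkeTerm_le hw hw1 (norm_pos_iff.1 (hc.trans_le h))).trans ?_
  rw [div_mul_eq_mul_div, mul_comm 2]
  have : 0 ≤ 1 - ‖w‖ := by linarith
  gcongr
  linarith

section

variable {ι : Type*} {a : ι → ℂ}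

theorem summable_norm_blaschkeTerm (ha0 : ∀ i, a i ≠ 0) (ha1 : ∀ i, ‖a i‖ < 1)
    (hsum : Summable fun i => 1 - ‖a i‖) {z : ℂ} (hz : ‖z‖ ≤ 1) {c : ℝ} (hc : 0 < c)
    (h : ∀ i, c ≤ ‖1 - conj (a i) * z‖) : Summable fun i => ‖blaschkeTerm (a i) z‖ :=
  (hsum.mul_left (2 / c)).of_nonneg_of_le (fun _ => norm_nonneg _)
    fun i => norm_blaschkeTerm_le_of_le (ha0 i) (ha1 i).le hz hc (h i)

theorem hasProd_blaschke (ha0 : ∀ i, a i ≠ 0) (ha1 : ∀ i, ‖a i‖ < 1)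
    (hsum : Summable fun i => 1 - ‖a i‖) {z : ℂ} (hz : ‖z‖ ≤ 1) {c : ℝ} (hc : 0 < c)
    (h : ∀ i, c ≤ ‖1 - conj (a i) * z‖) :
    HasProd (fun i => 1 + blaschkeTerm (a i) z) (blaschke a z) :=
  (multipliable_one_add_of_summable (summable_norm_blaschkeTerm ha0 ha1 hsum hz hc h)).hasProd

theorem tendsto_norm_blaschke (ha0 : ∀ i, a i ≠ 0) (ha1 : ∀ i, ‖a i‖ < 1)
    (hsum : Summable fun i => 1 - ‖a i‖) {z : ℂ} (hz : ‖z‖ ≤ 1) {c : ℝ} (hc : 0 < c)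
    (h : ∀ i, c ≤ ‖1 - conj (a i) * z‖) :
    Tendsto (fun s : Finset ι => ∏ i ∈ s, pseudoDist z (a i)) atTop (𝓝 ‖blaschke a z‖) := by
  have h1 : Tendsto (fun s : Finset ι => ∏ i ∈ s, (1 + blaschkeTerm (a i) z)) atTop
      (𝓝 (blaschke a z)) := hasProd_blaschke ha0 ha1 hsum hz hc h
  refine h1.norm.congr fun s => ?_
  rw [norm_prod]
  exact Finset.prod_congr rfl fun i _ => norm_one_add_blaschkeTerm (ha0 i) z

theorem tendsto_norm_blaschke_of_mem_disc (ha0 : ∀ i, a i ≠ 0) (ha1 : ∀ i, ‖a i‖ < 1)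
    (hsum : Summable fun i => 1 - ‖a i‖) {z : ℂ} (hz : z ∈ disc) :
    Tendsto (fun s : Finset ι => ∏ i ∈ s, pseudoDist z (a i)) atTop (𝓝 ‖blaschke a z‖) :=
  tendsto_norm_blaschke ha0 ha1 hsum (mem_disc.1 hz).le (sub_pos.2 (mem_disc.1 hz))
    fun i => one_sub_norm_le_norm_one_sub_conj_mul (ha1 i).le

theorem norm_blaschke_le_one (ha0 : ∀ i, a i ≠ 0) (ha1 : ∀ i, ‖a i‖ < 1)
    (hsum : Summable fun i => 1 - ‖a i‖) {z : ℂ} (hz : z ∈ disc) : ‖blaschke a z‖ ≤ 1 :=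
  le_of_tendsto' (tendsto_norm_blaschke_of_mem_disc ha0 ha1 hsum hz) fun _ =>
    Finset.prod_le_one (fun _ _ => pseudoDist_nonneg _ _)
      fun i _ => pseudoDist_le_one (mem_disc.1 hz).le (ha1 i).le

theorem blaschke_eq_zero (a : ι → ℂ) (i : ι) : blaschke a (a i) = 0 :=
  tprod_of_exists_eq_zero ⟨i, one_add_blaschkeTerm_self _⟩

theorem differentiableOn_blaschkeTerm {w : ℂ} (hw : ‖w‖ < 1) : DifferentiableOn ℂ (blaschkeTerm w) disc := by
  unfold blaschkeTerm
  refine (DifferentiableOn.const_mul (DifferentiableOn.div (by fun_prop) (by fun_prop)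
    fun z hz => one_sub_conj_mul_ne_zero (mem_disc.1 hz) hw.le) _).sub_const _

theorem differentiableOn_blaschke (ha0 : ∀ i, a i ≠ 0) (ha1 : ∀ i, ‖a i‖ < 1)
    (hsum : Summable fun i => 1 - ‖a i‖) : DifferentiableOn ℂ (blaschke a) disc := by
  have h1 : HasProdLocallyUniformlyOn (fun i z => 1 + blaschkeTerm (a i) z) (blaschke a) disc := by
    refine hasProdLocallyUniformlyOn_of_forall_compact isOpen_disc fun K hK hKc => ?_
    rcases K.eq_empty_or_nonempty with rfl | hne
    · rw [hasProdUniformlyOn_iff_tendstoUniformlyOn]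
      exact tendstoUniformlyOn_empty
    obtain ⟨z₀, hz₀, hmax⟩ := hKc.exists_isMaxOn hne continuous_norm.continuousOn
    have hlt : 0 < 1 - ‖z₀‖ := sub_pos.2 (mem_disc.1 (hK hz₀))
    refine Summable.hasProdUniformlyOn_one_add hKc (hsum.mul_left (2 / (1 - ‖z₀‖)))
      (Eventually.of_forall fun i z hz => ?_) fun i => ?_
    · refine norm_blaschkeTerm_le_of_le (ha0 i) (ha1 i).le (mem_disc.1 (hK hz)).le hlt ?_
      have h2 : ‖z‖ ≤ ‖z₀‖ := hmax hz
      linarith [one_sub_norm_le_norm_one_sub_conj_mul (z := z) (ha1 i).le]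
    · exact (differentiableOn_blaschkeTerm (ha1 i)).continuousOn.mono hK
  rw [hasProdLocallyUniformlyOn_iff_tendstoLocallyUniformlyOn] at h1
  refine h1.differentiableOn (Eventually.of_forall fun s => ?_) isOpen_disc
  exact DifferentiableOn.fun_finsetProd fun i _ => (differentiableOn_blaschkeTerm (ha1 i)).const_add 1

/-- At a boundary point away from its zeros, a Blaschke product has a radial limit of modulus
one. -/
theorem exists_radial_limit_blaschke (ha0 : ∀ i, a i ≠ 0) (ha1 : ∀ i, ‖a i‖ < 1)
    (hsum : Summable fun i => 1 - ‖a i‖) {ζ : ℂ} (hζ : ‖ζ‖ = 1) {c : ℝ} (hc : 0 < c)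
    (h : ∀ i, c ≤ ‖ζ - a i‖) :
    ∃ w : ℂ, ‖w‖ = 1 ∧ Tendsto (fun r : ℝ => blaschke a (r * ζ)) (𝓝[<] 1) (𝓝 w) := by
  -- On the circle `‖1 - conj (a i) * ζ‖ = ‖ζ - a i‖`, and moving to `z` costs at most `c / 2`. This
  -- bound, uniform in `i`, drives the dominated convergence of the product.
  have hkey : ∀ i, ∀ z : ℂ, ‖z - ζ‖ ≤ c / 2 → c / 2 ≤ ‖1 - conj (a i) * z‖ := fun i z hz => by
    have h1 : 1 - conj (a i) * z = conj (ζ - a i) * ζ - conj (a i) * (z - ζ) := by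
      have h2 : conj ζ * ζ = 1 := by
        rw [mul_comm, Complex.mul_conj, Complex.normSq_eq_norm_sq, hζ]; simp
      rw [map_sub]
      linear_combination -h2
    have h3 := norm_sub_norm_le (conj (ζ - a i) * ζ) (conj (a i) * (z - ζ))
    rw [← h1, norm_mul, norm_mul, RCLike.norm_conj, RCLike.norm_conj, hζ, mul_one] at h3
    have h4 : ‖a i‖ * ‖z - ζ‖ ≤ 1 * (c / 2) := by
      gcongr
      exact (ha1 i).le
    linarith [h i]
  have hζc : ∀ i, c / 2 ≤ ‖1 - conj (a i) * ζ‖ := fun i => hkey i ζ (by simp; positivity)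
  refine ⟨blaschke a ζ, ?_, ?_⟩
  · refine tendsto_nhds_unique
      (tendsto_norm_blaschke ha0 ha1 hsum hζ.le (half_pos hc) hζc) ?_
    refine tendsto_const_nhds.congr fun s => (Finset.prod_eq_one fun i _ => ?_).symm
    have h1 := norm_one_sub_conj_mul_sq_sub ζ (a i)
    rw [hζ] at h1
    have h2 : ‖1 - conj (a i) * ζ‖ = ‖ζ - a i‖ :=
      (pow_left_inj₀ (norm_nonneg _) (norm_nonneg _) two_ne_zero).1 (by linarith)
    rw [pseudoDist, norm_div, h2, div_self]
    exact (hc.trans_le (h i)).ne'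
  · refine tendsto_tprod_one_add_of_dominated_convergence
      (bound := fun i => 2 / (c / 2) * (1 - ‖a i‖)) (hsum.mul_left _) (fun i => ?_) ?_
    · have h1 : ContinuousAt (blaschkeTerm (a i)) ζ := by
        unfold blaschkeTerm
        have h2 : 1 - conj (a i) * ζ ≠ 0 := norm_pos_iff.1 ((half_pos hc).trans_le (hζc i))
        fun_prop (disch := assumption)
      exact h1.tendsto.comp (tendsto_radial ζ)
    · have h1 := (tendsto_radial ζ).eventually (Metric.closedBall_mem_nhds ζ (half_pos hc))
      filter_upwards [h1, Ioo_mem_nhdsLT (one_pos : (0 : ℝ) < 1)] with r hr hr' i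
      refine norm_blaschkeTerm_le_of_le (ha0 i) (ha1 i).le ?_ (half_pos hc) (hkey i _ ?_)
      · rw [norm_mul, hζ, mul_one, Complex.norm_real, Real.norm_of_nonneg hr'.1.le]
        exact hr'.2.le
      · simpa [dist_eq_norm] using hr

/-- A Blaschke product is bounded below away from its zeros, in terms of
`∑ (1 - ρ(z, a i) ^ 2)`. -/
theorem exp_le_norm_blaschke (ha0 : ∀ i, a i ≠ 0) (ha1 : ∀ i, ‖a i‖ < 1)
    (hsum : Summable fun i => 1 - ‖a i‖) {z : ℂ} (hz : z ∈ disc) {ε : ℝ} (hε : 0 < ε)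
    (h : ∀ i, ε ≤ pseudoDist z (a i)) {A : ℝ}
    (hA : ∀ s : Finset ι, ∑ i ∈ s, (1 - pseudoDist z (a i) ^ 2) ≤ A) :
    Real.exp (-(A / ε ^ 2)) ≤ ‖blaschke a z‖ := by
  refine ge_of_tendsto' (tendsto_norm_blaschke_of_mem_disc ha0 ha1 hsum hz) fun s => ?_
  have h1 : ∀ i, Real.exp (-((1 - pseudoDist z (a i) ^ 2) / ε ^ 2)) ≤ pseudoDist z (a i) := fun i => by
    set x := pseudoDist z (a i) with hx
    have hx0 : 0 < x := hε.trans_le (h i)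
    have hx1 : x ≤ 1 := pseudoDist_le_one (mem_disc.1 hz).le (ha1 i).le
    rw [← Real.le_log_iff_exp_le hx0]
    -- The bound `log x ≥ 1 - 1 / x ≥ -(1 - x ^ 2) / x ^ 2` is used with `x ≥ ε` in the denominator.
    have h2 := Real.one_sub_inv_le_log_of_pos hx0
    have h3 : (1 - x ^ 2) / x ^ 2 ≤ (1 - x ^ 2) / ε ^ 2 := by
      have : 0 ≤ 1 - x ^ 2 := by nlinarith
      have := h i
      gcongr
    have h4 : -((1 - x ^ 2) / x ^ 2) ≤ 1 - x⁻¹ := by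
      rw [← sub_nonneg]
      have h5 : 1 - x⁻¹ - -((1 - x ^ 2) / x ^ 2) = (1 - x) / x ^ 2 := by field_simp; ring
      rw [h5]
      exact div_nonneg (by linarith) (sq_nonneg _)
    linarith
  calc Real.exp (-(A / ε ^ 2))
      ≤ Real.exp (∑ i ∈ s, -((1 - pseudoDist z (a i) ^ 2) / ε ^ 2)) := by
        rw [Finset.sum_neg_distrib, ← Finset.sum_div]
        have := hA s
        gcongr
    _ = ∏ i ∈ s, Real.exp (-((1 - pseudoDist z (a i) ^ 2) / ε ^ 2)) := Real.exp_sum _ _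
    _ ≤ _ := Finset.prod_le_prod (fun _ _ => (Real.exp_pos _).le) fun i _ => h1 i

end

/-! ### Sums over equally spaced points on a circle -/

theorem turn_div_natCast (M j : ℕ) :
    (turn ((j : ℝ) / M) : ℂ) = Complex.exp (2 * Real.pi * Complex.I / M) ^ j := by
  rw [turn, Circle.coe_exp, ← Complex.exp_nat_mul]
  congr 1
  push_cast
  ring

/-- Partial fractions of `M / (1 - x ^ M)`. -/
theorem sum_inv_one_sub_turn_mul {M : ℕ} (hM : 0 < M) {x : ℂ} (hx : x ^ M ≠ 1) :
    ∑ j ∈ Finset.range M, (1 - (turn ((j : ℝ) / M) : ℂ) * x)⁻¹ = M / (1 - x ^ M) := by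
  set ω := Complex.exp (2 * Real.pi * Complex.I / M) with hω
  have hprim : IsPrimitiveRoot ω M := Complex.isPrimitiveRoot_exp M hM.ne'
  have hx' : 1 - x ^ M ≠ 0 := sub_ne_zero.2 (Ne.symm hx)
  rw [eq_div_iff hx', Finset.sum_mul]
  have h1 : ∀ j ∈ Finset.range M, (1 - (turn ((j : ℝ) / M) : ℂ) * x)⁻¹ * (1 - x ^ M) =
      ∑ k ∈ Finset.range M, (ω ^ k) ^ j * x ^ k := fun j _ => by
    have hpow : (ω ^ j * x) ^ M = x ^ M := by
      rw [mul_pow, ← pow_mul, mul_comm j, pow_mul, hprim.pow_eq_one, one_pow, one_mul]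
    have hne : 1 - ω ^ j * x ≠ 0 := fun h => by
      have h2 : ω ^ j * x = 1 := (sub_eq_zero.1 h).symm
      rw [h2, one_pow] at hpow
      exact hx hpow.symm
    rw [turn_div_natCast, ← hω, inv_mul_eq_iff_eq_mul₀ hne, ← hpow, ← mul_neg_geom_sum]
    congr 1
    refine Finset.sum_congr rfl fun k _ => ?_
    rw [mul_pow, ← pow_mul, ← pow_mul, mul_comm j]
  rw [Finset.sum_congr rfl h1, Finset.sum_comm]
  simp_rw [← Finset.sum_mul]
  rw [Finset.sum_eq_single 0]
  · simp
  · intro k hk hk0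
    have hne : ω ^ k ≠ 1 := fun h => by
      have := Nat.le_of_dvd (Nat.pos_of_ne_zero hk0) ((hprim.pow_eq_one_iff_dvd k).1 h)
      exact absurd (Finset.mem_range.1 hk) (by omega)
    have h2 := mul_neg_geom_sum (ω ^ k) M
    rw [← pow_mul, mul_comm k, pow_mul, hprim.pow_eq_one, one_pow, sub_self] at h2
    rw [(mul_eq_zero.1 h2).resolve_left (sub_ne_zero.2 hne.symm), zero_mul]
  · intro h
    exact absurd (Finset.mem_range.2 hM) h

/-- The Poisson term is `Re (2 / (1 - y)) - 1`, and the sum of `1 / (1 - y)` over the rotations is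
known in closed form. -/
theorem sum_poisson_turn_le {M : ℕ} (hM : 0 < M) {x : ℂ} (hx : ‖x‖ < 1) :
    ∑ j ∈ Finset.range M, (1 - ‖x‖ ^ 2) / ‖1 - (turn ((j : ℝ) / M) : ℂ) * x‖ ^ 2 ≤
      2 * M / (1 - ‖x‖ ^ M) := by
  have hpow : ‖x‖ ^ M < 1 := pow_lt_one₀ (norm_nonneg _) hx hM.ne'
  have hne : x ^ M ≠ 1 := fun h => by
    have := congrArg norm h
    rw [norm_pow, norm_one] at this
    linarith
  have h1 : ∀ j ∈ Finset.range M, (1 - ‖x‖ ^ 2) / ‖1 - (turn ((j : ℝ) / M) : ℂ) * x‖ ^ 2 ≤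
      (2 * (1 - (turn ((j : ℝ) / M) : ℂ) * x)⁻¹).re := fun j _ => by
    set y := (turn ((j : ℝ) / M) : ℂ) * x with hy
    have hyx : ‖y‖ = ‖x‖ := by rw [hy, norm_mul, norm_turn, one_mul]
    have hy1 : 1 - y ≠ 0 := fun h => by
      have := congrArg norm (sub_eq_zero.1 h)
      rw [norm_one] at this
      linarith
    have h2 := re_add_div_sub 1 y
    rw [norm_one, one_pow, hyx] at h2
    have h3 : (1 + y) / (1 - y) = 2 * (1 - y)⁻¹ - 1 := by field_simp; ring
    rw [← h2, h3, Complex.sub_re, Complex.one_re]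
    linarith
  refine (Finset.sum_le_sum h1).trans ?_
  rw [← Complex.re_sum, ← Finset.mul_sum, sum_inv_one_sub_turn_mul hM hne]
  refine (Complex.re_le_norm _).trans ?_
  rw [norm_mul, norm_div, Complex.norm_ofNat, Complex.norm_natCast, mul_div_assoc]
  have h4 : 1 - ‖x‖ ^ M ≤ ‖1 - x ^ M‖ := by
    have := norm_sub_norm_le (1 : ℂ) (x ^ M)
    rwa [norm_one, norm_pow] at this
  gcongr

/-- Replacing `z` by its radial projection `ξ` at most doubles the denominators and leaves a Poisson
sum over the ring. Since `M * h ≥ 1`, `(1 - h) ^ M ≤ 1 / 2`, so that sum is at most `4 * M`. -/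
theorem sum_one_sub_pseudoDist_sq_ring_le {M : ℕ} {h : ℝ} (hh0 : 0 < h) (hh1 : h < 1)
    (hMh : 1 ≤ M * h) {z : ℂ} (hz : ‖z‖ < 1) :
    ∑ j ∈ Finset.range M, (1 - pseudoDist z (((1 - h : ℝ) : ℂ) * turn ((j : ℝ) / M)) ^ 2) ≤
      32 * (1 - ‖z‖) * M := by
  have hM : 0 < M := by
    rcases Nat.eq_zero_or_pos M with h0 | h0
    · rw [h0] at hMh; norm_num at hMh
    · exact h0
  set a := 1 - h with ha
  have ha0 : 0 < a := by linarith
  obtain ⟨ξ, hξ⟩ : ∃ ξ : Circle, z = ‖z‖ * (ξ : ℂ) :=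
    ⟨Circle.exp z.arg, by rw [Circle.coe_exp, Complex.norm_mul_exp_arg_mul_I]⟩
  set x : ℂ := a * conj (ξ : ℂ) with hx
  have hxa : ‖x‖ = a := by
    rw [hx, norm_mul, RCLike.norm_conj, Circle.norm_coe, mul_one, Complex.norm_real,
      Real.norm_of_nonneg ha0.le]
  have hpow : a ^ M ≤ 1 / 2 := by
    have h1 : a ≤ Real.exp (-h) := by
      have := Real.add_one_le_exp (-h)
      linarith
    calc a ^ M ≤ Real.exp (-h) ^ M := by gcongr
      _ = Real.exp (M * -h) := (Real.exp_nat_mul _ _).symm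
      _ ≤ Real.exp (-1) := by gcongr; linarith
      _ ≤ 1 / 2 := by
        rw [Real.exp_neg, one_div]
        gcongr
        linarith [Real.add_one_le_exp (1 : ℝ)]
  have hterm : ∀ j ∈ Finset.range M,
      1 - pseudoDist z ((a : ℂ) * turn ((j : ℝ) / M)) ^ 2 ≤
        8 * (1 - ‖z‖) * ((1 - ‖x‖ ^ 2) / ‖1 - (turn ((j : ℝ) / M) : ℂ) * x‖ ^ 2) := fun j _ => by
    set w := (a : ℂ) * (turn ((j : ℝ) / M) : ℂ) with hw
    have hwa : ‖w‖ = a := by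
      rw [hw, norm_mul, norm_turn, mul_one, Complex.norm_real, Real.norm_of_nonneg ha0.le]
    have hw1 : ‖w‖ < 1 := by rw [hwa]; linarith
    have hd0 := norm_pos_iff.2 (one_sub_conj_mul_ne_zero hz hw1.le)
    have hd1 := one_sub_norm_le_norm_one_sub_conj_mul (z := z) hw1.le
    have hξw : ‖1 - conj w * ξ‖ = ‖1 - (turn ((j : ℝ) / M) : ℂ) * x‖ := by
      rw [← RCLike.norm_conj, hw, hx]
      congr 1
      simp only [map_sub, map_one, map_mul, Complex.conj_conj, Complex.conj_ofReal]
      ring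
    have hcmp : ‖1 - conj w * ξ‖ ≤ 2 * ‖1 - conj w * z‖ := by
      have h1 : 1 - conj w * ξ = (1 - conj w * z) - conj w * (((1 - ‖z‖ : ℝ) : ℂ) * ξ) := by
        conv_rhs => rw [hξ]
        push_cast
        simp only [norm_mul, Complex.norm_real, norm_norm, Circle.norm_coe, mul_one]
        ring
      rw [h1]
      refine (norm_sub_le _ _).trans ?_
      rw [norm_mul, norm_mul, RCLike.norm_conj, Circle.norm_coe, mul_one, Complex.norm_real,
        Real.norm_of_nonneg (by linarith)]
      nlinarith
    have hξ0 : 0 < ‖1 - conj w * ξ‖ := by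
      have h1 := norm_sub_norm_le (1 : ℂ) (conj w * ξ)
      rw [norm_one, norm_mul, RCLike.norm_conj, Circle.norm_coe, mul_one] at h1
      linarith
    rw [one_sub_pseudoDist_sq hz hw1, hwa, hxa, ← hξw, mul_div_assoc', div_le_div_iff₀
      (by positivity) (by positivity)]
    have h2 : ‖1 - conj w * ξ‖ ^ 2 ≤ 4 * ‖1 - conj w * z‖ ^ 2 := by nlinarith
    have h3 : 1 - ‖z‖ ^ 2 ≤ 2 * (1 - ‖z‖) := by nlinarith [norm_nonneg z]
    have h4 : 0 ≤ 1 - a ^ 2 := by nlinarith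
    have h5 : 0 ≤ 1 - ‖z‖ ^ 2 := by nlinarith [norm_nonneg z]
    calc (1 - ‖z‖ ^ 2) * (1 - a ^ 2) * ‖1 - conj w * ξ‖ ^ 2
        ≤ (2 * (1 - ‖z‖)) * (1 - a ^ 2) * (4 * ‖1 - conj w * z‖ ^ 2) := by
          have h6 : 0 ≤ 2 * (1 - ‖z‖) := by linarith
          gcongr
      _ = _ := by ring
  refine (Finset.sum_le_sum hterm).trans ?_
  rw [← Finset.mul_sum]
  have h1 := sum_poisson_turn_le hM (x := x) (by rw [hxa]; linarith)
  have h2 : 2 * (M : ℝ) / (1 - ‖x‖ ^ M) ≤ 4 * M := by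
    rw [hxa, div_le_iff₀ (by linarith)]
    have : (0 : ℝ) ≤ M := Nat.cast_nonneg M
    nlinarith
  have h3 : 0 ≤ 8 * (1 - ‖z‖) := by linarith
  calc _ ≤ 8 * (1 - ‖z‖) * (4 * M) := mul_le_mul_of_nonneg_left (h1.trans h2) h3
    _ = _ := by ring

theorem tsum_four_pow_le {Y : ℝ} (hY : 0 ≤ Y) :
    ∑' n : ℕ, (if (4 : ℝ) ^ n ≤ Y then ENNReal.ofReal (4 ^ n) else 0) ≤ ENNReal.ofReal (2 * Y) := by
  refine ENNReal.tsum_le_of_sum_range_le fun N => ?_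
  -- The first bound is the full geometric sum; it keeps the induction going until the terms exceed
  -- `Y`, after which nothing is added.
  suffices h : ∑ n ∈ Finset.range N, (if (4 : ℝ) ^ n ≤ Y then ENNReal.ofReal (4 ^ n) else 0) ≤
      ENNReal.ofReal (min (4 ^ N / 3) (2 * Y)) from
    h.trans (ENNReal.ofReal_le_ofReal (min_le_right _ _))
  induction N with
  | zero => simp
  | succ N ih =>
    rw [Finset.sum_range_succ]
    split_ifs with h
    · refine (add_le_add_left ih _).trans ?_
      rw [← ENNReal.ofReal_add (by positivity) (by positivity)]
      refine ENNReal.ofReal_le_ofReal (le_min ?_ ?_)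
      · have := min_le_left ((4 : ℝ) ^ N / 3) (2 * Y)
        rw [pow_succ]
        linarith
      · have := min_le_left ((4 : ℝ) ^ N / 3) (2 * Y)
        linarith
    · rw [add_zero]
      refine ih.trans (ENNReal.ofReal_le_ofReal (min_le_min_right _ ?_))
      rw [pow_succ]
      have : (0 : ℝ) < 4 ^ N := by positivity
      linarith

/-! ### The grid of zeros and its total mass -/

/-- Indices of the points of a family of grids in the disc: the grid `q` consists of `q` circles of
radii in `(1 - 4 ^ (1 - n), 1 - 4 ^ (-n)]` for each `n`, with `q * 4 ^ n` points on each of them. -/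
abbrev GridIndex := Σ q : ℕ, Σ n : ℕ, Fin q × Fin (q * 4 ^ n)

/-- The distance to the circle of a grid point. -/
def gridHeight (x : GridIndex) : ℝ := (1 / 4 : ℝ) ^ x.2.1 * (1 + 3 * (x.2.2.1 : ℕ) / x.1)

/-- The grid point of a given index. -/
def gridPoint (x : GridIndex) : ℂ :=
  ((1 - gridHeight x : ℝ) : ℂ) * turn (((x.2.2.2 : ℕ) : ℝ) / (x.1 * 4 ^ x.2.1 : ℕ))

/-- The aperture of the region in which the grid `q` is used. -/
def gridAperture (q : ℕ) : ℝ := q ^ 2 * 2 ^ q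

/-- The grid points lying in the parabolic regions
`gridAperture q * circDist E w ^ 2 ≤ 1 - ‖w‖` and below a level depending on `q`. -/
def GridSel (E : Set Circle) (N : ℕ → ℕ) (x : GridIndex) : Prop :=
  N x.1 ≤ x.2.1 ∧ gridAperture x.1 * circDist E (gridPoint x) ^ 2 ≤ gridHeight x

theorem grid_fst_pos (x : GridIndex) : 0 < x.1 := (Nat.zero_le _).trans_lt x.2.2.1.2

theorem one_le_gridAperture {q : ℕ} (hq : 0 < q) : 1 ≤ gridAperture q := by
  have h1 : (1 : ℝ) ≤ q := by exact_mod_cast hq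
  have h2 : (1 : ℝ) ≤ 2 ^ q := one_le_pow₀ one_le_two
  rw [gridAperture]
  nlinarith [one_le_pow₀ h1 (n := 2)]

theorem le_gridHeight (x : GridIndex) : (1 / 4 : ℝ) ^ x.2.1 ≤ gridHeight x := by
  rw [gridHeight]
  refine le_mul_of_one_le_right (by positivity) ?_
  have : 0 ≤ 3 * ((x.2.2.1 : ℕ) : ℝ) / x.1 := by positivity
  linarith

theorem gridHeight_pos (x : GridIndex) : 0 < gridHeight x :=
  (by positivity : (0 : ℝ) < (1 / 4 : ℝ) ^ x.2.1).trans_le (le_gridHeight x)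

theorem gridHeight_lt (x : GridIndex) : gridHeight x < 4 * (1 / 4 : ℝ) ^ x.2.1 := by
  rw [gridHeight, mul_comm]
  refine mul_lt_mul_of_pos_right ?_ (by positivity)
  have hq : (0 : ℝ) < x.1 := by exact_mod_cast grid_fst_pos x
  have h1 : ((x.2.2.1 : ℕ) : ℝ) < x.1 := by exact_mod_cast x.2.2.1.2
  have h2 : 3 * ((x.2.2.1 : ℕ) : ℝ) / x.1 < 3 := by
    rw [div_lt_iff₀ hq]
    linarith
  linarith

theorem gridHeight_lt_of_two_le {x : GridIndex} (hx : 2 ≤ x.2.1) : gridHeight x < 1 / 4 := by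
  have h1 := gridHeight_lt x
  have h2 : (1 / 4 : ℝ) ^ x.2.1 ≤ (1 / 4) ^ 2 := pow_le_pow_of_le_one (by norm_num) (by norm_num) hx
  norm_num at h2
  linarith

theorem norm_gridPoint {x : GridIndex} (hx : 2 ≤ x.2.1) : ‖gridPoint x‖ = 1 - gridHeight x := by
  rw [gridPoint, norm_mul, norm_turn, mul_one, Complex.norm_real, Real.norm_of_nonneg]
  linarith [gridHeight_lt_of_two_le hx]

theorem norm_gridPoint_sub_turn {x : GridIndex} :
    ‖gridPoint x - turn (((x.2.2.2 : ℕ) : ℝ) / (x.1 * 4 ^ x.2.1 : ℕ))‖ = gridHeight x := by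
  have h : gridPoint x - turn (((x.2.2.2 : ℕ) : ℝ) / (x.1 * 4 ^ x.2.1 : ℕ)) =
      -((gridHeight x : ℂ) * turn (((x.2.2.2 : ℕ) : ℝ) / (x.1 * 4 ^ x.2.1 : ℕ))) := by
    rw [gridPoint, Complex.ofReal_sub, Complex.ofReal_one]
    ring
  rw [h, norm_neg, norm_mul, norm_turn, mul_one, Complex.norm_real,
    Real.norm_of_nonneg (gridHeight_pos x).le]

open Classical in
theorem tsum_gridSel (E : Set Circle) (N : ℕ → ℕ) (f : GridIndex → ℝ≥0∞) :
    ∑' x : {x // GridSel E N x}, f x = ∑' q, ∑' n, ∑ i : Fin q, ∑ j : Fin (q * 4 ^ n),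
      if GridSel E N ⟨q, n, i, j⟩ then f ⟨q, n, i, j⟩ else 0 := by
  have h1 : ∑' x : {x // GridSel E N x}, f x = ∑' x : GridIndex, {x | GridSel E N x}.indicator f x :=
    tsum_subtype {x | GridSel E N x} f
  rw [h1, ENNReal.tsum_sigma']
  refine tsum_congr fun q => ?_
  rw [ENNReal.tsum_sigma']
  refine tsum_congr fun n => ?_
  rw [tsum_fintype, Fintype.sum_prod_type]
  rfl

/-- The part of the circle close to `E`, at the scale of the grid points of generation `n`. -/
def gridLayer (E : Set Circle) (n : ℕ) : Set ℝ :=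
  Ico 0 1 ∩ {t | circDist E (turn t) ≤ 13 * (1 / 2) ^ n}

theorem sum_volume_le_of_subset {M : ℕ} (hM : 0 < M) (L : Set ℝ) (P : Fin M → Prop)
    [DecidablePred P]
    (hP : ∀ j, P j → Ico (((j : ℕ) : ℝ) / M) (((j : ℕ) + 1 : ℝ) / M) ⊆ L) :
    ∑ j : Fin M, (if P j then ENNReal.ofReal (1 / M) else 0) ≤ volume L := by
  have hM' : (0 : ℝ) < M := by exact_mod_cast hM
  have hvol : ∀ j : Fin M, volume (Ico (((j : ℕ) : ℝ) / M) (((j : ℕ) + 1 : ℝ) / M)) =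
      ENNReal.ofReal (1 / M) := fun j => by
    rw [Real.volume_Ico, ← sub_div, add_sub_cancel_left]
  rw [← Finset.sum_filter, ← Finset.sum_congr rfl fun j _ => hvol j,
    ← measure_biUnion_finset ?_ fun _ _ => measurableSet_Ico]
  · refine measure_mono (iUnion₂_subset fun j hj => hP j ?_)
    exact (Finset.mem_filter.1 hj).2
  · intro i _ j _ hij
    rw [Function.onFun, Set.disjoint_left]
    intro t hi hj
    rw [mem_Ico, div_le_iff₀ hM', lt_div_iff₀ hM'] at hi hj
    have h1 : ((i : ℕ) : ℝ) < (j : ℕ) + 1 := hi.1.trans_lt hj.2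
    have h2 : ((j : ℕ) : ℝ) < (i : ℕ) + 1 := hj.1.trans_lt hi.2
    norm_cast at h1 h2
    exact hij (Fin.ext (by omega))

/-- A selected point has height below `4 * 4 ^ (-n)`, hence is within `2 * 2 ^ (-n)` of `E`. Points
of its angular interval are within `11 * 4 ^ (-n)` of it, and `2 + 11 = 13`. -/
theorem gridLayer_of_sel {E : Set Circle} {N : ℕ → ℕ} {x : GridIndex} (hx : GridSel E N x) :
    Ico (((x.2.2.2 : ℕ) : ℝ) / (x.1 * 4 ^ x.2.1 : ℕ))
      (((x.2.2.2 : ℕ) + 1 : ℝ) / (x.1 * 4 ^ x.2.1 : ℕ)) ⊆ gridLayer E x.2.1 := by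
  intro t ht
  have hq := grid_fst_pos x
  set n := x.2.1 with hn
  set M : ℕ := x.1 * 4 ^ n with hM
  have hM0 : 0 < M := by positivity
  have hM' : (0 : ℝ) < M := by exact_mod_cast hM0
  have hjM : (((x.2.2.2 : ℕ) + 1 : ℝ)) ≤ M := by exact_mod_cast x.2.2.2.2
  have hinv : 1 / (M : ℝ) ≤ (1 / 4) ^ n := by
    rw [one_div_pow, hM]
    push_cast
    have h1 : (1 : ℝ) ≤ x.1 := by exact_mod_cast hq
    have h2 : (0 : ℝ) < 4 ^ n := by positivity
    apply one_div_le_one_div_of_le h2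
    nlinarith
  have hpow2 : (1 / 4 : ℝ) ^ n ≤ (1 / 2) ^ n := by gcongr; norm_num
  have hsq : ((1 / 2 : ℝ) ^ n) ^ 2 = (1 / 4) ^ n := by
    rw [← pow_mul, mul_comm, pow_mul]; norm_num
  refine ⟨⟨le_trans (by positivity) ht.1, ht.2.trans_le ((div_le_one hM').2 hjM)⟩, ?_⟩
  have h1 : circDist E (gridPoint x) ≤ 2 * (1 / 2) ^ n := by
    have h2 := hx.2
    have h3 := one_le_gridAperture hq
    have h4 : circDist E (gridPoint x) ^ 2 ≤ gridAperture x.1 * circDist E (gridPoint x) ^ 2 :=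
      le_mul_of_one_le_left (sq_nonneg _) h3
    refine (pow_le_pow_iff_left₀ (circDist_nonneg _ _) (by positivity) two_ne_zero).1 ?_
    rw [mul_pow, hsq]
    linarith [(gridHeight_lt x).le]
  have h5 := circDist_le_add E (turn t) (gridPoint x)
  have h6 : ‖(turn t : ℂ) - gridPoint x‖ ≤ 11 * (1 / 4) ^ n := by
    have h7 : (turn t : ℂ) - gridPoint x = ((turn t : ℂ) - turn (((x.2.2.2 : ℕ) : ℝ) / M)) -
        (gridPoint x - turn (((x.2.2.2 : ℕ) : ℝ) / M)) := by ring
    rw [h7]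
    refine (norm_sub_le _ _).trans ?_
    have h8 := dist_turn_le t (((x.2.2.2 : ℕ) : ℝ) / M)
    have h9 : |t - ((x.2.2.2 : ℕ) : ℝ) / M| ≤ (1 / 4) ^ n := by
      have h10 := ht.1
      have h11 := ht.2
      rw [add_div] at h11
      rw [abs_of_nonneg (by linarith)]
      linarith
    have h12 := norm_gridPoint_sub_turn (x := x)
    have h13 := (gridHeight_lt x).le
    have h14 : 2 * Real.pi * |t - ((x.2.2.2 : ℕ) : ℝ) / M| ≤ 7 * (1 / 4) ^ n := by
      have : 2 * Real.pi ≤ 7 := by linarith [Real.pi_lt_d2]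
      gcongr
    linarith
  show circDist E (turn t) ≤ 13 * (1 / 2) ^ n
  linarith

open Classical in
-- On one circle the selected points own disjoint intervals of length `1 / (q * 4 ^ n)` inside the
-- layer, and heights are at most `4 * q` times that length; there are `q` circles.
theorem sum_gridHeight_le (E : Set Circle) (N : ℕ → ℕ) (q n : ℕ) :
    ∑ i : Fin q, ∑ j : Fin (q * 4 ^ n),
      (if GridSel E N ⟨q, n, i, j⟩ then ENNReal.ofReal (gridHeight ⟨q, n, i, j⟩) else 0) ≤
      if N q ≤ n then ENNReal.ofReal (4 * q ^ 2) * volume (gridLayer E n) else 0 := by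
  split_ifs with hN
  swap
  · refine le_of_eq (Finset.sum_eq_zero fun i _ => Finset.sum_eq_zero fun j _ => if_neg ?_)
    exact fun h => hN h.1
  have hring : ∀ i : Fin q, ∑ j : Fin (q * 4 ^ n),
      (if GridSel E N ⟨q, n, i, j⟩ then ENNReal.ofReal (gridHeight ⟨q, n, i, j⟩) else 0) ≤
      ENNReal.ofReal (4 * q) * volume (gridLayer E n) := fun i => by
    have hq : 0 < q := (Nat.zero_le _).trans_lt i.2
    have hq' : (0 : ℝ) < q := by exact_mod_cast hq
    have hterm : ∀ j : Fin (q * 4 ^ n),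
        (if GridSel E N ⟨q, n, i, j⟩ then ENNReal.ofReal (gridHeight ⟨q, n, i, j⟩) else 0) ≤
        ENNReal.ofReal (4 * q) * (if GridSel E N ⟨q, n, i, j⟩ then
          ENNReal.ofReal (1 / (q * 4 ^ n : ℕ)) else 0) := fun j => by
      split_ifs
      · rw [← ENNReal.ofReal_mul (by positivity)]
        refine ENNReal.ofReal_le_ofReal ((gridHeight_lt _).le.trans_eq ?_)
        simp only
        push_cast
        rw [one_div_pow]
        field_simp
      · simp
    refine (Finset.sum_le_sum fun j _ => hterm j).trans ?_
    rw [← Finset.mul_sum]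
    gcongr
    exact sum_volume_le_of_subset (by positivity) _ (fun j => GridSel E N ⟨q, n, i, j⟩)
      fun j hj => gridLayer_of_sel hj
  refine (Finset.sum_le_sum fun i _ => hring i).trans ?_
  rw [Finset.sum_const, Finset.card_univ, Fintype.card_fin, nsmul_eq_mul, ← mul_assoc]
  gcongr
  rw [← ENNReal.ofReal_natCast, ← ENNReal.ofReal_mul (Nat.cast_nonneg _)]
  exact ENNReal.ofReal_le_ofReal (le_of_eq (by ring))

/-- Cutting the convergent series at a late level makes the mass of grid `q` at most `2 ^ (-q)`; `2
≤ N` keeps the zeros away from the origin. -/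
theorem exists_level {E : Set Circle} (h : ∑' n, volume (gridLayer E n) < ⊤) (q : ℕ) :
    ∃ N : ℕ, 2 ≤ N ∧
      ∑' n, (if N ≤ n then ENNReal.ofReal (4 * q ^ 2) * volume (gridLayer E n) else 0) ≤
        ENNReal.ofReal ((1 / 2) ^ q) := by
  have h1 : ∑' n, ENNReal.ofReal (4 * q ^ 2) * volume (gridLayer E n) ≠ ⊤ := by
    rw [ENNReal.tsum_mul_left]
    exact ENNReal.mul_ne_top ENNReal.ofReal_ne_top h.ne
  have h2 := (ENNReal.tendsto_sum_nat_add _ h1).eventually_le_const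
    (show (0 : ℝ≥0∞) < ENNReal.ofReal ((1 / 2) ^ q) from ENNReal.ofReal_pos.2 (by positivity))
  obtain ⟨N, hN, hN2⟩ := (h2.and (eventually_ge_atTop 2)).exists
  refine ⟨N, hN2, le_trans (le_of_eq ?_) hN⟩
  rw [← ENNReal.summable.sum_add_tsum_nat_add' (k := N), Finset.sum_eq_zero, zero_add]
  · exact tsum_congr fun k => if_pos (by omega)
  · intro k hk
    exact if_neg (not_le.2 (Finset.mem_range.1 hk))

theorem tsum_ofReal_half_pow : ∑' q : ℕ, ENNReal.ofReal ((1 / 2) ^ q) = ENNReal.ofReal 2 := by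
  rw [← ENNReal.ofReal_tsum_of_nonneg (fun n => by positivity)
    (summable_geometric_of_lt_one (by norm_num) (by norm_num)), tsum_geometric_two]

theorem tsum_gridHeight_le {E : Set Circle} {N : ℕ → ℕ}
    (hN : ∀ q, ∑' n, (if N q ≤ n then
      ENNReal.ofReal (4 * (q : ℝ) ^ 2) * volume (gridLayer E n) else 0) ≤
        ENNReal.ofReal ((1 / 2) ^ q)) :
    ∑' x : {x // GridSel E N x}, ENNReal.ofReal (gridHeight x) ≤ ENNReal.ofReal 2 := by
  rw [tsum_gridSel E N fun x => ENNReal.ofReal (gridHeight x), ← tsum_ofReal_half_pow]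
  refine ENNReal.tsum_le_tsum fun q => le_trans (ENNReal.tsum_le_tsum fun n => ?_) (hN q)
  exact sum_gridHeight_le E N q n

/-! ### Bounds for the sum of `1 - ρ ^ 2` over the zeros -/

theorem one_sub_pseudoDist_gridPoint_sq_le {x : GridIndex} (hx : 2 ≤ x.2.1) {z : ℂ}
    (hz : ‖z‖ < 1) {c : ℝ} (hc : 0 < c) (h : c ≤ ‖1 - conj (gridPoint x) * z‖) :
    1 - pseudoDist z (gridPoint x) ^ 2 ≤ 4 * (1 - ‖z‖) / c ^ 2 * gridHeight x := by
  have hw := norm_gridPoint hx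
  have hpos := gridHeight_pos x
  have hlt := gridHeight_lt_of_two_le hx
  rw [one_sub_pseudoDist_sq hz (by linarith), hw, div_mul_eq_mul_div]
  have h1 : 1 - ‖z‖ ^ 2 ≤ 2 * (1 - ‖z‖) := by nlinarith [norm_nonneg z]
  have h2 : 1 - (1 - gridHeight x) ^ 2 ≤ 2 * gridHeight x := by nlinarith
  have h3 : 0 ≤ 1 - (1 - gridHeight x) ^ 2 := by nlinarith
  have h4 : 0 ≤ 2 * (1 - ‖z‖) := by linarith
  calc _ ≤ (2 * (1 - ‖z‖)) * (2 * gridHeight x) / c ^ 2 := by gcongr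
    _ = _ := by ring

theorem sum_gridRing_le {q n : ℕ} (hn : 2 ≤ n) {z : ℂ} (hz : ‖z‖ < 1) :
    ∑ i : Fin q, ∑ j : Fin (q * 4 ^ n),
      ENNReal.ofReal (1 - pseudoDist z (gridPoint ⟨q, n, i, j⟩) ^ 2) ≤
      ENNReal.ofReal (32 * q ^ 2 * (1 - ‖z‖)) * ENNReal.ofReal (4 ^ n) := by
  have hring : ∀ i : Fin q, ∑ j : Fin (q * 4 ^ n),
      ENNReal.ofReal (1 - pseudoDist z (gridPoint ⟨q, n, i, j⟩) ^ 2) ≤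
      ENNReal.ofReal (32 * (1 - ‖z‖) * (q * 4 ^ n : ℕ)) := fun i => by
    have hq : 0 < q := (Nat.zero_le _).trans_lt i.2
    have hM : 0 < q * 4 ^ n := by positivity
    set x₀ : GridIndex := ⟨q, n, i, ⟨0, hM⟩⟩ with hx₀
    have hlt : gridHeight x₀ < 1 / 4 := gridHeight_lt_of_two_le hn
    have h1 := sum_one_sub_pseudoDist_sq_ring_le (M := q * 4 ^ n) (gridHeight_pos x₀)
      (by linarith) (by
        have h2 := le_gridHeight x₀
        have h3 : (1 : ℝ) ≤ q := by exact_mod_cast hq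
        push_cast
        calc (1 : ℝ) = 1 * 4 ^ n * (1 / 4) ^ n := by
              rw [one_mul, ← mul_pow]; norm_num
          _ ≤ q * 4 ^ n * gridHeight x₀ := by gcongr) hz
    rw [← ENNReal.ofReal_sum_of_nonneg]
    · refine ENNReal.ofReal_le_ofReal (le_trans (le_of_eq ?_) h1)
      rw [← Fin.sum_univ_eq_sum_range (fun j => 1 - pseudoDist z
        (((1 - gridHeight x₀ : ℝ) : ℂ) * turn ((j : ℝ) / (q * 4 ^ n : ℕ))) ^ 2)]
      rfl
    · intro j _
      have hw : ‖gridPoint ⟨q, n, i, j⟩‖ ≤ 1 := by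
        rw [norm_gridPoint (x := ⟨q, n, i, j⟩) hn]
        linarith [gridHeight_pos ⟨q, n, i, j⟩]
      have h4 := pseudoDist_le_one hz.le hw
      have h5 := pseudoDist_nonneg z (gridPoint ⟨q, n, i, j⟩)
      nlinarith
  refine (Finset.sum_le_sum fun i _ => hring i).trans ?_
  rw [Finset.sum_const, Finset.card_univ, Fintype.card_fin, nsmul_eq_mul,
    ← ENNReal.ofReal_natCast, ← ENNReal.ofReal_mul (Nat.cast_nonneg _),
    ← ENNReal.ofReal_mul (by have : 0 ≤ 1 - ‖z‖ := by linarith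
                             positivity)]
  refine ENNReal.ofReal_le_ofReal (le_of_eq ?_)
  push_cast
  ring

theorem circDist_gridPoint_near {E : Set Circle} {x : GridIndex} {z : ℂ}
    (h : ‖z - gridPoint x‖ < circDist E z / 2) (hsel : gridAperture x.1 *
      circDist E (gridPoint x) ^ 2 ≤ gridHeight x) :
    gridAperture x.1 * circDist E z ^ 2 ≤ 4 * gridHeight x := by
  have h1 := circDist_le_add E z (gridPoint x)
  have h2 : circDist E z ≤ 2 * circDist E (gridPoint x) := by linarith
  have h3 := one_le_gridAperture (grid_fst_pos x)
  have h4 := circDist_nonneg E z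
  calc gridAperture x.1 * circDist E z ^ 2
      ≤ gridAperture x.1 * (2 * circDist E (gridPoint x)) ^ 2 := by gcongr
    _ = 4 * (gridAperture x.1 * circDist E (gridPoint x) ^ 2) := by ring
    _ ≤ _ := by linarith

/-- Zeros at distance at least `D / 2` from `z` are controlled by the total mass `2` and contribute
`32 * K`. Nearer zeros are selected only at heights at least `gridAperture q * D ^ 2 / 4`, so few
generations occur, and whole rings can be summed; they contribute `2048 * K`. -/
theorem tsum_one_sub_pseudoDist_sq_le {E : Set Circle} {N : ℕ → ℕ} (hN2 : ∀ q, 2 ≤ N q)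
    (hmass : ∑' x : {x // GridSel E N x}, ENNReal.ofReal (gridHeight x) ≤ ENNReal.ofReal 2)
    {z : ℂ} (hz : ‖z‖ < 1) {K : ℝ} (hzK : 1 - ‖z‖ ≤ K * circDist E z ^ 2) :
    ∑' x : {x // GridSel E N x}, ENNReal.ofReal (1 - pseudoDist z (gridPoint x) ^ 2) ≤
      ENNReal.ofReal (2080 * K) := by
  classical
  set D := circDist E z with hD
  have hD0 : 0 ≤ D := circDist_nonneg E z
  have hK2 : 0 < K * D ^ 2 := by linarith
  have hDsq : 0 < D ^ 2 := by
    rcases (sq_nonneg D).eq_or_lt with h | h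
    · rw [← h, mul_zero] at hK2; exact absurd hK2 (lt_irrefl _)
    · exact h
  have hDpos : 0 < D := by
    rcases hD0.eq_or_lt with h | h
    · rw [← h] at hDsq; norm_num at hDsq
    · exact h
  have hK : 0 < K := pos_of_mul_pos_left hK2 hDsq.le
  -- The selection condition is weakened to one on the generation alone: a factor `4` from
  -- `circDist_gridPoint_near` and a factor `4` from the height make `16`.
  set near : GridIndex → ℝ≥0∞ := fun x =>
    if gridAperture x.1 * D ^ 2 ≤ 16 * (1 / 4) ^ x.2.1 then
      ENNReal.ofReal (1 - pseudoDist z (gridPoint x) ^ 2) else 0 with hnear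
  have hpt : ∀ x : {x // GridSel E N x},
      ENNReal.ofReal (1 - pseudoDist z (gridPoint x) ^ 2) ≤
        ENNReal.ofReal (16 * K) * ENNReal.ofReal (gridHeight x) + near x := by
    rintro ⟨x, hx⟩
    simp only
    have hx2 : 2 ≤ x.2.1 := (hN2 _).trans hx.1
    have hw1 : ‖gridPoint x‖ ≤ 1 := by
      rw [norm_gridPoint hx2]; linarith [gridHeight_pos x]
    rcases lt_or_ge ‖z - gridPoint x‖ (D / 2) with hlt | hge
    · have h1 := circDist_gridPoint_near hlt hx.2
      have h2 := gridHeight_lt x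
      have h3 : near x = ENNReal.ofReal (1 - pseudoDist z (gridPoint x) ^ 2) :=
        if_pos (by linarith)
      rw [h3]
      exact le_add_self
    · refine le_add_right ?_
      rw [← ENNReal.ofReal_mul (by positivity)]
      refine ENNReal.ofReal_le_ofReal ?_
      refine (one_sub_pseudoDist_gridPoint_sq_le hx2 hz (half_pos hDpos)
        (hge.trans (norm_sub_le_norm_one_sub_conj_mul hz.le hw1))).trans ?_
      refine mul_le_mul_of_nonneg_right ?_ (gridHeight_pos x).le
      rw [div_pow, div_div_eq_mul_div, div_le_iff₀ hDsq]
      linarith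
  refine (ENNReal.tsum_le_tsum hpt).trans ?_
  rw [ENNReal.tsum_add, ENNReal.tsum_mul_left]
  have hnearsum : ∑' x : {x // GridSel E N x}, near x ≤ ENNReal.ofReal (2048 * K) := by
    rw [tsum_gridSel E N near]
    have hq : ∀ q : ℕ, ∑' n, ∑ i : Fin q, ∑ j : Fin (q * 4 ^ n),
        (if GridSel E N ⟨q, n, i, j⟩ then near ⟨q, n, i, j⟩ else 0) ≤
        ENNReal.ofReal (1024 * K) * ENNReal.ofReal ((1 / 2) ^ q) := by
      intro q
      rcases Nat.eq_zero_or_pos q with rfl | hq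
      · simp
      have hA : 0 < gridAperture q := one_pos.trans_le (one_le_gridAperture hq)
      set Y := 16 / (gridAperture q * D ^ 2) with hY
      have hn : ∀ n : ℕ, ∑ i : Fin q, ∑ j : Fin (q * 4 ^ n),
          (if GridSel E N ⟨q, n, i, j⟩ then near ⟨q, n, i, j⟩ else 0) ≤
          ENNReal.ofReal (32 * q ^ 2 * (1 - ‖z‖)) *
            (if (4 : ℝ) ^ n ≤ Y then ENNReal.ofReal (4 ^ n) else 0) := fun n => by
        by_cases hNn : N q ≤ n
        · by_cases hYn : (4 : ℝ) ^ n ≤ Y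
          · rw [if_pos hYn]
            refine le_trans (Finset.sum_le_sum fun i _ => Finset.sum_le_sum fun j _ => ?_)
              (sum_gridRing_le ((hN2 q).trans hNn) hz)
            simp only [hnear]
            split_ifs <;> simp
          · refine le_trans (le_of_eq ?_) zero_le
            refine Finset.sum_eq_zero fun i _ => Finset.sum_eq_zero fun j _ => ?_
            have h1 : near ⟨q, n, i, j⟩ = 0 := by
              refine if_neg fun h => hYn ?_
              simp only at h
              rw [hY, le_div_iff₀ (by positivity)]
              calc (4 : ℝ) ^ n * (gridAperture q * D ^ 2) ≤ 4 ^ n * (16 * (1 / 4) ^ n) := by gcongr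
                _ = 16 := by rw [mul_left_comm, ← mul_pow]; norm_num
            rw [h1, ite_self]
        · refine le_trans (le_of_eq ?_) zero_le
          exact Finset.sum_eq_zero fun i _ => Finset.sum_eq_zero fun j _ => if_neg fun h => hNn h.1
      refine (ENNReal.tsum_le_tsum hn).trans ?_
      rw [ENNReal.tsum_mul_left]
      have hq' : (0 : ℝ) < q := by exact_mod_cast hq
      have h1z : 0 ≤ 1 - ‖z‖ := by linarith
      calc _ ≤ ENNReal.ofReal (32 * q ^ 2 * (1 - ‖z‖)) * ENNReal.ofReal (2 * Y) := by
            gcongr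
            exact tsum_four_pow_le (by positivity)
        _ = ENNReal.ofReal (32 * q ^ 2 * (1 - ‖z‖) * (2 * Y)) :=
            (ENNReal.ofReal_mul (by positivity)).symm
        _ ≤ ENNReal.ofReal (1024 * K * (1 / 2) ^ q) := by
            refine ENNReal.ofReal_le_ofReal ?_
            -- Here `gridAperture q = q ^ 2 * 2 ^ q` cancels the density `q ^ 2` and leaves the
            -- summable factor `2 ^ (-q)`.
            have h2 : 32 * (q : ℝ) ^ 2 * (1 - ‖z‖) * (2 * Y) =
                1024 * ((1 - ‖z‖) / D ^ 2) * (1 / 2) ^ q := by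
              rw [hY, gridAperture, one_div_pow]
              field_simp
              ring
            rw [h2]
            gcongr
            rw [div_le_iff₀ hDsq]
            exact hzK
        _ = _ := ENNReal.ofReal_mul (by positivity)
    refine (ENNReal.tsum_le_tsum hq).trans_eq ?_
    rw [ENNReal.tsum_mul_left, tsum_ofReal_half_pow, ← ENNReal.ofReal_mul (by positivity)]
    congr 1
    ring
  calc _ ≤ ENNReal.ofReal (16 * K) * ENNReal.ofReal 2 + ENNReal.ofReal (2048 * K) := by gcongr
    _ = ENNReal.ofReal (2080 * K) := by
      rw [← ENNReal.ofReal_mul (by positivity), ← ENNReal.ofReal_add (by positivity) (by positivity)]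
      congr 1
      ring

theorem tsum_one_sub_pseudoDist_sq_le_div {E : Set Circle} {N : ℕ → ℕ} (hN2 : ∀ q, 2 ≤ N q)
    (hmass : ∑' x : {x // GridSel E N x}, ENNReal.ofReal (gridHeight x) ≤ ENNReal.ofReal 2)
    {z : ℂ} (hz : ‖z‖ < 1) :
    ∑' x : {x // GridSel E N x}, ENNReal.ofReal (1 - pseudoDist z (gridPoint x) ^ 2) ≤
      ENNReal.ofReal (8 / (1 - ‖z‖)) := by
  have h0 : 0 < 1 - ‖z‖ := by linarith
  have hpt : ∀ x : {x // GridSel E N x},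
      ENNReal.ofReal (1 - pseudoDist z (gridPoint x) ^ 2) ≤
        ENNReal.ofReal (4 / (1 - ‖z‖)) * ENNReal.ofReal (gridHeight x) := by
    rintro ⟨x, hx⟩
    have hx2 : 2 ≤ x.2.1 := (hN2 _).trans hx.1
    have hw1 : ‖gridPoint x‖ ≤ 1 := by
      rw [norm_gridPoint hx2]; linarith [gridHeight_pos x]
    rw [← ENNReal.ofReal_mul (by positivity)]
    refine ENNReal.ofReal_le_ofReal ((one_sub_pseudoDist_gridPoint_sq_le hx2 hz h0
      (one_sub_norm_le_norm_one_sub_conj_mul hw1)).trans_eq ?_)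
    field_simp
  refine (ENNReal.tsum_le_tsum hpt).trans ?_
  rw [ENNReal.tsum_mul_left]
  calc _ ≤ ENNReal.ofReal (4 / (1 - ‖z‖)) * ENNReal.ofReal 2 := by gcongr
    _ = _ := by
      rw [← ENNReal.ofReal_mul (by positivity)]
      congr 1
      ring

/-! ### The grids as nets in the parabolic regions -/

theorem exists_norm_smul_turn (z : ℂ) : ∃ t ∈ Ico (0 : ℝ) 1, z = (‖z‖ : ℂ) * turn t := by
  obtain ⟨t, ht, h⟩ := exists_turn_eq_Ico 0 (Circle.exp (Complex.arg z))
  refine ⟨t, by simpa using ht, ?_⟩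
  rw [h, Circle.coe_exp, Complex.norm_mul_exp_arg_mul_I]

theorem norm_ofReal_mul_turn_sub_le (r s a b : ℝ) (hr : |r| ≤ 1) :
    ‖(r : ℂ) * turn a - (s : ℂ) * turn b‖ ≤ |r - s| + 2 * Real.pi * |a - b| := by
  have h : (r : ℂ) * turn a - (s : ℂ) * turn b =
      (r : ℂ) * ((turn a : ℂ) - turn b) + ((r - s : ℝ) : ℂ) * turn b := by
    push_cast; ring
  rw [h]
  refine (norm_add_le _ _).trans ?_
  rw [norm_mul, norm_mul, norm_turn, mul_one, Complex.norm_real, Complex.norm_real,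
    Real.norm_eq_abs, Real.norm_eq_abs]
  have h1 := dist_turn_le a b
  have h2 : |r| * ‖(turn a : ℂ) - turn b‖ ≤ 1 * ‖(turn a : ℂ) - turn b‖ :=
    mul_le_mul_of_nonneg_right hr (norm_nonneg _)
  linarith

theorem exists_gridPoint_near {q : ℕ} (hq : 0 < q) {z : ℂ} (hz : ‖z‖ < 1) :
    ∃ x : GridIndex, x.1 = q ∧ (1 / 4 : ℝ) ^ x.2.1 < 1 - ‖z‖ ∧ 1 - ‖z‖ ≤ 4 * (1 / 4 : ℝ) ^ x.2.1 ∧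
      ‖z - gridPoint x‖ ≤ 10 * (1 - ‖z‖) / q := by
  have hq0 : (0 : ℝ) < q := by exact_mod_cast hq
  obtain ⟨m, hm1, hm2⟩ := exists_nat_pow_near_of_lt_one (x := 1 - ‖z‖) (y := (1 / 4 : ℝ))
    (by linarith) (by linarith [norm_nonneg z]) (by norm_num) (by norm_num)
  set h := 1 - ‖z‖ with hh
  set n := m + 1 with hn
  set p : ℝ := (1 / 4 : ℝ) ^ n with hp
  have hp0 : 0 < p := by positivity
  have hm3 : h ≤ 4 * p := by
    rw [hp, hn, pow_succ]; linarith
  obtain ⟨t, ⟨ht0, ht1⟩, htz⟩ := exists_norm_smul_turn z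
  have hpn : p * (4 : ℝ) ^ n = 1 := by rw [hp, ← mul_pow]; norm_num
  have hMpos : (0 : ℝ) < ((q * 4 ^ n : ℕ) : ℝ) := by positivity
  have hj : ⌊t * (q * 4 ^ n : ℕ)⌋₊ < q * 4 ^ n := by
    rw [Nat.floor_lt (by positivity)]
    nlinarith
  -- `y ∈ (0, q]` is the real radial index of `z` in generation `n`. Rounding to `⌈y⌉₊ - 1` stays
  -- below `q` and costs at most `3 * h / q`; rounding the angle costs at most `7 * h / q`.
  set y := q * (h / p - 1) / 3 with hy
  have hyp : 1 < h / p := by rwa [one_lt_div hp0]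
  have hyp4 : h / p ≤ 4 := by rwa [div_le_iff₀ hp0]
  have hy0 : 0 < y := by
    have : 0 < h / p - 1 := by linarith
    positivity
  have hyq : y ≤ q := by
    rw [hy, div_le_iff₀ (by norm_num)]
    nlinarith
  have hc1 : 1 ≤ ⌈y⌉₊ := Nat.one_le_ceil_iff.2 hy0
  have hcq : ⌈y⌉₊ ≤ q := Nat.ceil_le.2 hyq
  refine ⟨⟨q, n, ⟨⌈y⌉₊ - 1, by omega⟩, ⟨_, hj⟩⟩, rfl, hm1, hm3, ?_⟩
  have hi1 : (((⌈y⌉₊ - 1 : ℕ) : ℝ)) = (⌈y⌉₊ : ℝ) - 1 := by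
    rw [Nat.cast_sub hc1, Nat.cast_one]
  have hlt := Nat.ceil_lt_add_one hy0.le
  have hle := Nat.le_ceil y
  have hzw : ∀ w, z - w = (‖z‖ : ℂ) * turn t - w := fun w => by rw [← htz]
  rw [hzw, gridPoint]
  refine (norm_ofReal_mul_turn_sub_le _ _ _ _ (by rw [abs_of_nonneg (norm_nonneg _)]; exact hz.le)).trans ?_
  rw [gridHeight]
  dsimp only
  rw [hi1, ← hp]
  have hhp : h = p * (1 + 3 * y / q) := by
    rw [hy]; field_simp; ring
  have e1 : |‖z‖ - (1 - p * (1 + 3 * ((⌈y⌉₊ : ℝ) - 1) / q))| ≤ 3 * h / q := by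
    have : ‖z‖ - (1 - p * (1 + 3 * ((⌈y⌉₊ : ℝ) - 1) / q)) =
        3 * p / q * ((⌈y⌉₊ : ℝ) - 1 - y) := by
      have : ‖z‖ = 1 - p * (1 + 3 * y / q) := by rw [← hhp, hh]; ring
      rw [this]; field_simp; ring
    rw [this, abs_mul, abs_of_nonneg (by positivity)]
    have h1 : |(⌈y⌉₊ : ℝ) - 1 - y| ≤ 1 := abs_le.2 ⟨by linarith, by linarith⟩
    calc 3 * p / q * |(⌈y⌉₊ : ℝ) - 1 - y| ≤ 3 * p / q * 1 := by gcongr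
      _ ≤ 3 * h / q := by rw [mul_one]; gcongr
  have e2 : 2 * Real.pi * |t - (⌊t * (q * 4 ^ n : ℕ)⌋₊ : ℝ) / (q * 4 ^ n : ℕ)| ≤ 7 * h / q := by
    have f1 := Nat.floor_le (a := t * (q * 4 ^ n : ℕ)) (by positivity)
    have f2 := Nat.lt_floor_add_one (t * (q * 4 ^ n : ℕ))
    have : t - (⌊t * (q * 4 ^ n : ℕ)⌋₊ : ℝ) / (q * 4 ^ n : ℕ) =
        (t * (q * 4 ^ n : ℕ) - ⌊t * (q * 4 ^ n : ℕ)⌋₊) / (q * 4 ^ n : ℕ) := by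
      field_simp
    rw [this, abs_div, abs_of_pos hMpos, abs_of_nonneg (by linarith)]
    have f3 : (t * (q * 4 ^ n : ℕ) - ⌊t * (q * 4 ^ n : ℕ)⌋₊) / (q * 4 ^ n : ℕ) ≤ p / q := by
      rw [div_le_div_iff₀ hMpos hq0]
      have : p * ((q * 4 ^ n : ℕ) : ℝ) = q := by
        push_cast; linear_combination (q : ℝ) * hpn
      rw [this]
      nlinarith
    calc _ ≤ 2 * Real.pi * (p / q) := by gcongr
      _ ≤ 7 * (h / q) := by
        gcongr
        linarith [Real.pi_lt_d2]
      _ = 7 * h / q := by ring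
  calc _ ≤ 3 * h / q + 7 * h / q := add_le_add e1 e2
    _ = 10 * h / q := by ring

theorem exists_gridSel_near (E : Set Circle) (N : ℕ → ℕ) {q : ℕ} (hq : 0 < q) :
    ∃ δ : ℝ, 0 < δ ∧ ∀ z ∈ disc, 1 - ‖z‖ < δ →
      16 * gridAperture q * circDist E z ^ 2 ≤ 1 - ‖z‖ →
      ∃ x, GridSel E N x ∧ pseudoDist z (gridPoint x) ≤ 10 / q := by
  have hK := one_le_gridAperture hq
  have hq1 : (1 : ℝ) ≤ q := by exact_mod_cast hq
  -- The first bound puts the generation of the nearby grid point above `N q`. The second absorbs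
  -- the quadratic error `200 * (1 - ‖z‖) ^ 2` in its squared distance to `E`, so that the point
  -- still satisfies the wider condition of aperture `gridAperture q`.
  refine ⟨min ((1 / 4) ^ (N q + 2)) (1 / (1600 * gridAperture q)), by positivity, ?_⟩
  intro z hz hδ hD
  rw [mem_disc] at hz
  obtain ⟨x, hx, h1, h2, h3⟩ := exists_gridPoint_near hq hz
  have hδ1 := hδ.trans_le (min_le_left _ _)
  have hδ2 := hδ.trans_le (min_le_right _ _)
  rw [lt_div_iff₀ (by positivity)] at hδ2
  have hN : N q + 2 < x.2.1 := by
    by_contra hcon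
    exact absurd (h1.trans hδ1) (not_lt.2 (pow_le_pow_of_le_one (by norm_num) (by norm_num) (not_lt.1 hcon)))
  have hpos : 0 < 1 - ‖z‖ := by linarith
  have h3' : ‖z - gridPoint x‖ ≤ 10 * (1 - ‖z‖) := h3.trans (div_le_self (by linarith) hq1)
  refine ⟨x, ⟨(congrArg N hx).trans_le (by omega), ?_⟩, ?_⟩
  · rw [hx]
    have h4 := circDist_le_add E (gridPoint x) z
    rw [norm_sub_rev] at h4
    have h5 := circDist_nonneg E (gridPoint x)
    have h6 := circDist_nonneg E z
    have h7 : circDist E (gridPoint x) ^ 2 ≤ 2 * circDist E z ^ 2 + 200 * (1 - ‖z‖) ^ 2 := by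
      have : circDist E (gridPoint x) ≤ circDist E z + 10 * (1 - ‖z‖) := by linarith
      nlinarith [sq_nonneg (circDist E z - 10 * (1 - ‖z‖))]
    have h8 : gridAperture q * circDist E (gridPoint x) ^ 2 ≤
        gridAperture q * (2 * circDist E z ^ 2 + 200 * (1 - ‖z‖) ^ 2) := by gcongr
    have h9 : (1 - ‖z‖) * (1600 * gridAperture q) * (1 - ‖z‖) ≤ 1 * (1 - ‖z‖) := by gcongr
    have := le_gridHeight x
    nlinarith
  · have hx2 : 2 ≤ x.2.1 := by omega
    have hg := norm_gridPoint hx2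
    have hg0 := gridHeight_pos x
    rw [pseudoDist, norm_div]
    have hg1 : ‖gridPoint x‖ ≤ 1 := by linarith
    have hden := one_sub_norm_le_norm_one_sub_conj_mul (z := z) hg1
    calc _ ≤ (10 * (1 - ‖z‖) / q) / (1 - ‖z‖) :=
          div_le_div₀ (by positivity) h3 hpos hden
      _ = 10 / q := by field_simp

/-! ### Sufficiency of the Beurling–Carleson condition -/

theorem summable_of_tsum_ofReal_le {ι : Type*} {f : ι → ℝ} (hf : ∀ i, 0 ≤ f i) {A : ℝ}
    (h : ∑' i, ENNReal.ofReal (f i) ≤ ENNReal.ofReal A) : Summable f := by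
  have h1 := ENNReal.summable_toReal (h.trans_lt ENNReal.ofReal_lt_top).ne
  exact h1.congr fun i => ENNReal.toReal_ofReal (hf i)

theorem sum_le_of_tsum_ofReal_le {ι : Type*} {f : ι → ℝ} (hf : ∀ i, 0 ≤ f i) {A : ℝ} (hA : 0 ≤ A)
    (h : ∑' i, ENNReal.ofReal (f i) ≤ ENNReal.ofReal A) (s : Finset ι) : ∑ i ∈ s, f i ≤ A := by
  rw [← ENNReal.ofReal_le_ofReal_iff hA, ENNReal.ofReal_sum_of_nonneg fun i _ => hf i]
  exact (ENNReal.sum_le_tsum s).trans h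

section Selected

variable {E : Set Circle} {N : ℕ → ℕ}

theorem GridSel.two_le (hN2 : ∀ q, 2 ≤ N q) {x : GridIndex} (hx : GridSel E N x) : 2 ≤ x.2.1 :=
  (hN2 _).trans hx.1

theorem GridSel.norm_lt_one (hN2 : ∀ q, 2 ≤ N q) {x : GridIndex} (hx : GridSel E N x) :
    ‖gridPoint x‖ < 1 := by
  rw [norm_gridPoint (hx.two_le hN2)]
  linarith [gridHeight_pos x]

theorem GridSel.ne_zero (hN2 : ∀ q, 2 ≤ N q) {x : GridIndex} (hx : GridSel E N x) :
    gridPoint x ≠ 0 := by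
  rw [← norm_pos_iff, norm_gridPoint (hx.two_le hN2)]
  linarith [gridHeight_lt_of_two_le (hx.two_le hN2)]

theorem summable_one_sub_norm_gridPoint (hN2 : ∀ q, 2 ≤ N q)
    (hmass : ∑' x : {x // GridSel E N x}, ENNReal.ofReal (gridHeight x) ≤ ENNReal.ofReal 2) :
    Summable fun x : {x // GridSel E N x} => 1 - ‖gridPoint x‖ := by
  refine (summable_of_tsum_ofReal_le (fun x => (gridHeight_pos x.1).le) hmass).congr fun x => ?_
  rw [norm_gridPoint (x.2.two_le hN2)]
  ring

/-- Parabolic regions touch the circle only on `E`: a zero at distance `s < 1` from `ζ` has height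
at most `s`, hence distance at most `√s` to `E`, which forces `circDist E ζ ^ 2 ≤ 4 * s`. -/
theorem exists_le_norm_sub_gridPoint (hN2 : ∀ q, 2 ≤ N q) {ζ : ℂ} (hζ : ‖ζ‖ = 1)
    (hD : 0 < circDist E ζ) :
    ∃ c : ℝ, 0 < c ∧ ∀ x : {x // GridSel E N x}, c ≤ ‖ζ - gridPoint x‖ := by
  refine ⟨min 1 (circDist E ζ ^ 2 / 4), by positivity, fun x => ?_⟩
  by_contra! hcon
  set s := ‖ζ - gridPoint x‖ with hs
  have hs1 := hcon.trans_le (min_le_left _ _)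
  have hs2 := hcon.trans_le (min_le_right _ _)
  have hs0 : 0 ≤ s := norm_nonneg _
  have hD1 : circDist E ζ ≤ circDist E (gridPoint x) + s := circDist_le_add E ζ (gridPoint x)
  have hh : gridHeight x ≤ s := by
    have h1 := norm_sub_norm_le ζ (gridPoint x)
    rw [hζ, norm_gridPoint (x.2.two_le hN2)] at h1
    linarith
  have hw : circDist E (gridPoint x) ^ 2 ≤ gridHeight x :=
    (le_mul_of_one_le_left (sq_nonneg _) (one_le_gridAperture (grid_fst_pos x.1))).trans x.2.2
  have hw0 := circDist_nonneg E (gridPoint x)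
  have : circDist E ζ ^ 2 ≤ 4 * s := by
    have h1 : circDist E ζ ^ 2 ≤ (circDist E (gridPoint x) + s) ^ 2 := by gcongr
    nlinarith [sq_nonneg (circDist E (gridPoint x) - s)]
  linarith

theorem isInner_blaschke_gridPoint (hE : IsClosed E) (hne : E.Nonempty) (h0 : arcLength E = 0)
    (hN2 : ∀ q, 2 ≤ N q)
    (hmass : ∑' x : {x // GridSel E N x}, ENNReal.ofReal (gridHeight x) ≤ ENNReal.ofReal 2) :
    IsInner (blaschke fun x : {x // GridSel E N x} => gridPoint x) := by
  have ha0 : ∀ x : {x // GridSel E N x}, gridPoint x ≠ 0 := fun x => x.2.ne_zero hN2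
  have ha1 : ∀ x : {x // GridSel E N x}, ‖gridPoint x‖ < 1 := fun x => x.2.norm_lt_one hN2
  have hsum := summable_one_sub_norm_gridPoint hN2 hmass
  refine ⟨differentiableOn_blaschke ha0 ha1 hsum,
    ⟨1, fun z hz => norm_blaschke_le_one ha0 ha1 hsum hz⟩, ?_⟩
  filter_upwards [ae_exp_notMem h0] with θ hθ
  have hD : 0 < circDist E (Circle.exp θ : ℂ) := by
    obtain ⟨ζ, hζ, h⟩ := exists_circDist_eq hE hne (Circle.exp θ : ℂ)
    rw [h, norm_pos_iff, sub_ne_zero]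
    intro heq
    exact hθ (Circle.coe_injective heq ▸ hζ)
  obtain ⟨c, hc, h⟩ := exists_le_norm_sub_gridPoint (N := N) hN2 (Circle.norm_coe _) hD
  exact exists_radial_limit_blaschke ha0 ha1 hsum (Circle.norm_coe _) hc h

end Selected

theorem le_pseudoDist_of_lt_pseudoInfDist {z w : ℂ} {A : Set ℂ} {ε : ℝ}
    (h : ENNReal.ofReal ε < pseudoInfDist z A) (hw : w ∈ A) : ε ≤ pseudoDist z w := by
  have h1 : ENNReal.ofReal ε < ENNReal.ofReal (pseudoDist z w) := h.trans_le (iInf₂_le w hw)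
  exact (ENNReal.ofReal_lt_ofReal_iff'.1 h1).1.le

theorem eta_pos_of_le {I : ℂ → ℂ} {ε c : ℝ} (hc : 0 < c)
    (h : ∀ z ∈ disc, ENNReal.ofReal ε < pseudoInfDist z (zeroSet I) → c ≤ ‖I z‖) :
    0 < eta I ε := by
  refine (ENNReal.ofReal_pos.2 hc).trans_le (le_iInf₂ fun z hz => ?_)
  rw [← ofReal_norm]
  exact ENNReal.ofReal_le_ofReal (h z hz.1 hz.2)

theorem isInner_one : IsInner fun _ => 1 :=
  ⟨differentiableOn_const 1, ⟨1, by simp⟩, .of_forall fun _ => ⟨1, by simp, tendsto_const_nhds⟩⟩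

theorem exp_neg_le_norm_of_neg_log_le {w : ℂ} (hw : w ≠ 0) {A : ℝ} (h : -Real.log ‖w‖ ≤ A) :
    Real.exp (-A) ≤ ‖w‖ :=
  (Real.le_log_iff_exp_le (norm_pos_iff.2 hw)).1 (by linarith)

/-- With no singular points the decay estimate holds for every `d`. Letting `d → ∞` shows that `S`
has modulus one. This case is separate because `circDist` to the empty set is `0`. -/
theorem IsSingularInner.isWepable_of_singularSet_eq_empty {S : ℂ → ℂ} (hS : IsSingularInner S)
    (h : singularSet S = ∅) : IsWepable S := by
  refine ⟨fun _ => 1, isInner_one, fun ε _ => eta_pos_of_le one_pos fun z hz _ => ?_⟩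
  rw [mul_one]
  have hu := hS.neg_log_norm_nonneg (z := 0) (by simp [mem_disc])
  have hlim : Tendsto (fun d : ℝ => 18 * (1 - ‖z‖) / d ^ 2 * -Real.log ‖S 0‖) atTop (𝓝 0) := by
    have h1 : Tendsto (fun d : ℝ => 18 * (1 - ‖z‖) / d ^ 2) atTop (𝓝 0) :=
      tendsto_const_nhds.div_atTop (tendsto_pow_atTop two_ne_zero)
    simpa using h1.mul_const (-Real.log ‖S 0‖)
  have hle : -Real.log ‖S z‖ ≤ 0 := by
    refine ge_of_tendsto hlim ?_
    filter_upwards [eventually_gt_atTop 0] with d hd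
    exact hS.neg_log_norm_le h.subset hz hd (by simp)
  simpa using exp_neg_le_norm_of_neg_log_le (hS.ne_zero z hz) hle

theorem isWepable_of_entropy_lt_top {E : Set Circle} (hE : IsClosed E) (hne : E.Nonempty)
    (h0 : arcLength E = 0) (hent : entropy E < ⊤) {S : ℂ → ℂ} (hS : IsSingularInner S)
    (hSE : singularSet S ⊆ E) : IsWepable S := by
  have hlay : ∑' n, volume (gridLayer E n) < ⊤ :=
    tsum_volume_layer_lt_top hE hne h0 hent (by norm_num)
  choose N hN2 hN using exists_level hlay
  have hmass := tsum_gridHeight_le hN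
  have hJ := isInner_blaschke_gridPoint hE hne h0 hN2 hmass
  have ha0 : ∀ x : {x // GridSel E N x}, gridPoint x ≠ 0 := fun x => x.2.ne_zero hN2
  have ha1 : ∀ x : {x // GridSel E N x}, ‖gridPoint x‖ < 1 := fun x => x.2.norm_lt_one hN2
  have hsum := summable_one_sub_norm_gridPoint hN2 hmass
  refine ⟨_, hJ, fun ε hε => ?_⟩
  obtain ⟨q, hq⟩ := exists_nat_gt (10 / ε)
  have hq0 : (0 : ℝ) < q := lt_trans (by positivity) hq
  have hqε : 10 / q < ε := by rwa [div_lt_comm₀ hq0 hε]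
  obtain ⟨δ, hδ, hnet⟩ := exists_gridSel_near E N (q := q) (by exact_mod_cast hq0)
  have hKpos : 0 < gridAperture q :=
    one_pos.trans_le (one_le_gridAperture (by exact_mod_cast hq0))
  set u := -Real.log ‖S 0‖ with hu
  have hu0 : 0 ≤ u := hS.neg_log_norm_nonneg (by simp [mem_disc])
  set L : ℝ := max (8 / δ) (2080 * (16 * gridAperture q)) with hL
  set M : ℝ := max (18 / δ) (18 * (16 * gridAperture q)) with hM
  have hL0 : 0 ≤ L := le_max_of_le_left (by positivity)
  refine eta_pos_of_le (c := Real.exp (-(M * u)) * Real.exp (-(L / ε ^ 2))) (by positivity) ?_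
  intro z hz hzε
  have hz1 := mem_disc.1 hz
  have hρ : ∀ x : {x // GridSel E N x}, ε ≤ pseudoDist z (gridPoint x) := fun x => by
    refine le_pseudoDist_of_lt_pseudoInfDist hzε ⟨mem_disc.2 (ha1 x), ?_⟩
    dsimp only
    rw [blaschke_eq_zero (fun x : {x // GridSel E N x} => gridPoint x) x, mul_zero]
  have hterm : ∀ x : {x // GridSel E N x}, 0 ≤ 1 - pseudoDist z (gridPoint x) ^ 2 := fun x => by
    have h1 := pseudoDist_le_one hz1.le (ha1 x).le
    nlinarith [pseudoDist_nonneg z (gridPoint x)]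
  suffices h : (-Real.log ‖S z‖ ≤ M * u) ∧ ∑' x : {x // GridSel E N x},
      ENNReal.ofReal (1 - pseudoDist z (gridPoint x) ^ 2) ≤ ENNReal.ofReal L by
    rw [norm_mul]
    exact mul_le_mul (exp_neg_le_norm_of_neg_log_le (hS.ne_zero z hz) h.1)
      (exp_le_norm_blaschke ha0 ha1 hsum hz hε hρ (sum_le_of_tsum_ofReal_le hterm hL0 h.2))
      (Real.exp_pos _).le (norm_nonneg _)
  have hh : 0 < 1 - ‖z‖ := by linarith
  -- Three cases: far from the circle both bounds are trivial; near it and inside the parabolic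
  -- region a zero lies closer than `ε`, which is excluded; near it and outside the region both
  -- estimates apply with `K = 16 * gridAperture q`.
  rcases le_or_gt δ (1 - ‖z‖) with hfar | hnear
  · constructor
    · have h1 := hS.neg_log_norm_le hSE hz hh fun ζ _ => by
        have := norm_sub_norm_le (ζ : ℂ) z
        rw [Circle.norm_coe, norm_sub_rev] at this
        exact this
      have h2 : 18 * (1 - ‖z‖) / (1 - ‖z‖) ^ 2 = 18 / (1 - ‖z‖) := by field_simp
      rw [h2] at h1
      refine h1.trans (mul_le_mul_of_nonneg_right (le_max_of_le_left ?_) hu0)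
      gcongr
    · refine (tsum_one_sub_pseudoDist_sq_le_div hN2 hmass hz1).trans (ENNReal.ofReal_le_ofReal ?_)
      exact le_max_of_le_left (by gcongr)
  · rcases le_or_gt (16 * gridAperture q * circDist E z ^ 2) (1 - ‖z‖) with hin | hout
    · obtain ⟨x, hx, hxz⟩ := hnet z hz hnear hin
      exact absurd (hρ ⟨x, hx⟩) (not_le.2 (hxz.trans_lt hqε))
    · have hDne : circDist E z ≠ 0 := by
        intro h
        rw [h] at hout
        norm_num at hout
        linarith
      have hD : 0 < circDist E z := (circDist_nonneg E z).lt_of_ne' hDne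
      constructor
      · have h1 := hS.neg_log_norm_le hSE hz hD fun ζ hζ => circDist_le_norm_sub hζ z
        refine h1.trans (mul_le_mul_of_nonneg_right (le_max_of_le_right ?_) hu0)
        rw [div_le_iff₀ (by positivity)]
        linarith
      · exact (tsum_one_sub_pseudoDist_sq_le hN2 hmass hz1 hout.le).trans
          (ENNReal.ofReal_le_ofReal (le_max_right _ _))

end Wepable

end

theorem theorem1 (E : Set Circle) (hE : IsClosed E) :
    (∀ S : ℂ → ℂ, Wepable.IsSingularInner S → Wepable.singularSet S ⊆ E → Wepable.IsWepable S) ↔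
      (Wepable.arcLength E = 0 ∧ Wepable.entropy E < ⊤) := by
  refine ⟨Wepable.arcLength_eq_zero_and_entropy_lt_top hE, fun ⟨h0, hent⟩ S hS hSE => ?_⟩
  rcases E.eq_empty_or_nonempty with rfl | hne
  · exact hS.isWepable_of_singularSet_eq_empty (subset_empty_iff.1 hSE)
  · exact Wepable.isWepable_of_entropy_lt_top hE hne h0 hent hS hSE
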